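/- **Setting.** Fix $L\ge 2$ and $\rho>0$. Let $B_L\subset C_L$ be the real and complex Grassmann algebras on generators $e_1,\dots,e_L$, with norm $\|\sum_M y_Me_M\|=\sum_M|y_M|$ and body map $\epsilon$. Let $B_L^{3|2}$ be the normed space of points $(x^1,x^2,x^3,\theta^4,\theta^5)$ with $x^k\in B_L$ even and $\theta^\alpha\in B_L$ odd. An $\mathcal H^\infty$-function on $B_L^{3|2}$ is a function $f=f_\emptyset+f_4\theta^4+f_5\theta^5+f_{45}\theta^4\theta^5$ with values in $C_L$ whose coefficients are the expansions $\sum_N\frac1{N!}(\partial^N g)(\epsilon(x))\,(x-\epsilon(x))^N$ of smooth functions $g:\mathbb R^3\to\mathbb C$. Let $S_\rho=\{\sum_k (x^k)^2+2\theta^4\theta^5=\rho^2\}$ be the $(2|2)$-supersphere, let $\mathcal H^\infty(S_\rho)$ be the algebra of restrictions to $S_\rho$ of $\mathcal H^\infty$-functions on $B_L^{3|2}$, and let $\mathcal P(S_\rho)$ be the subalgebra of restrictions of polynomials in $x^k,\theta^\alpha$ with complex coefficients. The Fréchet topology of $\mathcal H^\infty(S_\rho)$ is defined by the seminorms $$\|\bar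 f\|_{K,n}=\inf_{f|_{S_\rho}=\bar f}\ \max_{p\in K,\ |N|\le n,\ M}\ \big\|\big((\partial/\partial x)^N(\partial/\partial\theta)^M f\big)(p)\big\|,\qquad K\subset B_L^{3|2}\text{ compact},\ n\in\mathbb N_0 .$$ The Lie superalgebra $osp(1|2)$, with even basis $J_1,J_2,J_3$ and odd basis $J_4,J_5$, acts on $\mathcal H^\infty$-functions by $$J_i=-i\sum_{j,k}\varepsilon_{ijk}x^j\tfrac{\partial}{\partial x^k}+\tfrac12\sum_{\alpha,\beta}(\sigma_i)_{\alpha\beta}\theta^\alpha\tfrac{\partial}{\partial\theta^\beta},\qquad J_\alpha=\tfrac12\sum_{k,\beta}\Big(i x^k(\sigma_2\sigma_k)_{\alpha\beta}\tfrac{\partial}{\partial\theta^\beta}-\theta^\beta(\sigma_k)_{\beta\alpha}\tfrac{\partial}{\partial x^k}\Big),$$ where $\sigma_k$ are the Pauli matrices; it acts on $\mathcal H^\infty(S_\rho)$ through representatives. Put $J_\pm=J_1\pm iJ_2$. For $j\in\frac12\mathbb N_0$ let $Y^j_{jj}\in\mathcal P(S_\rho)$ be the class of $$\frac{\sqrt{(2j)!}}{2^j\,j!\,\rho^j}(x^1+ix^2)^j\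 \ (j\in\mathbb N_0),\qquad \frac{\sqrt{(2j)!}}{2^{j-\frac12}\Gamma(j+\frac12)\rho^{j+\frac32}}(x^1+ix^2)^{j-\frac12}\big(x^3\theta^4+(x^1+ix^2)\theta^5\big)\ \ (j\in\mathbb N_0+\tfrac12),$$ let $V_j$ be the $osp(1|2)$-module generated by $Y^j_{jj}$, and let $\mathcal H_q=\sum_{j\le q}V_j$. For $\mu\in\{0,1\}$, $l=j-\frac\mu2\ge0$ and $m\in\{-l,-l+1,\dots,l\}$ the superspherical harmonics are $$Y^j_{lm}=\sqrt{\tfrac{4^{2(j-l)}\Gamma(l+m+1)}{\Gamma(2j+1)\Gamma(l-m+1)}}\;J_-^{\,l-m}J_5^{\,\mu}\,Y^j_{jj}.$$ Let $V(\frac q2,\bar1)$ be the irreducible graded $osp(1|2)$-module of highest weight $\frac q2$ with odd highest weight vector (of dimension $2q+1$); $osp(1|2)$ acts on $\mathrm{End}\,V(\frac q2,\bar1)$ by graded commutators $\mathrm{ad}$. For $j\in\frac12\mathbb N_0$, $j\le q$, the noncommutative superspherical harmonics $Y^{(q)j}_{lm}\in\mathrm{End}\,V(\frac q2,\bar1)$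 are given by the same formula with $\mathrm{ad}J_-,\mathrm{ad}J_5$ in place of $J_-,J_5$, applied to $$Y^{(q)j}_{jj}=\sqrt{\tfrac{2^j(2j-1)!!\,\Gamma(q-j+1)}{\Gamma(j+1)\Gamma(q+j+1)}}\,J_+^{\,j}\ \ (j\in\mathbb N_0),$$ $$Y^{(q)j}_{jj}=\tfrac1{q+\frac12}\sqrt{\tfrac{2^{j+\frac72}(2j)!!\,\Gamma(q-j+\frac12)}{\Gamma(j+\frac12)\Gamma(q+j+\frac32)}}\,J_+^{\,j-\frac12}\big[(J_3-\tfrac34)J_4+J_+J_5\big]\ \ (j\in\mathbb N_0+\tfrac12).$$ **Proposition 3.** For every $q\in\mathbb N_0$ there is a unique linear isomorphism $\psi_q:\mathcal H_q\to\mathrm{End}\,V(\frac q2,\bar1)$ with $\psi_q(Y^j_{lm})=Y^{(q)j}_{lm}$ for all superspherical harmonics with $j\le q$, and it is an even isomorphism of $osp(1|2)$-modules. With $\iota_{q'q}:\mathcal H_q\hookrightarrow\mathcal H_{q'}$ the inclusions, the maps $\eta_{q'q}=\psi_{q'}\circ\iota_{q'q}\circ\psi_q^{-1}$ ($q\le q'$)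 make the algebras $\mathrm{End}\,V(\frac q2,\bar1)$ a directed system, and this system has a graded-commutative limit: any $f,f'\in\mathcal P(S_\rho)$ lie in $\mathcal H_q$ for all sufficiently large $q$, and $$\lim_{q\to\infty}\psi_q^{-1}\big(\psi_q(f)\,\psi_q(f')\big)=f f'$$ in the Fréchet topology of $\mathcal H^\infty(S_\rho)$. -/

import Mathlib

open scoped ContDiff TensorProduct

noncomputable section

namespace FuzzySupersphere

/-! ### Grassmann algebras and the vector superspace -/

/-- The complex Grassmann algebra `C_L` on `L` generators. -/
abbrev Grassmann (L : ℕ) : Type := ExteriorAlgebra ℂ (Fin L → ℂ)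

/-- The basis of monomials `e_M = e_{i₁} ⋯ e_{iₚ}`, `i₁ < ⋯ < iₚ`. -/
def monomialBasis (L : ℕ) : Module.Basis (Finset (Fin L)) ℂ (Grassmann L) :=
  (Pi.basisFun ℂ (Fin L)).ExteriorAlgebra

def coeff {L : ℕ} (y : Grassmann L) (M : Finset (Fin L)) : ℂ := (monomialBasis L).repr y M

theorem eq_sum_coeff {L : ℕ} (y : Grassmann L) : y = ∑ M, coeff y M • monomialBasis L M :=
  ((monomialBasis L).sum_repr y).symm

theorem monomialBasis_mem (L : ℕ) (M : Finset (Fin L)) :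
    monomialBasis L M ∈ LinearMap.range (ExteriorAlgebra.ι ℂ (M := Fin L → ℂ)) ^ M.card := by
  unfold monomialBasis
  rw [ExteriorAlgebra.basis_apply_ofCard _ rfl]
  exact ExteriorAlgebra.ιMulti_range ℂ _ ⟨_, rfl⟩

theorem ι_mul_pow {L n : ℕ} (v : Fin L → ℂ) (y : Grassmann L)
    (hy : y ∈ LinearMap.range (ExteriorAlgebra.ι ℂ (M := Fin L → ℂ)) ^ n) :
    ExteriorAlgebra.ι ℂ v * y = (-1 : ℂ) ^ n • (y * ExteriorAlgebra.ι ℂ v) := by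
  induction hy using Submodule.pow_induction_on_left' with
  | algebraMap r => simp [Algebra.commutes]
  | add x y i hx hy ihx ihy => rw [mul_add, ihx, ihy, add_mul, smul_add]
  | mem_mul m hm i x hx ih =>
    obtain ⟨w, rfl⟩ := hm
    have h := eq_neg_of_add_eq_zero_left (ExteriorAlgebra.ι_add_mul_swap (R := ℂ) v w)
    rw [← mul_assoc, h, neg_mul, mul_assoc, ih, pow_succ]
    simp [mul_assoc]

theorem mul_swap {L m n : ℕ} (x y : Grassmann L)
    (hx : x ∈ LinearMap.range (ExteriorAlgebra.ι ℂ (M := Fin L → ℂ)) ^ m)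
    (hy : y ∈ LinearMap.range (ExteriorAlgebra.ι ℂ (M := Fin L → ℂ)) ^ n) :
    x * y = (-1 : ℂ) ^ (m * n) • (y * x) := by
  induction hx using Submodule.pow_induction_on_left' with
  | algebraMap r => simp [Algebra.commutes]
  | add x x' i hx hx' ihx ihx' => rw [add_mul, ihx, ihx', mul_add, smul_add]
  | mem_mul v hv i x hx ih =>
    obtain ⟨w, rfl⟩ := hv
    rw [mul_assoc, ih, mul_smul_comm, ← mul_assoc, ι_mul_pow w y hy, smul_mul_assoc, smul_smul,
      mul_assoc, ← pow_add]
    congr 2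
    rw [Nat.succ_eq_add_one]
    ring

/-- Only monomials of even degree occur. -/
def IsEven {L : ℕ} (y : Grassmann L) : Prop := ∀ M, ¬ Even M.card → coeff y M = 0
/-- Only monomials of odd degree occur. -/
def IsOdd {L : ℕ} (y : Grassmann L) : Prop := ∀ M, Even M.card → coeff y M = 0

theorem IsEven.commute {L : ℕ} {y : Grassmann L} (hy : IsEven y) (z : Grassmann L) :
    Commute y z := by
  unfold Commute SemiconjBy
  rw [eq_sum_coeff y, eq_sum_coeff z, Finset.sum_mul_sum, Finset.sum_mul_sum, Finset.sum_comm]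
  refine Finset.sum_congr rfl fun N _ => Finset.sum_congr rfl fun M _ => ?_
  by_cases hM : Even M.card
  · rw [smul_mul_smul_comm, smul_mul_smul_comm,
      mul_swap _ _ (monomialBasis_mem L M) (monomialBasis_mem L N), (hM.mul_right _).neg_one_pow,
      one_smul, mul_comm (coeff y M)]
  · simp [hy M hM]

theorem IsOdd.anticomm {L : ℕ} {y z : Grassmann L} (hy : IsOdd y) (hz : IsOdd z) :
    y * z = -(z * y) := by
  rw [eq_sum_coeff y, eq_sum_coeff z, Finset.sum_mul_sum, Finset.sum_mul_sum, Finset.sum_comm,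
    ← Finset.sum_neg_distrib]
  refine Finset.sum_congr rfl fun N _ => ?_
  rw [← Finset.sum_neg_distrib]
  refine Finset.sum_congr rfl fun M _ => ?_
  by_cases hM : Even M.card
  · simp [hy M hM]
  by_cases hN : Even N.card
  · simp [hz N hN]
  rw [Nat.not_even_iff_odd] at hM hN
  rw [smul_mul_smul_comm, smul_mul_smul_comm,
    mul_swap _ _ (monomialBasis_mem L M) (monomialBasis_mem L N), (hM.mul hN).neg_one_pow,
    mul_comm (coeff y M)]
  simp

theorem IsOdd.mul_self {L : ℕ} {y : Grassmann L} (hy : IsOdd y) : y * y = 0 := by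
  have h : (2 : ℂ) • (y * y) = 0 := by
    rw [two_smul]
    nth_rewrite 1 [hy.anticomm hy]
    simp
  simpa using h

theorem range_pow_eq_bot (L : ℕ) (n : ℕ) (hn : L < n) :
    LinearMap.range (ExteriorAlgebra.ι ℂ (M := Fin L → ℂ)) ^ n = ⊥ := by
  have h := ExteriorAlgebra.ιMulti_span_fixedDegree ℂ (M := Fin L → ℂ) n
  rw [eq_bot_iff]
  change ⋀[ℂ]^n (Fin L → ℂ) ≤ ⊥
  rw [← h, Submodule.span_le]
  rintro _ ⟨v, rfl⟩
  rw [SetLike.mem_coe, Submodule.mem_bot]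
  refine AlternatingMap.map_linearDependent _ v fun hv => ?_
  have := hv.fintype_card_le_finrank
  simp at this
  omega

theorem pow_eq_zero_of_body {L : ℕ} {y : Grassmann L} (hy : coeff y ∅ = 0) : y ^ (L + 1) = 0 := by
  set R := LinearMap.range (ExteriorAlgebra.ι ℂ (M := Fin L → ℂ)) with hR
  -- the filtration by degree
  let I : ℕ → Submodule ℂ (Grassmann L) := fun k => ⨆ n : {n : ℕ // k ≤ n}, R ^ n.1
  have h1 : y ∈ I 1 := by
    rw [eq_sum_coeff y]
    refine Submodule.sum_mem _ fun M _ => ?_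
    rcases M.eq_empty_or_nonempty with rfl | hM
    · simp [hy]
    · exact Submodule.smul_mem _ _ (Submodule.mem_iSup_of_mem ⟨M.card, hM.card_pos⟩
        (monomialBasis_mem L M))
  have hmul : ∀ k, I k * I 1 ≤ I (k + 1) := by
    intro k
    simp only [I, Submodule.iSup_mul, Submodule.mul_iSup]
    refine iSup_le fun a => iSup_le fun b => ?_
    rw [← pow_add]
    exact le_iSup (fun n : {n : ℕ // k + 1 ≤ n} => R ^ n.1) ⟨b.1 + a.1, by omega⟩
  have hp : ∀ k, y ^ (k + 1) ∈ I (k + 1) := by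
    intro k
    induction k with
    | zero => simpa using h1
    | succ k ih => rw [pow_succ]; exact hmul _ (Submodule.mul_mem_mul ih h1)
  have h0 : I (L + 1) = ⊥ := by
    rw [eq_bot_iff]
    exact iSup_le fun n => (range_pow_eq_bot L n.1 (by omega)).le
  have := hp L
  rwa [h0, Submodule.mem_bot] at this

/-- The norm `‖∑ y_M e_M‖ = ∑ |y_M|`. -/
def gnorm {L : ℕ} (y : Grassmann L) : ℝ := ∑ M, ‖coeff y M‖

/-- The body (augmentation) map `ε`. -/
def body {L : ℕ} (y : Grassmann L) : ℂ := coeff y ∅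

def soul {L : ℕ} (y : Grassmann L) : Grassmann L := y - algebraMap ℂ (Grassmann L) (body y)

theorem coeff_sub {L : ℕ} (y z : Grassmann L) (M : Finset (Fin L)) :
    coeff (y - z) M = coeff y M - coeff z M := by
  simp [coeff]

theorem algebraMap_eq_smul {L : ℕ} (c : ℂ) :
    algebraMap ℂ (Grassmann L) c = c • monomialBasis L ∅ := by
  unfold monomialBasis
  rw [ExteriorAlgebra.basis_apply_ofCard _ Finset.card_empty, Algebra.algebraMap_eq_smul_one]
  exact congrArg (c • ·) (ExteriorAlgebra.ιMulti_zero_apply _).symm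

theorem coeff_algebraMap {L : ℕ} (c : ℂ) (M : Finset (Fin L)) :
    coeff (algebraMap ℂ (Grassmann L) c) M = if M = ∅ then c else 0 := by
  rw [algebraMap_eq_smul, coeff, map_smul, Module.Basis.repr_self]
  simp [Finsupp.single_apply, eq_comm]

theorem soul_pow_eq_zero {L : ℕ} (y : Grassmann L) : soul y ^ (L + 1) = 0 :=
  pow_eq_zero_of_body (by simp [soul, coeff_sub, coeff_algebraMap, body])

theorem IsEven.soul {L : ℕ} {y : Grassmann L} (hy : IsEven y) : IsEven (soul y) := by
  intro M hM
  have : M ≠ ∅ := by rintro rfl; simp at hM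
  simp [FuzzySupersphere.soul, coeff_sub, coeff_algebraMap, this, hy M hM]

/-- Membership in the real Grassmann algebra `B_L ⊆ C_L`: all coefficients are real. -/
def IsReal {L : ℕ} (y : Grassmann L) : Prop := ∀ M, (coeff y M).im = 0

/-- The real vector superspace of dimension `(3|2)`: three even and two odd real Grassmann
coordinates; `θ 0`, `θ 1` are the coordinates `θ⁴`, `θ⁵`. -/
structure SuperSpace (L : ℕ) where
  x : Fin 3 → Grassmann L
  θ : Fin 2 → Grassmann L
  x_real : ∀ k, IsReal (x k)
  x_even : ∀ k, IsEven (x k)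
  θ_real : ∀ α, IsReal (θ α)
  θ_odd : ∀ α, IsOdd (θ α)

theorem gnorm_triangle {L : ℕ} (a b c : Grassmann L) :
    gnorm (a - c) ≤ gnorm (a - b) + gnorm (b - c) := by
  simp only [gnorm, coeff_sub, ← Finset.sum_add_distrib]
  exact Finset.sum_le_sum fun M _ => norm_sub_le_norm_sub_add_norm_sub _ _ _

theorem gnorm_sub_comm {L : ℕ} (a b : Grassmann L) : gnorm (a - b) = gnorm (b - a) := by
  simp only [gnorm, coeff_sub, norm_sub_rev]

theorem gnorm_nonneg {L : ℕ} (a : Grassmann L) : 0 ≤ gnorm a :=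
  Finset.sum_nonneg fun _ _ => norm_nonneg _

theorem eq_of_gnorm_sub {L : ℕ} {a b : Grassmann L} (h : gnorm (a - b) = 0) : a = b := by
  rw [gnorm, Finset.sum_eq_zero_iff_of_nonneg fun _ _ => norm_nonneg _] at h
  refine (monomialBasis L).ext_elem fun M => ?_
  have := h M (Finset.mem_univ M)
  rwa [coeff_sub, norm_eq_zero, sub_eq_zero] at this

/-- The fine topology: the metric of the norm `∑ ‖xᵏ‖ + ∑ ‖θᵅ‖`. -/
instance (L : ℕ) : MetricSpace (SuperSpace L) where
  dist p p' := ∑ k, gnorm (p.x k - p'.x k) + ∑ α, gnorm (p.θ α - p'.θ α)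
  dist_self p := by simp [gnorm, coeff]
  dist_comm p p' := by simp only [gnorm_sub_comm]
  dist_triangle p p' p'' := by
    have h1 := Finset.sum_le_sum fun k (_ : k ∈ Finset.univ) =>
      gnorm_triangle (p.x k) (p'.x k) (p''.x k)
    have h2 := Finset.sum_le_sum fun α (_ : α ∈ Finset.univ) =>
      gnorm_triangle (p.θ α) (p'.θ α) (p''.θ α)
    rw [Finset.sum_add_distrib] at h1 h2
    linarith
  eq_of_dist_eq_zero := by
    intro p p' h
    have h1 : 0 ≤ ∑ k, gnorm (p.x k - p'.x k) := Finset.sum_nonneg fun _ _ => gnorm_nonneg _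
    have h2 : 0 ≤ ∑ α, gnorm (p.θ α - p'.θ α) := Finset.sum_nonneg fun _ _ => gnorm_nonneg _
    have h3 : ∑ k, gnorm (p.x k - p'.x k) = 0 := by linarith
    have h4 : ∑ α, gnorm (p.θ α - p'.θ α) = 0 := by linarith
    rw [Finset.sum_eq_zero_iff_of_nonneg fun _ _ => gnorm_nonneg _] at h3 h4
    cases p
    cases p'
    rw [SuperSpace.mk.injEq]
    exact ⟨funext fun k => eq_of_gnorm_sub (h3 k (Finset.mem_univ k)),
      funext fun α => eq_of_gnorm_sub (h4 α (Finset.mem_univ α))⟩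

/-- The supersphere `∑ (xᵏ)² + 2 θ⁴ θ⁵ = ρ²`. -/
def superSphere (L : ℕ) (ρ : ℝ) : Set (SuperSpace L) :=
  {p | ∑ k, p.x k ^ 2 + 2 * p.θ 0 * p.θ 1 - algebraMap ℂ (Grassmann L) ((ρ : ℂ) ^ 2) = 0}

/-! ### Smooth functions and their Z-expansion -/

/-- The algebra of smooth complex functions on `ℝ³`. -/
def Smooth : Subalgebra ℂ ((Fin 3 → ℝ) → ℂ) where
  carrier := {f | ContDiff ℝ ∞ f}
  mul_mem' := by
    intro f g hf hg
    have hf' : ContDiff ℝ ∞ f := hf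
    have hg' : ContDiff ℝ ∞ g := hg
    exact hf'.mul hg'
  add_mem' := by
    intro f g hf hg
    have hf' : ContDiff ℝ ∞ f := hf
    have hg' : ContDiff ℝ ∞ g := hg
    exact hf'.add hg'
  algebraMap_mem' c := by
    change ContDiff ℝ ∞ fun _ => c
    exact contDiff_const

theorem smooth_contDiff (f : Smooth) : ContDiff ℝ ∞ f.1 := f.2

theorem smooth_differentiableAt (f : Smooth) (u : Fin 3 → ℝ) : DifferentiableAt ℝ f.1 u :=
  ((smooth_contDiff f).differentiable (by simp)) u

/-- The partial derivative in the direction of the `k`-th coordinate. -/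
def partialDeriv (k : Fin 3) : Smooth →ₗ[ℂ] Smooth where
  toFun f := ⟨fun u => fderiv ℝ f.1 u (Pi.single k 1),
    ((smooth_contDiff f).fderiv_right (m := ∞) (by simp)).clm_apply contDiff_const⟩
  map_add' f g := by
    ext u
    change fderiv ℝ (f.1 + g.1) u _ = fderiv ℝ f.1 u _ + fderiv ℝ g.1 u _
    rw [fderiv_add (smooth_differentiableAt f u) (smooth_differentiableAt g u)]
    rfl
  map_smul' c f := by
    ext u
    change fderiv ℝ (c • f.1) u _ = c • fderiv ℝ f.1 u _
    rw [fderiv_const_smul (smooth_differentiableAt f u)]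
    rfl

theorem partialDeriv_mul (k : Fin 3) (f g : Smooth) :
    partialDeriv k (f * g) = partialDeriv k f * g + f * partialDeriv k g := by
  ext u
  change fderiv ℝ (f.1 * g.1) u _ = fderiv ℝ f.1 u _ * g.1 u + f.1 u * fderiv ℝ g.1 u _
  rw [fderiv_mul (smooth_differentiableAt f u) (smooth_differentiableAt g u)]
  simp
  ring

theorem leibniz_pow {A : Type*} [CommRing A] [Algebra ℂ A] (D : Module.End ℂ A)
    (hD : ∀ f g, D (f * g) = D f * g + f * D g) (n : ℕ) (f g : A) :
    ((n.factorial : ℂ)⁻¹) • (D ^ n) (f * g) = ∑ ij ∈ Finset.HasAntidiagonal.antidiagonal n,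
      (((ij.1.factorial : ℂ)⁻¹) • (D ^ ij.1) f) * (((ij.2.factorial : ℂ)⁻¹) • (D ^ ij.2) g) := by
  let m : TensorProduct ℂ A A →ₗ[ℂ] A := LinearMap.mul' ℂ A
  let DR : Module.End ℂ (TensorProduct ℂ A A) := D.rTensor A
  let DL : Module.End ℂ (TensorProduct ℂ A A) := D.lTensor A
  have hcomm : Commute DR DL := by
    ext
    simp [DL, DR]
  have hm : ∀ t, D (m t) = m ((DR + DL) t) := by
    intro t
    induction t with
    | zero => simp
    | tmul a b => simp [m, DR, DL, hD]
    | add a b ha hb => rw [map_add, map_add, ha, hb, ← map_add, ← map_add]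
  have hpow : ∀ k t, (D ^ k) (m t) = m (((DR + DL) ^ k) t) := by
    intro k
    induction k with
    | zero => simp
    | succ k ih => intro t; rw [pow_succ, pow_succ, Module.End.mul_apply, Module.End.mul_apply, hm, ih]
  have hR : ∀ k a b, (DR ^ k) (a ⊗ₜ[ℂ] b) = ((D ^ k) a) ⊗ₜ[ℂ] b := by
    intro k a b
    induction k with
    | zero => simp
    | succ k _ => simp [pow_succ', DR]
  have hL : ∀ k a b, (DL ^ k) (a ⊗ₜ[ℂ] b) = a ⊗ₜ[ℂ] ((D ^ k) b) := by
    intro k a b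
    induction k with
    | zero => simp
    | succ k _ => simp [pow_succ', DL]
  have h := hpow n (f ⊗ₜ[ℂ] g)
  rw [show m (f ⊗ₜ[ℂ] g) = f * g from LinearMap.mul'_apply] at h
  rw [h, hcomm.add_pow', LinearMap.sum_apply, map_sum, Finset.smul_sum]
  refine Finset.sum_congr rfl fun ij hij => ?_
  rw [LinearMap.smul_apply, Module.End.mul_apply, hL, hR, map_nsmul,
    show m (((D ^ ij.1) f) ⊗ₜ[ℂ] ((D ^ ij.2) g)) = _ from LinearMap.mul'_apply,
    smul_mul_smul_comm, ← Nat.cast_smul_eq_nsmul ℂ, smul_smul]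
  congr 1
  rw [← Finset.HasAntidiagonal.mem_antidiagonal.mp hij, Nat.cast_add_choose]
  have h1 : (((ij.1 + ij.2).factorial : ℕ) : ℂ) ≠ 0 := by exact_mod_cast Nat.factorial_ne_zero _
  field_simp

theorem taylor_mul {A C : Type*} [CommRing A] [Algebra ℂ A] [Ring C] [Algebra ℂ C]
    (D : Module.End ℂ A) (hD : ∀ f g, D (f * g) = D f * g + f * D g)
    (φ : A →ₗ[ℂ] C) (hφ : ∀ f g, φ (f * g) = φ f * φ g) (s : C) (hc : ∀ c, Commute s c) (m : ℕ)
    (hs : s ^ (m + 1) = 0) (f g : A) :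
    ∑ n ∈ Finset.range (m + 1), ((n.factorial : ℂ)⁻¹) • (φ ((D ^ n) (f * g)) * s ^ n) =
      (∑ n ∈ Finset.range (m + 1), ((n.factorial : ℂ)⁻¹) • (φ ((D ^ n) f) * s ^ n)) *
      ∑ n ∈ Finset.range (m + 1), ((n.factorial : ℂ)⁻¹) • (φ ((D ^ n) g) * s ^ n) := by
  have key : ∀ n, ((n.factorial : ℂ)⁻¹) • (φ ((D ^ n) (f * g)) * s ^ n) =
      ∑ ij ∈ Finset.HasAntidiagonal.antidiagonal n, (((ij.1.factorial : ℂ)⁻¹) • (φ ((D ^ ij.1) f) * s ^ ij.1)) *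
        (((ij.2.factorial : ℂ)⁻¹) • (φ ((D ^ ij.2) g) * s ^ ij.2)) := by
    intro n
    rw [← smul_mul_assoc, ← map_smul, leibniz_pow D hD, map_sum, Finset.sum_mul]
    refine Finset.sum_congr rfl fun ij hij => ?_
    rw [hφ, map_smul, map_smul, ← Finset.HasAntidiagonal.mem_antidiagonal.mp hij, pow_add]
    simp only [smul_mul_smul_comm]
    rw [smul_mul_assoc]
    congr 1
    have := ((hc (φ ((D ^ ij.2) g))).pow_left ij.1).eq
    rw [mul_assoc, mul_assoc, ← mul_assoc _ (s ^ ij.1), ← this, mul_assoc]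
  set a : ℕ → C := fun i => ((i.factorial : ℂ)⁻¹) • (φ ((D ^ i) f) * s ^ i) with ha
  set b : ℕ → C := fun j => ((j.factorial : ℂ)⁻¹) • (φ ((D ^ j) g) * s ^ j) with hb
  have hab : ∀ i j, m < i + j → a i * b j = 0 := by
    intro i j hij
    have := ((hc (φ ((D ^ j) g))).pow_left i).eq
    simp only [ha, hb, smul_mul_smul_comm]
    rw [mul_assoc, ← mul_assoc (s ^ i), this, mul_assoc, ← pow_add,
      pow_eq_zero_of_le (show m + 1 ≤ i + j by omega) hs]
    simp
  rw [Finset.sum_congr rfl fun n _ => key n]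
  change ∑ n ∈ Finset.range (m + 1), ∑ ij ∈ Finset.HasAntidiagonal.antidiagonal n,
    a ij.1 * b ij.2 = _
  rw [Finset.sum_mul_sum, ← Finset.sum_product', Finset.sum_sigma']
  refine Finset.sum_of_injOn (fun t => t.2) ?_ ?_ ?_ ?_
  · rintro ⟨n, i, j⟩ h ⟨n', i', j'⟩ h' e
    simp only [Finset.coe_sigma, Set.mem_sigma_iff, Finset.mem_coe,
      Finset.HasAntidiagonal.mem_antidiagonal] at h h'
    simp only [Prod.mk.injEq] at e
    obtain ⟨rfl, rfl⟩ := e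
    obtain ⟨-, rfl⟩ := h
    obtain ⟨-, rfl⟩ := h'
    rfl
  · rintro ⟨n, i, j⟩ h
    simp only [Finset.coe_sigma, Set.mem_sigma_iff, Finset.mem_coe,
      Finset.HasAntidiagonal.mem_antidiagonal, Finset.mem_range] at h
    simp only [Finset.coe_product, Set.mem_prod, Finset.mem_coe, Finset.mem_range]
    omega
  · rintro ⟨i, j⟩ h h'
    refine hab i j ?_
    by_contra hlt
    refine h' ⟨⟨i + j, (i, j)⟩, ?_, rfl⟩
    simp only [Finset.coe_sigma, Set.mem_sigma_iff, Finset.mem_coe,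
      Finset.HasAntidiagonal.mem_antidiagonal, Finset.mem_range, and_true]
    omega
  · intro t _
    rfl

/-- The body map of the superspace onto `ℝ³`. -/
def bodyPoint {L : ℕ} (p : SuperSpace L) : Fin 3 → ℝ := fun k => (body (p.x k)).re

def evalBody {L : ℕ} (p : SuperSpace L) : Smooth →ₗ[ℂ] Grassmann L where
  toFun f := algebraMap ℂ (Grassmann L) (f.1 (bodyPoint p))
  map_add' f g := by simp
  map_smul' c f := by simp [Algebra.smul_def]

def taylorStep {L : ℕ} (p : SuperSpace L) (k : Fin 3) (φ : Smooth →ₗ[ℂ] Grassmann L) :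
    Smooth →ₗ[ℂ] Grassmann L :=
  ∑ n ∈ Finset.range (L + 1), ((n.factorial : ℂ)⁻¹) •
    (LinearMap.mulRight ℂ (soul (p.x k) ^ n) ∘ₗ φ ∘ₗ (partialDeriv k ^ n : Module.End ℂ Smooth))

theorem taylorStep_apply {L : ℕ} (p : SuperSpace L) (k : Fin 3) (φ : Smooth →ₗ[ℂ] Grassmann L)
    (f : Smooth) : taylorStep p k φ f = ∑ n ∈ Finset.range (L + 1),
      ((n.factorial : ℂ)⁻¹) • (φ ((partialDeriv k ^ n : Module.End ℂ Smooth) f) *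
        soul (p.x k) ^ n) := by
  simp [taylorStep]

theorem taylorStep_mul {L : ℕ} (p : SuperSpace L) (k : Fin 3) (φ : Smooth →ₗ[ℂ] Grassmann L)
    (hφ : ∀ f g, φ (f * g) = φ f * φ g) (f g : Smooth) :
    taylorStep p k φ (f * g) = taylorStep p k φ f * taylorStep p k φ g := by
  simp only [taylorStep_apply]
  exact taylor_mul (partialDeriv k) (partialDeriv_mul k) φ hφ _ ((p.x_even k).soul.commute) L
    (soul_pow_eq_zero _) f g

theorem partialDeriv_one (k : Fin 3) : partialDeriv k 1 = 0 := by
  have h := partialDeriv_mul k 1 1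
  simpa using h

theorem taylorStep_one {L : ℕ} (p : SuperSpace L) (k : Fin 3) (φ : Smooth →ₗ[ℂ] Grassmann L)
    (hφ : φ 1 = 1) : taylorStep p k φ 1 = 1 := by
  rw [taylorStep_apply, Finset.sum_range_succ', Finset.sum_eq_zero]
  · simp [hφ]
  · intro n _
    simp [pow_succ, partialDeriv_one]

/-- The Z-expansion `∑_N (1/N!) (∂^N f)(ε(x)) (x - ε(x))^N` of a smooth function. The exponents may
be cut off at `L` because `(x - ε(x))^(L+1) = 0`. -/
def zExpansion {L : ℕ} (p : SuperSpace L) (f : Smooth) : Grassmann L :=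
  ∑ a ∈ Finset.range (L + 1), ∑ b ∈ Finset.range (L + 1), ∑ c ∈ Finset.range (L + 1),
    (((a.factorial * b.factorial * c.factorial : ℕ) : ℂ)⁻¹ *
      ((partialDeriv 0)^[a] ((partialDeriv 1)^[b] ((partialDeriv 2)^[c] f))).1 (bodyPoint p)) •
    (soul (p.x 0) ^ a * soul (p.x 1) ^ b * soul (p.x 2) ^ c)

theorem zExpansion_eq {L : ℕ} (p : SuperSpace L) (f : Smooth) :
    zExpansion p f = taylorStep p 2 (taylorStep p 1 (taylorStep p 0 (evalBody p))) f := by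
  simp only [taylorStep_apply, zExpansion, Finset.sum_mul, Finset.smul_sum]
  rw [Finset.sum_comm' (t' := Finset.range (L + 1)) (s' := fun _ => Finset.range (L + 1))
    (by simp)]
  rw [Finset.sum_congr rfl fun b _ => Finset.sum_comm]
  rw [Finset.sum_comm]
  refine Finset.sum_congr rfl fun c _ => Finset.sum_congr rfl fun b _ =>
    Finset.sum_congr rfl fun a _ => ?_
  simp only [evalBody, LinearMap.coe_mk, AddHom.coe_mk, Module.End.coe_pow,
    Algebra.algebraMap_eq_smul_one, smul_mul_assoc, one_mul, smul_smul, Nat.cast_mul, mul_inv]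
  congr 1
  ring

theorem zExpansion_mul {L : ℕ} (p : SuperSpace L) (f g : Smooth) :
    zExpansion p (f * g) = zExpansion p f * zExpansion p g := by
  simp only [zExpansion_eq]
  refine taylorStep_mul p 2 _ (taylorStep_mul p 1 _ (taylorStep_mul p 0 _ fun f g => ?_)) f g
  simp [evalBody]

theorem zExpansion_one {L : ℕ} (p : SuperSpace L) : zExpansion p 1 = 1 := by
  rw [zExpansion_eq]
  refine taylorStep_one p 2 _ (taylorStep_one p 1 _ (taylorStep_one p 0 _ ?_))
  simp [evalBody]

theorem zExpansion_comm {L : ℕ} (p : SuperSpace L) (f : Smooth) (z : Grassmann L) :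
    Commute (zExpansion p f) z := by
  have h : ∀ k, Commute (soul (p.x k)) z := fun k => (p.x_even k).soul.commute z
  refine Commute.sum_left _ _ _ fun a _ => Commute.sum_left _ _ _ fun b _ =>
    Commute.sum_left _ _ _ fun c _ => Commute.smul_left ?_ _
  exact (((h 0).pow_left a).mul_left ((h 1).pow_left b)).mul_left ((h 2).pow_left c)

/-! ### Superfields -/

/-- An `H^∞`-function `f₀ + f₄ θ⁴ + f₅ θ⁵ + f₄₅ θ⁴ θ⁵` on the vector superspace, given by the smooth
functions whose Z-expansions are the coefficients; see `evalHom` for the function itself. For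
`2 ≤ L` the coefficients are determined by the function. -/
@[ext]
structure Superfield where
  c0 : Smooth
  c4 : Smooth
  c5 : Smooth
  c45 : Smooth

namespace Superfield

instance : Zero Superfield := ⟨⟨0, 0, 0, 0⟩⟩
instance : One Superfield := ⟨⟨1, 0, 0, 0⟩⟩
instance : Add Superfield := ⟨fun F G => ⟨F.c0 + G.c0, F.c4 + G.c4, F.c5 + G.c5, F.c45 + G.c45⟩⟩
instance : Neg Superfield := ⟨fun F => ⟨-F.c0, -F.c4, -F.c5, -F.c45⟩⟩
instance : SMul ℂ Superfield := ⟨fun c F => ⟨c • F.c0, c • F.c4, c • F.c5, c • F.c45⟩⟩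
instance : Mul Superfield := ⟨fun F G =>
  ⟨F.c0 * G.c0, F.c0 * G.c4 + F.c4 * G.c0, F.c0 * G.c5 + F.c5 * G.c0,
    F.c0 * G.c45 + F.c4 * G.c5 - F.c5 * G.c4 + F.c45 * G.c0⟩⟩

theorem zero_def : (0 : Superfield) = ⟨0, 0, 0, 0⟩ := rfl
theorem one_def : (1 : Superfield) = ⟨1, 0, 0, 0⟩ := rfl
theorem add_def (F G : Superfield) :
    F + G = ⟨F.c0 + G.c0, F.c4 + G.c4, F.c5 + G.c5, F.c45 + G.c45⟩ := rfl
theorem neg_def (F : Superfield) : -F = ⟨-F.c0, -F.c4, -F.c5, -F.c45⟩ := rfl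
theorem smul_def (c : ℂ) (F : Superfield) :
    c • F = ⟨c • F.c0, c • F.c4, c • F.c5, c • F.c45⟩ := rfl
theorem mul_def (F G : Superfield) :
    F * G = ⟨F.c0 * G.c0, F.c0 * G.c4 + F.c4 * G.c0, F.c0 * G.c5 + F.c5 * G.c0,
      F.c0 * G.c45 + F.c4 * G.c5 - F.c5 * G.c4 + F.c45 * G.c0⟩ := rfl

instance : Ring Superfield where
  add_assoc _ _ _ := by simp only [add_def, add_assoc]
  zero_add _ := by simp only [add_def, zero_def, zero_add]
  add_zero _ := by simp only [add_def, zero_def, add_zero]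
  add_comm _ _ := by simp only [add_def, add_comm]
  neg_add_cancel _ := by simp only [add_def, neg_def, zero_def, neg_add_cancel]
  nsmul := nsmulRec
  zsmul := zsmulRec
  left_distrib _ _ _ := by
    simp only [add_def, mul_def, mk.injEq]
    refine ⟨?_, ?_, ?_, ?_⟩ <;> ring
  right_distrib _ _ _ := by
    simp only [add_def, mul_def, mk.injEq]
    refine ⟨?_, ?_, ?_, ?_⟩ <;> ring
  zero_mul _ := by simp [zero_def, mul_def]
  mul_zero _ := by simp [zero_def, mul_def]
  mul_assoc _ _ _ := by
    simp only [mul_def, mk.injEq]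
    refine ⟨?_, ?_, ?_, ?_⟩ <;> ring
  one_mul _ := by simp [one_def, mul_def]
  mul_one _ := by simp [one_def, mul_def]

instance : Module ℂ Superfield where
  one_smul _ := by simp [smul_def]
  mul_smul _ _ _ := by simp [smul_def, mul_smul]
  smul_zero _ := by simp [smul_def, zero_def]
  smul_add _ _ _ := by simp [smul_def, add_def]
  add_smul _ _ _ := by simp [smul_def, add_def, add_smul]
  zero_smul _ := by simp [smul_def, zero_def]

instance : Algebra ℂ Superfield := Algebra.ofModule
  (fun c F G => by simp [smul_def, mul_def, smul_add, smul_sub])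
  (fun c F G => by simp [smul_def, mul_def, smul_add, smul_sub])

/-- The even coordinate projections. -/
def x (k : Fin 3) : Superfield :=
  ⟨⟨fun u => (u k : ℂ), by
    change ContDiff ℝ ∞ fun u : Fin 3 → ℝ => (u k : ℂ)
    exact Complex.ofRealCLM.contDiff.comp (contDiff_apply ℝ ℝ k)⟩, 0, 0, 0⟩

/-- The odd coordinate projections. -/
def θ (α : Fin 2) : Superfield := if α = 0 then ⟨0, 1, 0, 0⟩ else ⟨0, 0, 1, 0⟩

/-- The derivation `∂/∂xᵏ`. -/
def ddx (k : Fin 3) : Module.End ℂ Superfield where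
  toFun F := ⟨partialDeriv k F.c0, partialDeriv k F.c4, partialDeriv k F.c5, partialDeriv k F.c45⟩
  map_add' F G := by simp [add_def]
  map_smul' c F := by simp [smul_def]

/-- The (left) odd derivation `∂/∂θ⁴` or `∂/∂θ⁵`. -/
def ddθ (α : Fin 2) : Module.End ℂ Superfield where
  toFun F := if α = 0 then ⟨F.c4, 0, F.c45, 0⟩ else ⟨F.c5, -F.c45, 0, 0⟩
  map_add' F G := by split_ifs <;> simp [add_def, add_comm]
  map_smul' c F := by split_ifs <;> simp [smul_def]

end Superfield

def evalFun (L : ℕ) (F : Superfield) (p : SuperSpace L) : Grassmann L :=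
  zExpansion p F.c0 + zExpansion p F.c4 * p.θ 0 + zExpansion p F.c5 * p.θ 1 +
    zExpansion p F.c45 * (p.θ 0 * p.θ 1)

theorem zExpansion_add {L : ℕ} (p : SuperSpace L) (f g : Smooth) :
    zExpansion p (f + g) = zExpansion p f + zExpansion p g := by
  simp only [zExpansion_eq, map_add]

theorem zExpansion_smul {L : ℕ} (p : SuperSpace L) (c : ℂ) (f : Smooth) :
    zExpansion p (c • f) = c • zExpansion p f := by
  simp only [zExpansion_eq, map_smul]

theorem zExpansion_zero {L : ℕ} (p : SuperSpace L) : zExpansion p 0 = 0 := by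
  simp only [zExpansion_eq, map_zero]

theorem zExpansion_sub {L : ℕ} (p : SuperSpace L) (f g : Smooth) :
    zExpansion p (f - g) = zExpansion p f - zExpansion p g := by
  simp only [zExpansion_eq, map_sub]

theorem evalFun_mul (L : ℕ) (F G : Superfield) (p : SuperSpace L) :
    evalFun L (F * G) p = evalFun L F p * evalFun L G p := by
  have h00 := (p.θ_odd 0).mul_self
  have h11 := (p.θ_odd 1).mul_self
  have h10 := (p.θ_odd 1).anticomm (p.θ_odd 0)
  simp only [evalFun, Superfield.mul_def, zExpansion_add, zExpansion_sub, zExpansion_mul]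
  have c : ∀ f z, zExpansion p f * z = z * zExpansion p f := fun f z => (zExpansion_comm p f z).eq
  generalize p.θ 0 = s at *
  generalize p.θ 1 = t at *
  have e1 : ∀ a g z, a * z * zExpansion p g = a * zExpansion p g * z := by
    intro a g z
    rw [mul_assoc, ← c g z, mul_assoc]
  have e2 : ∀ a g z w, a * z * (zExpansion p g * w) = a * zExpansion p g * (z * w) := by
    intro a g z w
    rw [← mul_assoc, e1, mul_assoc]
  have z1 : s * (s * t) = 0 := by rw [← mul_assoc, h00, zero_mul]
  have z2 : t * (s * t) = 0 := by rw [← mul_assoc, h10, neg_mul, mul_assoc, h11, mul_zero, neg_zero]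
  have z3 : s * t * s = 0 := by rw [mul_assoc, h10, mul_neg, z1, neg_zero]
  have z4 : s * t * t = 0 := by rw [mul_assoc, h11, mul_zero]
  have z5 : s * t * (s * t) = 0 := by rw [mul_assoc, z2, mul_zero]
  simp only [add_mul, mul_add, sub_mul, e1, e2, h00, h11, h10, z1, z2, z3, z4, z5, mul_zero,
    add_zero, mul_neg, ← mul_assoc (zExpansion p F.c0)]
  abel

/-- The function on the superspace given by a superfield. -/
def evalHom (L : ℕ) : Superfield →ₐ[ℂ] (SuperSpace L → Grassmann L) :=
  AlgHom.ofLinearMap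
    { toFun := evalFun L
      map_add' := fun F G => by
        ext p
        simp only [evalFun, Superfield.add_def, zExpansion_add, Pi.add_apply, add_mul]
        abel
      map_smul' := fun c F => by
        ext p
        simp [evalFun, Superfield.smul_def, zExpansion_smul] }
    (by
      ext p
      simp [evalFun, Superfield.one_def, zExpansion_one, zExpansion_zero])
    (fun F G => by
      ext p
      exact evalFun_mul L F G p)

/-- Restriction of an `H^∞`-function to the supersphere. -/
def sphereHom (L : ℕ) (ρ : ℝ) : Superfield →ₐ[ℂ] (superSphere L ρ → Grassmann L) :=
  (AlgHom.pi fun p : superSphere L ρ =>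
    Pi.evalAlgHom ℂ (fun _ : SuperSpace L => Grassmann L) p.1).comp (evalHom L)

/-- The algebra of complex Grassmann-valued `H^∞`-functions on the supersphere: the functions on it
that are restrictions of `H^∞`-functions on the superspace, i.e. the quotient by the ideal of
functions vanishing on the supersphere. -/
def HInfSphere (L : ℕ) (ρ : ℝ) : Subalgebra ℂ (superSphere L ρ → Grassmann L) :=
  (sphereHom L ρ).range

/-- The canonical projection from superspace functions to supersphere functions. -/
def restrict (L : ℕ) (ρ : ℝ) : Superfield →ₐ[ℂ] HInfSphere L ρ := (sphereHom L ρ).rangeRestrict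

/-- The derivative `(∂/∂x)^N (∂/∂θ)^M`. -/
def superDeriv (N : Fin 3 → ℕ) (M : Fin 2 → Fin 2) : Module.End ℂ Superfield :=
  Superfield.ddx 0 ^ N 0 * Superfield.ddx 1 ^ N 1 * Superfield.ddx 2 ^ N 2 *
    (Superfield.ddθ 0 ^ (M 0 : ℕ) * Superfield.ddθ 1 ^ (M 1 : ℕ))

/-- The seminorm `max ‖(∂/∂x)^N (∂/∂θ)^M f (p)‖` over `p ∈ K`, `|N| ≤ n` and all `M`. -/
def superSeminorm {L : ℕ} (K : Set (SuperSpace L)) (n : ℕ) (F : Superfield) : ENNReal :=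
  ⨆ p ∈ K, ⨆ (N : Fin 3 → ℕ) (_ : ∑ k, N k ≤ n) (M : Fin 2 → Fin 2),
    ENNReal.ofReal (gnorm (evalHom L (superDeriv N M F) p))

/-- The quotient seminorm: the infimum over all representatives. -/
def sphereSeminorm {L : ℕ} {ρ : ℝ} (K : Set (SuperSpace L)) (n : ℕ) (f : HInfSphere L ρ) :
    ENNReal :=
  ⨅ (F : Superfield) (_ : restrict L ρ F = f), superSeminorm K n F

theorem gnorm_add_le {L : ℕ} (a b : Grassmann L) : gnorm (a + b) ≤ gnorm a + gnorm b := by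
  simp only [gnorm, coeff, map_add, Finsupp.add_apply, ← Finset.sum_add_distrib]
  exact Finset.sum_le_sum fun M _ => norm_add_le _ _

theorem gnorm_neg {L : ℕ} (a : Grassmann L) : gnorm (-a) = gnorm a := by
  simp [gnorm, coeff]

theorem superSeminorm_zero {L : ℕ} (K : Set (SuperSpace L)) (n : ℕ) :
    superSeminorm K n 0 = 0 := by
  simp [superSeminorm, gnorm, coeff]

theorem superSeminorm_neg {L : ℕ} (K : Set (SuperSpace L)) (n : ℕ) (F : Superfield) :
    superSeminorm K n (-F) = superSeminorm K n F := by
  simp [superSeminorm, gnorm_neg]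

theorem superSeminorm_add {L : ℕ} (K : Set (SuperSpace L)) (n : ℕ) (F G : Superfield) :
    superSeminorm K n (F + G) ≤ superSeminorm K n F + superSeminorm K n G := by
  refine iSup₂_le fun p hp => iSup₂_le fun N hN => iSup_le fun M => ?_
  have h : ∀ H : Superfield, ENNReal.ofReal (gnorm (evalHom L (superDeriv N M H) p)) ≤
      superSeminorm K n H := fun H =>
    le_iSup₂_of_le p hp (le_iSup₂_of_le N hN (le_iSup_of_le M le_rfl))
  refine le_trans ?_ (add_le_add (h F) (h G))
  rw [← ENNReal.ofReal_add (gnorm_nonneg _) (gnorm_nonneg _), map_add, map_add]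
  exact ENNReal.ofReal_le_ofReal (gnorm_add_le _ _)

theorem le_iInf_add_iInf_of_forall {X : Type*} (P Q : X → Prop) (s : X → ENNReal) (c : ENNReal)
    (h : ∀ F G, P F → Q G → c ≤ s F + s G) :
    c ≤ (⨅ (F : X) (_ : P F), s F) + ⨅ (G : X) (_ : Q G), s G := by
  simp only [ENNReal.iInf_add, ENNReal.add_iInf]
  exact le_iInf fun F => le_iInf fun hF => le_iInf fun G => le_iInf fun hG => h G F hG hF

theorem sphereSeminorm_add {L : ℕ} {ρ : ℝ} (K : Set (SuperSpace L)) (n : ℕ)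
    (f g : HInfSphere L ρ) :
    sphereSeminorm K n (f + g) ≤ sphereSeminorm K n f + sphereSeminorm K n g := by
  have key : ∀ F G : Superfield, restrict L ρ F = f → restrict L ρ G = g →
      sphereSeminorm K n (f + g) ≤ superSeminorm K n F + superSeminorm K n G := by
    rintro F G rfl rfl
    exact iInf₂_le_of_le (F + G) (map_add _ F G) (superSeminorm_add K n F G)
  exact le_iInf_add_iInf_of_forall _ _ _ _ key

theorem sphereSeminorm_neg {L : ℕ} {ρ : ℝ} (K : Set (SuperSpace L)) (n : ℕ)
    (f : HInfSphere L ρ) : sphereSeminorm K n (-f) ≤ sphereSeminorm K n f := by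
  refine le_iInf₂ fun F hF => ?_
  subst hF
  exact iInf₂_le_of_le (-F) (map_neg _ F) (superSeminorm_neg K n F).le

/-- The pseudo-distance of one quotient seminorm. -/
abbrev sphereEMetric {L : ℕ} (ρ : ℝ) (K : Set (SuperSpace L)) (n : ℕ) :
    PseudoEMetricSpace (HInfSphere L ρ) where
  edist f g := sphereSeminorm K n (f - g)
  edist_self f := by
    refine le_antisymm ?_ bot_le
    rw [sub_self]
    exact iInf₂_le_of_le 0 (map_zero _) (superSeminorm_zero K n).le
  edist_comm f g := by
    refine le_antisymm ?_ ?_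
    · rw [← neg_sub g f]
      exact sphereSeminorm_neg K n _
    · rw [← neg_sub f g]
      exact sphereSeminorm_neg K n _
  edist_triangle f g h := by
    rw [← sub_add_sub_cancel f g h]
    exact sphereSeminorm_add K n _ _

/-- The Fréchet topology, induced by the quotient seminorms for all compact `K` and all `n`. -/
instance frechetTopology (L : ℕ) (ρ : ℝ) : TopologicalSpace (HInfSphere L ρ) :=
  ⨅ (K : {K : Set (SuperSpace L) // IsCompact K}) (n : ℕ),
    (sphereEMetric ρ K.1 n).toUniformSpace.toTopologicalSpace

/-- The polynomial superfunctions on the supersphere: classes of polynomials in the coordinate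
projections with complex coefficients. -/
def PolSphere (L : ℕ) (ρ : ℝ) : Subalgebra ℂ (HInfSphere L ρ) :=
  (Algebra.adjoin ℂ (Set.range Superfield.x ∪ Set.range Superfield.θ)).map (restrict L ρ)

/-! ### Superspherical harmonics

The generators of `osp(1|2)` are indexed by `Fin 3 ⊕ Fin 2`: `inl 0, inl 1, inl 2` are `J₁, J₂, J₃`,
and `inr 0, inr 1` are `J₄, J₅`. A superspin `j` is given by `n = 2 j`. -/

/-- The Pauli matrices. -/
def pauli : Fin 3 → Matrix (Fin 2) (Fin 2) ℂ :=
  ![!![0, 1; 1, 0], !![0, -Complex.I; Complex.I, 0], !![1, 0; 0, -1]]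

/-- The action of `osp(1|2)` on functions on the superspace:
`J_i = - i ∑ ε_{ijk} xʲ ∂/∂xᵏ + (1/2) ∑ (σ_i)_{αβ} θᵅ ∂/∂θᵝ` and
`J_α = (1/2) ∑ (i xᵏ (σ₂ σ_k)_{αβ} ∂/∂θᵝ - θᵝ (σ_k)_{βα} ∂/∂xᵏ)`. -/
def fieldJ : Fin 3 ⊕ Fin 2 → Module.End ℂ Superfield
  | .inl i =>
      (-Complex.I) • (LinearMap.mulLeft ℂ (Superfield.x (i + 1)) * Superfield.ddx (i + 2) -
        LinearMap.mulLeft ℂ (Superfield.x (i + 2)) * Superfield.ddx (i + 1)) +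
      (1 / 2 : ℂ) • ∑ α, ∑ β, pauli i α β •
        (LinearMap.mulLeft ℂ (Superfield.θ α) * Superfield.ddθ β)
  | .inr α =>
      (1 / 2 : ℂ) • ∑ k, ∑ β,
        ((Complex.I * (pauli 1 * pauli k) α β) •
            (LinearMap.mulLeft ℂ (Superfield.x k) * Superfield.ddθ β) -
          pauli k β α • (LinearMap.mulLeft ℂ (Superfield.θ β) * Superfield.ddx k))

/-- `J₋ = J₁ - i J₂`. -/
def lowering {W : Type*} [AddCommGroup W] [Module ℂ W]
    (J : Fin 3 ⊕ Fin 2 → Module.End ℂ W) : Module.End ℂ W :=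
  J (.inl 0) - Complex.I • J (.inl 1)

/-- The normalized vector `sqrt (4^(2(j-l)) Γ(l+m+1) / (Γ(2j+1) Γ(l-m+1))) J₋^(l-m) J₅^μ v` of a
module with highest weight vector `v`, where `n = 2 j`, `l = j - μ/2` and `r = l - m`; the admissible
indices are `μ ≤ 1` and `μ + r ≤ n`. -/
def descendant {W : Type*} [AddCommGroup W] [Module ℂ W]
    (J : Fin 3 ⊕ Fin 2 → Module.End ℂ W) (v : W) (n μ r : ℕ) : W :=
  ((Real.sqrt (4 ^ μ * (n - μ - r).factorial / (n.factorial * r.factorial)) : ℝ) : ℂ) •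
    (lowering J ^ r) ((J (.inr 1) ^ μ) v)

/-- The highest weight vector of superspin `n/2`: with `k = ⌊n/2⌋`, a multiple of `(x¹ + i x²)^k` for
`n = 2k` and of `(x¹ + i x²)^k (x³ θ⁴ + (x¹ + i x²) θ⁵)` for `n = 2k + 1`. -/
def harmonicTop (ρ : ℝ) (n : ℕ) : Superfield :=
  let k := n / 2
  if Even n then
    ((Real.sqrt (n.factorial) / (2 ^ k * k.factorial * ρ ^ k) : ℝ) : ℂ) •
      (Superfield.x 0 + Complex.I • Superfield.x 1) ^ k
  else
    ((Real.sqrt (n.factorial) / (2 ^ k * k.factorial * ρ ^ (k + 2)) : ℝ) : ℂ) •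
      ((Superfield.x 0 + Complex.I • Superfield.x 1) ^ k *
        (Superfield.x 2 * Superfield.θ 0 +
          (Superfield.x 0 + Complex.I • Superfield.x 1) * Superfield.θ 1))

/-- The `osp(1|2)`-module generated by the highest weight vector, on the superspace. -/
def fieldModule (ρ : ℝ) (n : ℕ) : Submodule ℂ Superfield :=
  sInf {W | harmonicTop ρ n ∈ W ∧ ∀ A, ∀ F ∈ W, fieldJ A F ∈ W}

/-- The `osp(1|2)`-module generated by the highest weight vector, on the supersphere; the action on
the supersphere is the action on representatives. -/
def sphereModule (L : ℕ) (ρ : ℝ) (n : ℕ) : Submodule ℂ (HInfSphere L ρ) :=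
  (fieldModule ρ n).map (restrict L ρ).toLinearMap

/-- The truncation `H_q`: the sum of the modules of superspin `j ≤ q`. -/
def trunc (L : ℕ) (ρ : ℝ) (q : ℕ) : Submodule ℂ (HInfSphere L ρ) :=
  ⨆ n : {n : ℕ // n ≤ 2 * q}, sphereModule L ρ n

/-- The superspherical harmonics. -/
def harmonic (L : ℕ) (ρ : ℝ) (n μ r : ℕ) : HInfSphere L ρ :=
  restrict L ρ (descendant fieldJ (harmonicTop ρ n) n μ r)

theorem harmonic_mem (L : ℕ) (ρ : ℝ) (q n μ r : ℕ) (hn : n ≤ 2 * q) :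
    harmonic L ρ n μ r ∈ trunc L ρ q := by
  refine Submodule.mem_iSup_of_mem ⟨n, hn⟩ (Submodule.mem_map_of_mem ?_)
  refine Submodule.mem_sInf.mpr fun W hW => Submodule.smul_mem _ _ ?_
  have h5 : ∀ m, (fieldJ (.inr 1) ^ m) (harmonicTop ρ n) ∈ W := by
    intro m
    induction m with
    | zero => simpa using hW.1
    | succ m ih => rw [pow_succ', Module.End.mul_apply]; exact hW.2 _ _ ih
  induction r with
  | zero => simpa using h5 μ
  | succ r ih =>
    rw [pow_succ', Module.End.mul_apply]
    exact Submodule.sub_mem _ (hW.2 _ _ ih) (Submodule.smul_mem _ _ (hW.2 _ _ ih))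

theorem trunc_mono (L : ℕ) (ρ : ℝ) {p q : ℕ} (h : p ≤ q) : trunc L ρ p ≤ trunc L ρ q :=
  iSup_le fun n => le_iSup (fun m : {n : ℕ // n ≤ 2 * q} => sphereModule L ρ m)
    ⟨n.1, n.2.trans (by omega)⟩

theorem fieldModule_invariant (ρ : ℝ) (n : ℕ) (A : Fin 3 ⊕ Fin 2) {F : Superfield}
    (hF : F ∈ fieldModule ρ n) : fieldJ A F ∈ fieldModule ρ n :=
  Submodule.mem_sInf.mpr fun W hW => hW.2 A F (Submodule.mem_sInf.mp hF W hW)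

/-! ### The irreducible representation of superspin `q/2` and noncommutative harmonics -/

/-- The space of the irreducible representation of superspin `j = q/2` with odd highest weight vector.
The basis vector `inl a` is the odd `e_{j, m}` with `m = a - q/2`, and `inr b` is the even
`e_{j-1/2, m}` with `m = b - (q-1)/2`. -/
abbrev RepSpace (q : ℕ) : Type := Fin (q + 1) ⊕ Fin q → ℂ

/-- The algebra of all endomorphisms. -/
abbrev RepEnd (q : ℕ) : Type := Module.End ℂ (RepSpace q)

/-- `J₊ e_{l,m} = sqrt ((l-m)(l+m+1)) e_{l,m+1}`. -/
def repRaise (q : ℕ) : RepEnd q := Matrix.toLin' (Matrix.fromBlocks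
  (.of fun a' a => if a'.val = a.val + 1 then
    ((Real.sqrt ((q - a.val) * (a.val + 1)) : ℝ) : ℂ) else 0)
  0 0
  (.of fun b' b => if b'.val = b.val + 1 then
    ((Real.sqrt ((q - 1 - b.val) * (b.val + 1)) : ℝ) : ℂ) else 0))

/-- `J₋ e_{l,m} = sqrt ((l+m)(l-m+1)) e_{l,m-1}`. -/
def repLower (q : ℕ) : RepEnd q := Matrix.toLin' (Matrix.fromBlocks
  (.of fun a' a => if a'.val + 1 = a.val then
    ((Real.sqrt (a.val * (q - a.val + 1)) : ℝ) : ℂ) else 0)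
  0 0
  (.of fun b' b => if b'.val + 1 = b.val then
    ((Real.sqrt (b.val * (q - b.val)) : ℝ) : ℂ) else 0))

/-- `J₃ e_{l,m} = m e_{l,m}`. -/
def repWeight (q : ℕ) : RepEnd q := Matrix.toLin' (Matrix.fromBlocks
  (.diagonal fun a => (a.val : ℂ) - q / 2) 0 0 (.diagonal fun b => (b.val : ℂ) - (q - 1) / 2))

/-- `J₄ e_{j,m} = -(1/2) sqrt (j-m) e_{j-1/2,m+1/2}` and
`J₄ e_{j-1/2,m} = -(1/2) sqrt (j+m+1/2) e_{j,m+1/2}`. -/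
def repJ4 (q : ℕ) : RepEnd q := Matrix.toLin' (Matrix.fromBlocks 0
  (.of fun a b => if a.val = b.val + 1 then ((-(1 / 2) * Real.sqrt (b.val + 1) : ℝ) : ℂ) else 0)
  (.of fun b a => if b.val = a.val then ((-(1 / 2) * Real.sqrt (q - a.val) : ℝ) : ℂ) else 0)
  0)

/-- `J₅ e_{j,m} = (1/2) sqrt (j+m) e_{j-1/2,m-1/2}` and
`J₅ e_{j-1/2,m} = -(1/2) sqrt (j-m+1/2) e_{j,m-1/2}`. -/
def repJ5 (q : ℕ) : RepEnd q := Matrix.toLin' (Matrix.fromBlocks 0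
  (.of fun a b => if a.val = b.val then ((-(1 / 2) * Real.sqrt (q - b.val) : ℝ) : ℂ) else 0)
  (.of fun b a => if b.val + 1 = a.val then ((1 / 2 * Real.sqrt a.val : ℝ) : ℂ) else 0)
  0)

/-- The generators in the representation, with `J₁ = (J₊ + J₋)/2` and `J₂ = (J₊ - J₋)/(2i)`. -/
def repJ (q : ℕ) : Fin 3 ⊕ Fin 2 → RepEnd q
  | .inl i => ![(1 / 2 : ℂ) • (repRaise q + repLower q),
      (-(Complex.I / 2)) • (repRaise q - repLower q), repWeight q] i
  | .inr α => ![repJ4 q, repJ5 q] α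

/-- The grading operator: `-1` on odd and `1` on even vectors. -/
def repParity (q : ℕ) : RepEnd q :=
  Matrix.toLin' (Matrix.fromBlocks (-1) 0 0 1)

/-- The involution of the endomorphism algebra that is `1` on even and `-1` on odd endomorphisms. -/
def gradeInvolution (q : ℕ) : Module.End ℂ (RepEnd q) :=
  LinearMap.mulLeft ℂ (repParity q) * LinearMap.mulRight ℂ (repParity q)

/-- The adjoint action by graded commutators, `f ↦ J f - (-1)^(deg J deg f) f J`. -/
def repAd (q : ℕ) : Fin 3 ⊕ Fin 2 → Module.End ℂ (RepEnd q)
  | .inl i => LinearMap.mulLeft ℂ (repJ q (.inl i)) - LinearMap.mulRight ℂ (repJ q (.inl i))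
  | .inr α => LinearMap.mulLeft ℂ (repJ q (.inr α)) -
      LinearMap.mulRight ℂ (repJ q (.inr α)) * gradeInvolution q

/-- The normalized highest weight endomorphism of superspin `j = n/2 ≤ q`, with `k = ⌊n/2⌋`:
`sqrt (2^j (2j-1)!! Γ(q-j+1) / (Γ(j+1) Γ(q+j+1))) J₊^j` for integral `j`, and
`1/(q+1/2) sqrt (2^(j+7/2) (2j)!! Γ(q-j+1/2) / (Γ(j+1/2) Γ(q+j+3/2)))
J₊^(j-1/2) ((J₃ - 3/4) J₄ + J₊ J₅)` for half-integral `j`. -/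
def ncHarmonicTop (q n : ℕ) : RepEnd q :=
  let k := n / 2
  if Even n then
    ((Real.sqrt (2 ^ k * (n - 1).doubleFactorial * (q - k).factorial /
      (k.factorial * (q + k).factorial)) : ℝ) : ℂ) • repRaise q ^ k
  else
    ((1 / (q + 1 / 2) * Real.sqrt (2 ^ (k + 4) * n.doubleFactorial * (q - k - 1).factorial /
      (k.factorial * (q + k + 1).factorial)) : ℝ) : ℂ) •
      (repRaise q ^ k * ((repWeight q - (3 / 4 : ℂ) • 1) * repJ4 q + repRaise q * repJ5 q))

/-- The noncommutative superspherical harmonics. -/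
def ncHarmonic (q n μ r : ℕ) : RepEnd q :=
  descendant (repAd q) (ncHarmonicTop q n) n μ r

/-- `ψ` sends the superspherical harmonics to the noncommutative ones. -/
def SendsHarmonics (L : ℕ) (ρ : ℝ) (q : ℕ) (ψ : trunc L ρ q ≃ₗ[ℂ] RepEnd q) : Prop :=
  ∀ (n μ r : ℕ) (hn : n ≤ 2 * q), μ ≤ 1 → μ + r ≤ n →
    ψ ⟨harmonic L ρ n μ r, harmonic_mem L ρ q n μ r hn⟩ = ncHarmonic q n μ r

theorem restrict_mem (L : ℕ) {ρ : ℝ} {q n : ℕ} (hn : n ≤ 2 * q) {F : Superfield}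
    (hF : F ∈ fieldModule ρ n) : restrict L ρ F ∈ trunc L ρ q :=
  Submodule.mem_iSup_of_mem ⟨n, hn⟩ (Submodule.mem_map_of_mem hF)

/-- `ψ` is a homomorphism of `osp(1|2)`-modules. -/
def IsModuleHom (L : ℕ) (ρ : ℝ) (q : ℕ) (ψ : trunc L ρ q ≃ₗ[ℂ] RepEnd q) : Prop :=
  ∀ (n : ℕ) (hn : n ≤ 2 * q) (A : Fin 3 ⊕ Fin 2) (F : Superfield) (hF : F ∈ fieldModule ρ n),
    ψ ⟨restrict L ρ (fieldJ A F), restrict_mem L hn (fieldModule_invariant ρ n A hF)⟩ =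
      repAd q A (ψ ⟨restrict L ρ F, restrict_mem L hn hF⟩)

/-- `ψ` preserves the `ℤ₂`-degree. -/
def IsEvenMap (L : ℕ) (ρ : ℝ) (q : ℕ) (ψ : trunc L ρ q ≃ₗ[ℂ] RepEnd q) : Prop :=
  ∀ (n : ℕ) (hn : n ≤ 2 * q) (F : Superfield) (hF : F ∈ fieldModule ρ n),
    (F.c4 = 0 → F.c5 = 0 → gradeInvolution q (ψ ⟨restrict L ρ F, restrict_mem L hn hF⟩) =
      ψ ⟨restrict L ρ F, restrict_mem L hn hF⟩) ∧
    (F.c0 = 0 → F.c45 = 0 → gradeInvolution q (ψ ⟨restrict L ρ F, restrict_mem L hn hF⟩) =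
      -ψ ⟨restrict L ρ F, restrict_mem L hn hF⟩)

/-! ### Directed systems and the graded-commutative limit -/

/-- The connecting map `η_{q'q} = ψ_{q'} ∘ ι_{q'q} ∘ ψ_q⁻¹`. -/
def connect {L : ℕ} {ρ : ℝ} {A : ℕ → Type} [∀ q, Ring (A q)] [∀ q, Algebra ℂ (A q)]
    (ψ : (q : ℕ) → trunc L ρ q ≃ₗ[ℂ] A q) {q q' : ℕ} (h : q ≤ q') : A q →ₗ[ℂ] A q' :=
  (ψ q').toLinearMap ∘ₗ Submodule.inclusion (trunc_mono L ρ h) ∘ₗ (ψ q).symm.toLinearMap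

/-- The product `(f f')_q = ψ_q⁻¹ (ψ_q(f) ψ_q(f'))`, viewed as a function on the supersphere. -/
def truncProd {L : ℕ} {ρ : ℝ} {A : ℕ → Type} [∀ q, Ring (A q)] [∀ q, Algebra ℂ (A q)]
    (ψ : (q : ℕ) → trunc L ρ q ≃ₗ[ℂ] A q) (q : ℕ) (f f' : trunc L ρ q) : HInfSphere L ρ :=
  ((ψ q).symm (ψ q f * ψ q f') : trunc L ρ q)

/-- Any two polynomial superfunctions `f, f'` lie in a common truncation `H_p`, hence in `H_q` for all
`q ≥ p`, and the sequence of the products `(f f')_q`, `q ≥ p`, tends to `f f'` in the Fréchet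
topology. -/
def HasGradedCommutativeLimit {L : ℕ} {ρ : ℝ} {A : ℕ → Type} [∀ q, Ring (A q)]
    [∀ q, Algebra ℂ (A q)] (ψ : (q : ℕ) → trunc L ρ q ≃ₗ[ℂ] A q) : Prop :=
  ∀ f ∈ PolSphere L ρ, ∀ f' ∈ PolSphere L ρ,
    (∃ p, f ∈ trunc L ρ p ∧ f' ∈ trunc L ρ p) ∧
    ∀ (p : ℕ) (hf : f ∈ trunc L ρ p) (hf' : f' ∈ trunc L ρ p),
      Filter.Tendsto
        (fun q : Set.Ici p => truncProd ψ q
          ⟨f, trunc_mono L ρ q.2 hf⟩ ⟨f', trunc_mono L ρ q.2 hf'⟩)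
        Filter.atTop (nhds (f * f'))

end FuzzySupersphere

end

noncomputable section

namespace FuzzySupersphere

/-! The functions on the supersphere and all the endomorphism algebras are instances of one
structure, `OspAlgebra`: generators `xp, xm, x3, t4, t5` forming a copy of the adjoint
representation of `osp(1|2)`, whose graded commutators are a central element `ε` times the Lie
brackets. Superfields are the case `ε = 0`. In `End V(q/2)` the generators are `e` times the
representing operators and `ε = e`. The Casimir element `C` is the left side of the equation of the
supersphere in the first case and the scalar `e² q (q + 1) / 4` in the second.

The isomorphisms. The even generators are quadratic in the odd ones, `J₊ = 4 J₄²`, `J₋ = -4 J₅²`,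
`J₃ = -2 (J₄ J₅ + J₅ J₄)`, so the module generated by a highest weight vector `v` of superspin `n/2`
is the string `J₅^s v`. It is nonzero exactly for `s ≤ 2n`, and its members are eigenvectors of `J₅
J₄` and of `J₄ J₅`; the pair of eigenvalues determines `n` and `s`, which gives linear independence
(`linearIndependent_descendants`). For the functions one needs in addition that `J₄` and `J₅` act
modulo the superfields vanishing on the sphere, and that no highest weight vector vanishes there
(`ker_restrict_le`, `fieldOsp_top_notMem_sphereKer`). The number of descendants with `n ≤ 2q` is `∑
(2n + 1) = (2q + 1)² = dim End V`, so they form bases on both sides and `ψ_q` matches these bases.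
The harmonics are nonzero multiples of the descendants, with equal factors on both sides.

The limit. The product `xm * top n` is a combination of descendants whose coefficients are
polynomials in `ε` and `C` that do not depend on the algebra (`xm_mul_xp_pow`,
`xm_mul_xp_pow_mul_w`). Applying `J₄` and `J₅` extends this to all generators and all descendants,
so that the span of the `ε^i C^j J₅^s top n` is stable under multiplication
(`mul_mem_harmonicSpan`). This is applied to the product `jointOsp` of the algebra of superfields
with all the `End V(q/2)`, where `e = 2 ρ / √(q (q + 1))` makes `C` equal to `ρ²` for `q ≥ 1`. A
product of two descendants thus has one finite expansion, valid for the functions and for every `q`.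
Under `ψ_q⁻¹` a rescaled descendant becomes `ratio` times the corresponding function. As `ratio → 1`
and `ε → 0`, the convergence is one of finitely many scalar coefficients
(`harmonicSpan_le_convergent`). -/

/-! ### Deformed function algebras of the supersphere -/

/-- An algebra generated by a copy of the adjoint representation of `osp(1|2)` in which the
graded commutators of the generators are `ε` times the Lie superalgebra brackets. The operators `D4`
and `D5` are the actions of the odd generators `J₄` and `J₅`; `P` is the parity involution and `C`
the quadratic Casimir element. -/
structure OspAlgebra (R : Type*) [Ring R] [Algebra ℂ R] where
  P : R →ₗ[ℂ] R
  D4 : R →ₗ[ℂ] R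
  D5 : R →ₗ[ℂ] R
  xp : R
  xm : R
  x3 : R
  t4 : R
  t5 : R
  ε : R
  C : R
  P_one : P 1 = 1
  P_mul : ∀ Y Z, P (Y * Z) = P Y * P Z
  P_P : ∀ Y, P (P Y) = Y
  P_xp : P xp = xp
  P_xm : P xm = xm
  P_x3 : P x3 = x3
  P_t4 : P t4 = -t4
  P_t5 : P t5 = -t5
  P_ε : P ε = ε
  P_C : P C = C
  P_D4 : ∀ Y, P (D4 Y) = -D4 (P Y)
  P_D5 : ∀ Y, P (D5 Y) = -D5 (P Y)
  D4_mul : ∀ Y Z, D4 (Y * Z) = D4 Y * Z + P Y * D4 Z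
  D5_mul : ∀ Y Z, D5 (Y * Z) = D5 Y * Z + P Y * D5 Z
  D4_xp : D4 xp = 0
  D4_xm : D4 xm = -t5
  D4_x3 : D4 x3 = (-1 / 2 : ℂ) • t4
  D4_t4 : D4 t4 = (1 / 2 : ℂ) • xp
  D4_t5 : D4 t5 = (-1 / 2 : ℂ) • x3
  D4_ε : D4 ε = 0
  D4_C : D4 C = 0
  D5_xp : D5 xp = -t4
  D5_xm : D5 xm = 0
  D5_x3 : D5 x3 = (1 / 2 : ℂ) • t5
  D5_t4 : D5 t4 = (-1 / 2 : ℂ) • x3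
  D5_t5 : D5 t5 = (-1 / 2 : ℂ) • xm
  D5_ε : D5 ε = 0
  D5_C : D5 C = 0
  ε_comm : ∀ Y, Y * ε = ε * Y
  C_comm : ∀ Y, Y * C = C * Y
  t4_mul : ∀ Y, t4 * Y = P Y * t4 + ε * D4 Y
  t5_mul : ∀ Y, t5 * Y = P Y * t5 + ε * D5 Y
  x3_xp : x3 * xp = xp * x3 + ε * xp
  xm_xp : xm * xp = xp * xm - (2 : ℂ) • (ε * x3)
  xm_x3 : xm * x3 = x3 * xm + ε * xm
  C_eq : C = x3 * x3 + xp * xm - (1 / 2 : ℂ) • (ε * x3) + (2 : ℂ) • (t4 * t5)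

namespace OspAlgebra

variable {R : Type*} [Ring R] [Algebra ℂ R] (S : OspAlgebra R)

/-- The generating element of the odd highest weight vectors. -/
def w : R := (S.x3 - (3 / 4 : ℂ) • S.ε) * S.t4 + S.xp * S.t5

/-- The highest weight vector of superspin `n / 2`. -/
def top (n : ℕ) : R := if Even n then S.xp ^ (n / 2) else S.xp ^ (n / 2) * S.w

theorem top_even (k : ℕ) : S.top (2 * k) = S.xp ^ k := by
  simp [top]

theorem top_odd (k : ℕ) : S.top (2 * k + 1) = S.xp ^ k * S.w := by
  have : (2 * k + 1) / 2 = k := by omega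
  simp [top, this]

theorem t4_xp : S.t4 * S.xp = S.xp * S.t4 := by
  rw [S.t4_mul, S.P_xp, S.D4_xp, mul_zero, add_zero]

theorem t4_x3 : S.t4 * S.x3 = S.x3 * S.t4 - (1 / 2 : ℂ) • (S.ε * S.t4) := by
  rw [S.t4_mul, S.P_x3, S.D4_x3, mul_smul_comm]; module

theorem t4_xm : S.t4 * S.xm = S.xm * S.t4 - S.ε * S.t5 := by
  rw [S.t4_mul, S.P_xm, S.D4_xm, mul_neg]; abel

theorem t5_xp : S.t5 * S.xp = S.xp * S.t5 - S.ε * S.t4 := by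
  rw [S.t5_mul, S.P_xp, S.D5_xp, mul_neg]; abel

theorem t5_x3 : S.t5 * S.x3 = S.x3 * S.t5 + (1 / 2 : ℂ) • (S.ε * S.t5) := by
  rw [S.t5_mul, S.P_x3, S.D5_x3, mul_smul_comm]

theorem t5_xm : S.t5 * S.xm = S.xm * S.t5 := by
  rw [S.t5_mul, S.P_xm, S.D5_xm, mul_zero, add_zero]

theorem t5_t4 : S.t5 * S.t4 = -(S.t4 * S.t5) - (1 / 2 : ℂ) • (S.ε * S.x3) := by
  rw [S.t5_mul, S.P_t4, S.D5_t4, mul_smul_comm, neg_mul]; module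

/-- The relation `t4_mul` for `Y = t4` reads `2 t4² = ε D4 t4`: squares of odd generators are of
order `ε`. -/
theorem t4_t4 : S.t4 * S.t4 = (1 / 4 : ℂ) • (S.ε * S.xp) := by
  have h := S.t4_mul S.t4
  rw [S.P_t4, S.D4_t4, mul_smul_comm, neg_mul] at h
  calc S.t4 * S.t4 = (1 / 2 : ℂ) • (S.t4 * S.t4 + S.t4 * S.t4) := by module
    _ = _ := by
      nth_rewrite 1 [h]
      module

theorem t5_t5 : S.t5 * S.t5 = -((1 / 4 : ℂ) • (S.ε * S.xm)) := by
  have h := S.t5_mul S.t5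
  rw [S.P_t5, S.D5_t5, mul_smul_comm, neg_mul] at h
  calc S.t5 * S.t5 = (1 / 2 : ℂ) • (S.t5 * S.t5 + S.t5 * S.t5) := by module
    _ = _ := by
      nth_rewrite 1 [h]
      module

theorem mul_mul_of_eq {A : Type*} [Semigroup A] {a b c : A} (h : a * b = c) (y : A) :
    a * (b * y) = c * y := by
  rw [← mul_assoc, h]

theorem ε_left (a y : R) : a * (S.ε * y) = S.ε * (a * y) := by
  rw [← mul_assoc, S.ε_comm, mul_assoc]

theorem D4_one : S.D4 1 = 0 := by
  have h := S.D4_mul 1 1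
  rw [S.P_one, mul_one, mul_one, one_mul] at h
  simpa using h

theorem D5_one : S.D5 1 = 0 := by
  have h := S.D5_mul 1 1
  rw [S.P_one, mul_one, mul_one, one_mul] at h
  simpa using h

theorem D4_ε_mul (Y : R) : S.D4 (S.ε * Y) = S.ε * S.D4 Y := by
  rw [S.D4_mul, S.D4_ε, S.P_ε, zero_mul, zero_add]

theorem D5_ε_mul (Y : R) : S.D5 (S.ε * Y) = S.ε * S.D5 Y := by
  rw [S.D5_mul, S.D5_ε, S.P_ε, zero_mul, zero_add]

theorem D4_C_mul (Y : R) : S.D4 (S.C * Y) = S.C * S.D4 Y := by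
  rw [S.D4_mul, S.D4_C, S.P_C, zero_mul, zero_add]

theorem D5_C_mul (Y : R) : S.D5 (S.C * Y) = S.C * S.D5 Y := by
  rw [S.D5_mul, S.D5_C, S.P_C, zero_mul, zero_add]

theorem P_xp_pow (k : ℕ) : S.P (S.xp ^ k) = S.xp ^ k := by
  induction k with
  | zero => simp [S.P_one]
  | succ k ih => rw [pow_succ, S.P_mul, ih, S.P_xp]

theorem D4_xp_pow (k : ℕ) : S.D4 (S.xp ^ k) = 0 := by
  induction k with
  | zero => simp [S.D4_one]
  | succ k ih => rw [pow_succ, S.D4_mul, ih, S.D4_xp]; simp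

theorem D5_xp_pow (k : ℕ) : S.D5 (S.xp ^ (k + 1)) = (-(k + 1 : ℂ)) • (S.xp ^ k * S.t4) := by
  induction k with
  | zero => simp [S.D5_xp]
  | succ k ih =>
    rw [pow_succ, S.D5_mul, ih, S.P_xp_pow, S.D5_xp, smul_mul_assoc, mul_assoc, S.t4_xp,
      ← mul_assoc, ← pow_succ, mul_neg]
    push_cast
    module

/-- The square of `D5` is a derivation. -/
theorem D5_D5_mul (Y Z : R) :
    S.D5 (S.D5 (Y * Z)) = S.D5 (S.D5 Y) * Z + Y * S.D5 (S.D5 Z) := by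
  rw [S.D5_mul, map_add, S.D5_mul, S.D5_mul, S.P_D5, S.P_P]
  noncomm_ring

/-- The factor `xp ^ k` is kept on the left, here and in the next two lemmas, so that the product
identities below only compare what stands to its right. -/
theorem D5_D5_xp_pow_mul (k : ℕ) (Y : R) :
    S.D5 (S.D5 (S.xp ^ (k + 1) * Y)) = S.xp ^ k *
      (((k + 1) * k / 4 : ℂ) • (S.ε * Y) + ((k + 1) / 2 : ℂ) • (S.x3 * Y) +
        S.xp * S.D5 (S.D5 Y)) := by
  have h : S.D5 (S.D5 (S.xp ^ (k + 1))) = S.xp ^ k * (((k + 1) * k / 4 : ℂ) • S.ε +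
      ((k + 1) / 2 : ℂ) • S.x3) := by
    rw [S.D5_xp_pow, map_smul, S.D5_mul, S.P_xp_pow, S.D5_t4]
    cases k with
    | zero =>
      simp [S.D5_one]
      module
    | succ k =>
      rw [S.D5_xp_pow, smul_mul_assoc, mul_assoc, S.t4_t4, pow_succ, ← S.ε_comm]
      simp only [mul_smul_comm, mul_add, mul_assoc]
      push_cast
      module
  rw [S.D5_D5_mul, h, pow_succ]
  simp only [mul_add, add_mul, smul_mul_assoc, mul_smul_comm, mul_assoc]

theorem D5_xp_pow_mul (k : ℕ) (Y : R) :
    S.D5 (S.xp ^ (k + 1) * Y) = S.xp ^ k * ((-(k + 1 : ℂ)) • (S.t4 * Y) + S.xp * S.D5 Y) := by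
  rw [S.D5_mul, S.D5_xp_pow, S.P_xp_pow, pow_succ]
  simp only [mul_add, smul_mul_assoc, mul_smul_comm, mul_assoc]

theorem xm_xp_pow (k : ℕ) :
    S.xm * S.xp ^ (k + 1) = S.xp ^ k * (S.xp * S.xm - (2 * (k + 1) : ℂ) • (S.ε * S.x3)
      - ((k + 1) * k : ℂ) • (S.ε * S.ε)) := by
  induction k with
  | zero => simp [S.xm_xp]
  | succ k ih =>
    rw [pow_succ, ← mul_assoc, ih]
    simp only [sub_mul, mul_sub, mul_add, smul_mul_assoc, mul_smul_comm, mul_assoc, S.xm_xp,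
      S.x3_xp, pow_succ, S.ε_left, S.ε_comm]
    push_cast
    module

theorem D5_w : S.D5 S.w = (-(3 / 2 : ℂ)) • (S.t4 * S.t5) -
    (1 / 2 : ℂ) • (S.x3 * S.x3 + S.xp * S.xm) + (1 / 8 : ℂ) • (S.ε * S.x3) := by
  simp only [w, map_add, map_sub, map_smul, S.D5_mul, S.D5_x3, S.D5_ε, S.D5_t4, S.D5_xp, S.D5_t5,
    S.P_x3, S.P_ε, S.P_xp, zero_mul, smul_mul_assoc, mul_smul_comm, S.t5_t4, sub_mul, neg_mul]
  module

theorem D5_D5_w : S.D5 (S.D5 S.w) = (-1 / 4 : ℂ) • (S.xm * S.t4) + (1 / 4 : ℂ) • (S.x3 * S.t5) +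
    (3 / 16 : ℂ) • (S.ε * S.t5) := by
  simp only [w, map_add, map_sub, map_smul, S.D5_D5_mul, S.D5_x3, S.D5_ε, S.D5_t4, S.D5_xp, S.D5_t5,
    S.D5_xm, map_zero, map_neg, smul_zero, smul_mul_assoc, mul_smul_comm, smul_smul, sub_mul,
    neg_mul, zero_mul, zero_add, mul_zero]
  module

/-- A Clebsch-Gordan decomposition: the lowest vector of the adjoint representation times a highest
weight vector with `n = 2 k + 2`. By weight only `D5 ^ 4` of `top (n + 2)`, `D5 ^ 3` of `top (n +
1)`, and so on down to `top (n - 2)` are possible. The identity is homogeneous if generators and `ε`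
have degree one and `C` has degree two, so `top (n + 1)` is too long to occur. What matters later is
that the coefficients are the same in every algebra. -/
theorem xm_mul_xp_pow (k : ℕ) :
    S.xm * S.xp ^ (k + 1) =
      (-8 / ((k + 2) * (2 * k + 3)) : ℂ) • S.D5 (S.D5 (S.D5 (S.D5 (S.xp ^ (k + 2))))) +
      (8 * (k + 1) / ((2 * k + 1) * (2 * k + 3)) : ℂ) • S.D5 (S.xp ^ k * S.w) +
      (2 * (k + 1) / (2 * k + 1) : ℂ) • (S.C * S.xp ^ k) +
      (-2 : ℂ) • (S.ε * S.D5 (S.D5 (S.xp ^ (k + 1)))) +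
      (-(k + 1) ^ 2 * k / (2 * (2 * k + 1)) : ℂ) • (S.ε * (S.ε * S.xp ^ k)) := by
  have h1 := S.D5_D5_xp_pow_mul k 1
  have h2 := S.D5_D5_xp_pow_mul (k + 1) 1
  have h3 : S.D5 (S.xp ^ k * S.w) = S.xp ^ k * ((-(k + 3 / 2 : ℂ)) • (S.t4 * S.t5) -
      (1 / 2 : ℂ) • (S.x3 * S.x3 + S.xp * S.xm) + ((1 - 2 * k) / 8 : ℂ) • (S.ε * S.x3) +
      (k / 16 : ℂ) • (S.ε * S.ε)) := by
    have htw : S.t4 * S.w = S.xp * (S.t4 * S.t5 + (1 / 4 : ℂ) • (S.ε * S.x3) -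
        (1 / 16 : ℂ) • (S.ε * S.ε)) := by
      simp only [w, mul_add, mul_sub, sub_mul, smul_mul_assoc, mul_smul_comm, mul_assoc, S.t4_t4,
        mul_mul_of_eq S.t4_x3, mul_mul_of_eq S.t4_xp, S.x3_xp, S.ε_left S.x3, S.ε_left S.xp,
        S.ε_left S.t4, S.ε_comm S.xp]
      module
    -- `D5_xp_pow_mul` needs a positive exponent; for `k = 0` the claim is `D5_w`.
    cases k with
    | zero => simp [S.D5_w]
    | succ k =>
      rw [S.D5_xp_pow_mul, htw, S.D5_w]
      simp only [mul_add, mul_sub, mul_smul_comm, pow_succ, mul_assoc, S.ε_left, S.ε_comm]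
      push_cast
      module
  simp only [mul_one, S.D5_one, map_zero, mul_zero, add_zero] at h1 h2
  rw [S.xm_xp_pow, h2, S.D5_D5_xp_pow_mul, h3, h1, ← S.C_comm, S.C_eq]
  have e1 : (k + 2 : ℂ) ≠ 0 := by exact_mod_cast (by omega : k + 2 ≠ 0)
  have e2 : (k * 2 + 3 : ℂ) ≠ 0 := by exact_mod_cast (by omega : k * 2 + 3 ≠ 0)
  have e2' : (2 * k + 3 : ℂ) ≠ 0 := by exact_mod_cast (by omega : 2 * k + 3 ≠ 0)
  have e3 : (k * 2 + 1 : ℂ) ≠ 0 := by exact_mod_cast (by omega : k * 2 + 1 ≠ 0)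
  have e3' : (2 * k + 1 : ℂ) ≠ 0 := by exact_mod_cast (by omega : 2 * k + 1 ≠ 0)
  -- Every term is brought to the form `xp ^ k * _`; the ordered cofactors are then compared
  -- monomial by monomial.
  rw [← S.ε_comm (S.xp ^ k)]
  simp only [← S.ε_left (S.xp ^ k), ← mul_smul_comm _ (S.xp ^ k), ← mul_add (S.xp ^ k)]
  refine congrArg (S.xp ^ k * ·) ?_
  simp only [map_add, map_smul, S.D5_x3, S.D5_t5, S.D5_ε, mul_add, mul_smul_comm, smul_add,
    smul_smul, smul_zero, zero_add, S.ε_comm S.x3]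
  push_cast
  match_scalars <;> field_simp <;> ring

/-- The odd counterpart, with `n = 2 k + 3`. Here `D5 ^ 3` of `top (n + 1)` does occur, while `D5`
of `top (n - 1)` does not. -/
theorem xm_mul_xp_pow_mul_w (k : ℕ) :
    S.xm * (S.xp ^ (k + 1) * S.w) =
      (-8 / ((k + 2) * (2 * k + 5)) : ℂ) • S.D5 (S.D5 (S.D5 (S.D5 (S.xp ^ (k + 2) * S.w)))) +
      (8 / ((k + 2) * (2 * k + 3) * (2 * k + 5)) : ℂ) •
        (S.C * S.D5 (S.D5 (S.D5 (S.xp ^ (k + 2))))) +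
      (2 * (k + 1) / (2 * k + 3) : ℂ) • (S.C * (S.xp ^ k * S.w)) +
      (-2 : ℂ) • (S.ε * S.D5 (S.D5 (S.xp ^ (k + 1) * S.w))) +
      (-(k + 1) ^ 2 * (k + 2) / (2 * (2 * k + 3)) : ℂ) • (S.ε * (S.ε * (S.xp ^ k * S.w))) +
      (1 / (2 * (k + 2) * (2 * k + 3) * (2 * k + 5)) : ℂ) •
        (S.ε * (S.ε * S.D5 (S.D5 (S.D5 (S.xp ^ (k + 2)))))) := by
  have h2 := S.D5_D5_xp_pow_mul (k + 1) 1
  simp only [mul_one, S.D5_one, map_zero, mul_zero, add_zero] at h2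
  rw [← mul_assoc, S.xm_xp_pow, h2, S.D5_D5_xp_pow_mul (k + 1), S.D5_D5_xp_pow_mul k,
    S.D5_D5_xp_pow_mul k, S.D5_xp_pow_mul k, ← S.C_comm, ← S.C_comm, mul_assoc (S.xp ^ k),
    mul_assoc (S.xp ^ k), S.C_eq]
  have e1 : (k + 2 : ℂ) ≠ 0 := by exact_mod_cast (by omega : k + 2 ≠ 0)
  have e2 : (k * 2 + 3 : ℂ) ≠ 0 := by exact_mod_cast (by omega : k * 2 + 3 ≠ 0)
  have e2' : (2 * k + 3 : ℂ) ≠ 0 := by exact_mod_cast (by omega : 2 * k + 3 ≠ 0)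
  have e3 : (k * 2 + 5 : ℂ) ≠ 0 := by exact_mod_cast (by omega : k * 2 + 5 ≠ 0)
  have e3' : (2 * k + 5 : ℂ) ≠ 0 := by exact_mod_cast (by omega : 2 * k + 5 ≠ 0)
  rw [mul_assoc (S.xp ^ k)]
  simp only [← S.ε_left (S.xp ^ k), ← mul_smul_comm _ (S.xp ^ k), ← mul_add (S.xp ^ k)]
  refine congrArg (S.xp ^ k * ·) ?_
  simp only [map_add, map_smul, S.D5_ε_mul, S.D5_D5_mul, S.D5_D5_w, S.D5_x3, S.D5_t5, S.D5_t4,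
    S.D5_xm, S.D5_xp, S.D5_ε, map_zero, map_neg, mul_add, mul_sub, add_mul, sub_mul, mul_smul_comm,
    smul_mul_assoc, neg_mul, mul_neg, zero_mul, smul_add, smul_sub, smul_neg, smul_smul, mul_zero,
    smul_zero, zero_add, add_zero]
  -- Normal ordering of the cofactors: `ε` in front, then `xp`, `x3`, `xm`, `t4`, `t5`.
  simp only [w, mul_assoc, mul_add, mul_sub, add_mul, sub_mul, mul_smul_comm, smul_mul_assoc,
    neg_mul, mul_neg, S.t4_x3, S.t4_xm, S.t5_x3, S.t5_xm, S.t5_t5, mul_mul_of_eq S.x3_xp,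
    mul_mul_of_eq S.xm_xp, mul_mul_of_eq S.xm_x3, mul_mul_of_eq S.t4_xp, mul_mul_of_eq S.t4_x3,
    mul_mul_of_eq S.t5_xp, mul_mul_of_eq S.t5_x3, mul_mul_of_eq S.t4_t4, mul_mul_of_eq S.t5_t4,
    S.ε_left, S.ε_comm S.t4]
  push_cast
  match_scalars <;> field_simp <;> ring

end OspAlgebra

/-! ### Highest weight vectors -/

/-- The coefficient in `J₄ J₅^s v = ladder n s • J₅^(s-1) v` for a highest weight vector `v` of
superspin `n / 2`. -/
def ladder (n s : ℕ) : ℝ := if Even s then s / 8 else -(n / 4) + (s - 1) / 8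

theorem ladder_add_two (n s : ℕ) : ladder n (s + 2) = ladder n s + 1 / 4 := by
  by_cases h : Even s
  · simp [ladder, h, Nat.even_add]; ring
  · simp [ladder, h, Nat.even_add]; ring

theorem ladder_even (n r : ℕ) : ladder n (2 * r) = r / 4 := by
  simp [ladder]; ring

theorem ladder_odd (n r : ℕ) : ladder n (2 * r + 1) = (r - n) / 4 := by
  simp [ladder]; ring

/-- The two excluded values are the ends of the string: `s = 0` at its top, `s = 2 n + 1` just past
its bottom. -/
theorem ladder_ne_zero {n s : ℕ} (h0 : s ≠ 0) (h : s ≠ 2 * n + 1) : ladder n s ≠ 0 := by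
  obtain ⟨r, rfl | rfl⟩ := Nat.even_or_odd' s
  · rw [ladder_even]
    have : (r : ℝ) ≠ 0 := by exact_mod_cast (by omega : r ≠ 0)
    positivity
  · rw [ladder_odd]
    have : (r : ℝ) ≠ n := by exact_mod_cast (by omega : r ≠ n)
    exact div_ne_zero (sub_ne_zero.mpr this) (by norm_num)

/-- Within the string the first coefficient is `r / 4 ≥ 0` for `s = 2 r` and `(r - n) / 4 < 0` for
`s = 2 r + 1`. Its sign therefore gives the parity of `s`, after which the two coefficients
determine `r` and `n`. -/
theorem ladder_injective {n n' s s' : ℕ} (hs : s ≤ 2 * n) (hs' : s' ≤ 2 * n')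
    (h1 : ladder n s = ladder n' s') (h2 : ladder n (s + 1) = ladder n' (s' + 1)) :
    n = n' ∧ s = s' := by
  obtain ⟨r, rfl | rfl⟩ := Nat.even_or_odd' s <;> obtain ⟨r', rfl | rfl⟩ := Nat.even_or_odd' s'
  · rw [ladder_even, ladder_even] at h1
    rw [ladder_odd, ladder_odd] at h2
    have e1 : (r : ℝ) = r' := by linarith
    have e2 : (n : ℝ) = n' := by linarith
    norm_cast at e1 e2
    omega
  · rw [ladder_even, ladder_odd] at h1
    have hr : (r' : ℝ) + 1 ≤ n' := by exact_mod_cast (by omega : r' + 1 ≤ n')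
    have := Nat.cast_nonneg (α := ℝ) r
    linarith
  · rw [ladder_even, ladder_odd] at h1
    have hr : (r : ℝ) + 1 ≤ n := by exact_mod_cast (by omega : r + 1 ≤ n)
    have := Nat.cast_nonneg (α := ℝ) r'
    linarith
  · rw [ladder_odd, ladder_odd] at h1
    rw [show 2 * r + 1 + 1 = 2 * (r + 1) by ring, show 2 * r' + 1 + 1 = 2 * (r' + 1) by ring,
      ladder_even, ladder_even] at h2
    push_cast at h2
    have e1 : (r : ℝ) = r' := by linarith
    have e2 : (n : ℝ) = n' := by linarith
    norm_cast at e1 e2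
    omega

/-- `v` is a highest weight vector of superspin `n / 2` for the odd raising operator `A` and the odd
lowering operator `B`. -/
structure IsHighestWeight {V : Type*} [AddCommGroup V] [Module ℂ V] (A B : Module.End ℂ V)
    (n : ℕ) (v : V) : Prop where
  raise : A v = 0
  weight : A (B v) = (-(n / 4) : ℂ) • v
  rel : ∀ s : ℕ, A (B (B ((B ^ s) v))) = B (B (A ((B ^ s) v))) + (1 / 4 : ℂ) • B ((B ^ s) v)

namespace IsHighestWeight

variable {V : Type*} [AddCommGroup V] [Module ℂ V] {A B : Module.End ℂ V} {n : ℕ} {v : V}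

/-- The field `rel` is `[A, B²] = B / 4`, so the coefficient grows by `1 / 4` every two steps from
its values at `s = 1` and `s = 2`. The relation is imposed along the string only, because for
superfields it is derived only on polynomials. -/
theorem lower (h : IsHighestWeight A B n v) (s : ℕ) :
    A ((B ^ (s + 1)) v) = (ladder n (s + 1) : ℂ) • (B ^ s) v := by
  induction s using Nat.twoStepInduction with
  | zero =>
    have := ladder_odd n 0
    rw [show 2 * 0 + 1 = 0 + 1 from rfl] at this
    rw [this]
    simp [h.weight, neg_div]
  | one =>
    have := ladder_even n 1
    rw [show 2 * 1 = 1 + 1 from rfl] at this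
    rw [this]
    have h0 := h.rel 0
    simp only [pow_zero, Module.End.one_apply, h.raise, map_zero, zero_add] at h0
    simp [pow_succ, h0]
  | more s ih _ =>
    rw [pow_succ' B (s + 2), pow_succ' B (s + 1), Module.End.mul_apply, Module.End.mul_apply, h.rel,
      ih, show s + 2 + 1 = s + 1 + 2 from rfl, ladder_add_two, map_smul, map_smul, pow_succ' B s]
    simp only [Module.End.mul_apply]
    push_cast
    module

theorem pow_ne_zero (h : IsHighestWeight A B n v) (hv : v ≠ 0) {s : ℕ} (hs : s ≤ 2 * n) :
    (B ^ s) v ≠ 0 := by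
  induction s with
  | zero => simpa
  | succ s ih =>
    intro h0
    have h1 := h.lower s
    rw [h0, map_zero] at h1
    refine smul_ne_zero ?_ (ih (by omega)) h1.symm
    exact_mod_cast ladder_ne_zero (by omega) (by omega)

/-- No ladder coefficient vanishes beyond `2 n + 1`, so if `B ^ (2 n + 1) v` were nonzero, no higher
power of `B` could kill `v`. -/
theorem pow_eq_zero (h : IsHighestWeight A B n v) {N : ℕ} (hN : (B ^ N) v = 0) :
    (B ^ (2 * n + 1)) v = 0 := by
  by_contra h0
  have key : ∀ m, (B ^ (2 * n + 1 + m)) v ≠ 0 := by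
    intro m
    induction m with
    | zero => exact h0
    | succ m ih =>
      intro hz
      have h1 := h.lower (2 * n + 1 + m)
      rw [show 2 * n + 1 + m + 1 = 2 * n + 1 + (m + 1) from rfl, hz, map_zero] at h1
      refine smul_ne_zero ?_ ih h1.symm
      exact_mod_cast ladder_ne_zero (by omega) (by omega)
  refine key N ?_
  rw [pow_add, Module.End.mul_apply, hN, map_zero]

theorem map {W : Type*} [AddCommGroup W] [Module ℂ W] {A' B' : Module.End ℂ W}
    (h : IsHighestWeight A B n v) (f : V →ₗ[ℂ] W) (hA : ∀ x, f (A x) = A' (f x))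
    (hB : ∀ x, f (B x) = B' (f x)) : IsHighestWeight A' B' n (f v) := by
  have hp : ∀ s x, f ((B ^ s) x) = (B' ^ s) (f x) := by
    intro s x
    induction s with
    | zero => simp
    | succ s ih => rw [pow_succ', pow_succ', Module.End.mul_apply, Module.End.mul_apply, hB, ih]
  refine ⟨by rw [← hA, h.raise, map_zero], by rw [← hB, ← hA, h.weight, map_smul], fun s => ?_⟩
  rw [← hp, ← hB, ← hB, ← hA, h.rel, map_add, map_smul, hB, hB, hA, hB]

theorem smul (h : IsHighestWeight A B n v) (c : ℂ) : IsHighestWeight A B n (c • v) := by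
  refine ⟨by rw [map_smul, h.raise, smul_zero], ?_, fun s => ?_⟩
  · rw [map_smul, map_smul, h.weight, smul_comm]
  · simp only [map_smul, h.rel, smul_add]
    rw [smul_comm]

end IsHighestWeight

/-- Descendants of nonzero highest weight vectors of distinct superspins are linearly
independent. -/
theorem linearIndependent_descendants {V : Type*} [AddCommGroup V] [Module ℂ V]
    (A B : Module.End ℂ V) (v : ℕ → V) (N : ℕ) (hv : ∀ n < N, IsHighestWeight A B n (v n))
    (h0 : ∀ n < N, v n ≠ 0) :
    LinearIndependent ℂ (fun i : (n : Fin N) × Fin (2 * n.val + 1) =>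
      (B ^ i.2.val) (v i.1.val)) := by
  -- Both `B A` and `A B` act on each descendant by a real scalar. Combined with the factor `I`,
  -- they give one operator whose eigenvalue records the two scalars as real and imaginary part.
  refine Module.End.eigenvectors_linearIndependent' (B * A + Complex.I • (A * B))
    (fun i => (ladder i.1 i.2 : ℂ) + Complex.I * ladder i.1 (i.2 + 1)) ?_ _ ?_
  · rintro ⟨n, s⟩ ⟨n', s'⟩ h
    have h1 := congrArg Complex.re h
    have h2 := congrArg Complex.im h
    simp at h1 h2
    obtain ⟨e1, e2⟩ := ladder_injective (Nat.lt_succ_iff.mp s.2) (Nat.lt_succ_iff.mp s'.2) h1 h2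
    obtain rfl := Fin.ext e1
    obtain rfl := Fin.ext e2
    rfl
  · rintro ⟨n, s⟩
    have hw := hv n n.2
    refine ⟨?_, hw.pow_ne_zero (h0 n n.2) (Nat.lt_succ_iff.mp s.2)⟩
    rw [Module.End.mem_eigenspace_iff]
    dsimp only
    have h1 : B (A ((B ^ s.val) (v n))) = (ladder n s : ℂ) • (B ^ s.val) (v n) := by
      rcases Nat.eq_zero_or_eq_succ_pred s.val with hs | hs
      · simp [hs, hw.raise, ladder]
      · rw [hs, hw.lower, map_smul, Nat.succ_eq_add_one, pow_succ', Module.End.mul_apply]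
    have h2 : A (B ((B ^ s.val) (v n))) = (ladder n (s + 1) : ℂ) • (B ^ s.val) (v n) := by
      rw [← hw.lower, pow_succ', Module.End.mul_apply]
    simp only [LinearMap.add_apply, LinearMap.smul_apply, Module.End.mul_apply, h1, h2]
    module

/-! ### Highest weight vectors of a deformed algebra. -/

namespace OspAlgebra

variable {R : Type*} [Ring R] [Algebra ℂ R] (S : OspAlgebra R)

/-- The constant `3 / 4` in `w` is the one for which the three contributions `-1/8`, `1/2` and
`-3/8` of `ε * xp` cancel. -/
theorem D4_w : S.D4 S.w = 0 := by
  simp only [w, map_add, map_sub, map_smul, S.D4_mul, S.D4_x3, S.D4_ε, S.D4_t4, S.D4_xp, S.D4_t5,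
    S.P_x3, S.P_ε, S.P_xp, smul_mul_assoc, mul_smul_comm, S.t4_t4, S.x3_xp, sub_mul, zero_mul]
  module

theorem P_w : S.P S.w = -S.w := by
  simp only [w, map_add, map_sub, map_smul, S.P_mul, S.P_x3, S.P_ε, S.P_xp, S.P_t4, S.P_t5]
  noncomm_ring

theorem D4_D5_w : S.D4 (S.D5 S.w) = (-1 / 4 : ℂ) • S.w := by
  rw [D5_w]
  simp only [w, map_add, map_sub, map_smul, S.D4_mul, S.D4_x3, S.D4_ε, S.D4_t4, S.D4_xp, S.D4_t5,
    S.D4_xm, S.P_t4, S.P_x3, S.P_ε, S.P_xp, smul_mul_assoc, mul_smul_comm, S.t4_x3, sub_mul,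
    neg_mul, mul_neg, zero_mul]
  module

theorem D4_top (n : ℕ) : S.D4 (S.top n) = 0 := by
  obtain ⟨k, rfl | rfl⟩ := Nat.even_or_odd' n
  · rw [top_even, S.D4_xp_pow]
  · rw [top_odd, S.D4_mul, S.D4_xp_pow, S.D4_w, zero_mul, mul_zero, add_zero]

theorem D4_D5_top (n : ℕ) : S.D4 (S.D5 (S.top n)) = (-(n / 4) : ℂ) • S.top n := by
  obtain ⟨k, rfl | rfl⟩ := Nat.even_or_odd' n
  · rw [top_even]
    cases k with
    | zero => simp [S.D5_one]
    | succ k =>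
      rw [S.D5_xp_pow, map_smul, S.D4_mul, S.D4_xp_pow, S.P_xp_pow, S.D4_t4, zero_mul, zero_add,
        mul_smul_comm, ← pow_succ]
      push_cast
      module
  · rw [top_odd]
    cases k with
    | zero =>
      simp only [pow_zero, one_mul, D4_D5_w]
      norm_num
    | succ k =>
      rw [S.D5_xp_pow_mul, S.D4_mul, S.D4_xp_pow, S.P_xp_pow, zero_mul, zero_add, map_add, map_smul,
        S.D4_mul, S.D4_mul, S.D4_t4, S.D4_w, S.D4_xp, S.P_xp, D4_D5_w, pow_succ, mul_zero, add_zero,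
        zero_mul, zero_add]
      simp only [mul_add, mul_smul_comm, smul_mul_assoc, mul_assoc]
      push_cast
      module

theorem P_top (n : ℕ) : S.P (S.top n) = (-1 : ℂ) ^ n • S.top n := by
  obtain ⟨k, rfl | rfl⟩ := Nat.even_or_odd' n
  · simp [top_even, S.P_xp_pow]
  · simp [top_odd, S.P_mul, S.P_xp_pow, S.P_w, pow_succ]

theorem P_D5_pow_top (n s : ℕ) :
    S.P ((S.D5 ^ s) (S.top n)) = (-1 : ℂ) ^ (n + s) • (S.D5 ^ s) (S.top n) := by
  induction s with
  | zero => simp [P_top]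
  | succ s ih =>
    rw [pow_succ', Module.End.mul_apply, S.P_D5, ih, map_smul, ← add_assoc, pow_succ]
    simp

/-- The set of the generators. -/
def gens : Set R := {S.xp, S.xm, S.x3, S.t4, S.t5, S.ε}

/-- Stability under `P` has to be proved together with stability under `D5`, since the graded
Leibniz rule involves `P Y`. -/
theorem D5_mem {Y : R} (hY : Y ∈ Algebra.adjoin ℂ S.gens) : S.D5 Y ∈ Algebra.adjoin ℂ S.gens ∧
    S.P Y ∈ Algebra.adjoin ℂ S.gens := by
  have hxm : S.xm ∈ Algebra.adjoin ℂ S.gens := Algebra.subset_adjoin (by simp [gens])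
  have hx3 : S.x3 ∈ Algebra.adjoin ℂ S.gens := Algebra.subset_adjoin (by simp [gens])
  have ht4 : S.t4 ∈ Algebra.adjoin ℂ S.gens := Algebra.subset_adjoin (by simp [gens])
  have ht5 : S.t5 ∈ Algebra.adjoin ℂ S.gens := Algebra.subset_adjoin (by simp [gens])
  induction hY using Algebra.adjoin_induction with
  | mem Y hY =>
    have hm := Algebra.subset_adjoin (R := ℂ) hY
    simp only [gens, Set.mem_insert_iff, Set.mem_singleton_iff] at hY
    rcases hY with rfl | rfl | rfl | rfl | rfl | rfl
    · exact ⟨S.D5_xp ▸ neg_mem ht4, by rwa [S.P_xp]⟩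
    · exact ⟨S.D5_xm ▸ zero_mem _, by rwa [S.P_xm]⟩
    · exact ⟨S.D5_x3 ▸ Subalgebra.smul_mem _ ht5 _, by rwa [S.P_x3]⟩
    · exact ⟨S.D5_t4 ▸ Subalgebra.smul_mem _ hx3 _, S.P_t4 ▸ neg_mem hm⟩
    · exact ⟨S.D5_t5 ▸ Subalgebra.smul_mem _ hxm _, S.P_t5 ▸ neg_mem hm⟩
    · exact ⟨S.D5_ε ▸ zero_mem _, by rwa [S.P_ε]⟩
  | algebraMap r =>
    rw [Algebra.algebraMap_eq_smul_one, map_smul, map_smul, S.D5_one, S.P_one]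
    exact ⟨by simp, Subalgebra.smul_mem _ (one_mem _) _⟩
  | add Y Z _ _ h1 h2 => exact ⟨by rw [map_add]; exact add_mem h1.1 h2.1,
      by rw [map_add]; exact add_mem h1.2 h2.2⟩
  | mul Y Z hY hZ h1 h2 =>
    exact ⟨by rw [S.D5_mul]; exact add_mem (mul_mem h1.1 hZ) (mul_mem h1.2 h2.1),
      by rw [S.P_mul]; exact mul_mem h1.2 h2.2⟩

theorem w_mem : S.w ∈ Algebra.adjoin ℂ S.gens := by
  have h : ∀ g ∈ S.gens, g ∈ Algebra.adjoin ℂ S.gens := fun g hg => Algebra.subset_adjoin hg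
  refine add_mem (mul_mem (sub_mem (h _ ?_) (Subalgebra.smul_mem _ (h _ ?_) _)) (h _ ?_))
    (mul_mem (h _ ?_) (h _ ?_)) <;> simp [gens]

theorem top_mem (n : ℕ) : S.top n ∈ Algebra.adjoin ℂ S.gens := by
  have h : S.xp ∈ Algebra.adjoin ℂ S.gens := Algebra.subset_adjoin (by simp [gens])
  unfold top
  split_ifs
  · exact pow_mem h _
  · exact mul_mem (pow_mem h _) S.w_mem

theorem D5_pow_top_mem (n s : ℕ) : (S.D5 ^ s) (S.top n) ∈ Algebra.adjoin ℂ S.gens := by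
  induction s with
  | zero => exact S.top_mem n
  | succ s ih => rw [pow_succ', Module.End.mul_apply]; exact (S.D5_mem ih).1

/-- The commutator of `J₄` with `J₅²` on the subalgebra of the generators. -/
theorem D4_D5_D5 {Y : R} (hY : Y ∈ Algebra.adjoin ℂ S.gens) :
    S.D4 (S.D5 (S.D5 Y)) = S.D5 (S.D5 (S.D4 Y)) + (1 / 4 : ℂ) • S.D5 Y := by
  induction hY using Algebra.adjoin_induction with
  | mem Y hY =>
    simp only [gens, Set.mem_insert_iff, Set.mem_singleton_iff] at hY
    rcases hY with rfl | rfl | rfl | rfl | rfl | rfl <;>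
    · simp only [S.D4_xp, S.D4_xm, S.D4_x3, S.D4_t4, S.D4_t5, S.D4_ε, S.D5_xp, S.D5_xm, S.D5_x3,
      S.D5_t4, S.D5_t5, S.D5_ε, map_smul, map_neg, map_zero]
      module
  | algebraMap r =>
    simp [Algebra.algebraMap_eq_smul_one, S.D5_one, S.D4_one]
  | add Y Z _ _ h1 h2 =>
    simp only [map_add, h1, h2]
    module
  | mul Y Z hY hZ h1 h2 =>
    rw [S.D5_D5_mul Y Z, map_add, S.D4_mul, S.D4_mul Y, S.D4_mul Y Z, map_add, map_add, S.D5_D5_mul,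
      S.D5_D5_mul, h1, h2, S.D5_mul Y Z, S.P_D5, S.P_D5, map_neg, neg_neg]
    simp only [mul_add, add_mul, smul_mul_assoc, mul_smul_comm]
    module

theorem isHighestWeight_top (n : ℕ) : IsHighestWeight S.D4 S.D5 n (S.top n) :=
  ⟨S.D4_top n, S.D4_D5_top n, fun s => S.D4_D5_D5 (S.D5_pow_top_mem n s)⟩

/-! ### The span of the descendants is closed under multiplication -/

/-- The span of the descendants of the highest weight vectors over the polynomials in the central
elements `ε` and `C`. -/
def harmonicSpan : Submodule ℂ R :=
  Submodule.span ℂ {Y | ∃ i j n s : ℕ, Y = S.ε ^ i * S.C ^ j * (S.D5 ^ s) (S.top n)}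

theorem basic_mem (n s : ℕ) : (S.D5 ^ s) (S.top n) ∈ S.harmonicSpan :=
  Submodule.subset_span ⟨0, 0, n, s, by simp⟩

theorem ε_mul_mem {Y : R} (hY : Y ∈ S.harmonicSpan) : S.ε * Y ∈ S.harmonicSpan := by
  induction hY using Submodule.span_induction with
  | mem Y hY =>
    obtain ⟨i, j, n, s, rfl⟩ := hY
    exact Submodule.subset_span ⟨i + 1, j, n, s, by rw [pow_succ']; simp only [mul_assoc]⟩
  | zero => simp
  | add Y Z _ _ h1 h2 => rw [mul_add]; exact add_mem h1 h2
  | smul c Y _ h => rw [mul_smul_comm]; exact Submodule.smul_mem _ _ h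

theorem C_mul_mem {Y : R} (hY : Y ∈ S.harmonicSpan) : S.C * Y ∈ S.harmonicSpan := by
  induction hY using Submodule.span_induction with
  | mem Y hY =>
    obtain ⟨i, j, n, s, rfl⟩ := hY
    refine Submodule.subset_span ⟨i, j + 1, n, s, ?_⟩
    rw [pow_succ', ← mul_assoc, ← mul_assoc, ← mul_assoc, S.C_comm]
  | zero => simp
  | add Y Z _ _ h1 h2 => rw [mul_add]; exact add_mem h1 h2
  | smul c Y _ h => rw [mul_smul_comm]; exact Submodule.smul_mem _ _ h

theorem pow_mul_pow_mul_map (D : R →ₗ[ℂ] R) (h1 : ∀ Y, D (S.ε * Y) = S.ε * D Y)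
    (h2 : ∀ Y, D (S.C * Y) = S.C * D Y) (i j : ℕ) (Y : R) :
    D (S.ε ^ i * S.C ^ j * Y) = S.ε ^ i * S.C ^ j * D Y := by
  have hC : ∀ j Y, D (S.C ^ j * Y) = S.C ^ j * D Y := by
    intro j
    induction j with
    | zero => simp
    | succ j ih => intro Y; rw [pow_succ, mul_assoc, ih, h2, mul_assoc]
  induction i with
  | zero => simpa using hC j Y
  | succ i ih =>
    rw [pow_succ', mul_assoc, mul_assoc, h1, ← mul_assoc (S.ε ^ i), ih]
    simp only [mul_assoc]

theorem D5_mem_harmonicSpan {Y : R} (hY : Y ∈ S.harmonicSpan) : S.D5 Y ∈ S.harmonicSpan := by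
  induction hY using Submodule.span_induction with
  | mem Y hY =>
    obtain ⟨i, j, n, s, rfl⟩ := hY
    refine Submodule.subset_span ⟨i, j, n, s + 1, ?_⟩
    rw [S.pow_mul_pow_mul_map S.D5 S.D5_ε_mul S.D5_C_mul, pow_succ' S.D5, Module.End.mul_apply]
  | zero => simp
  | add Y Z _ _ h1 h2 => rw [map_add]; exact add_mem h1 h2
  | smul c Y _ h => rw [map_smul]; exact Submodule.smul_mem _ _ h

theorem D4_mem_harmonicSpan {Y : R} (hY : Y ∈ S.harmonicSpan) : S.D4 Y ∈ S.harmonicSpan := by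
  induction hY using Submodule.span_induction with
  | mem Y hY =>
    obtain ⟨i, j, n, s, rfl⟩ := hY
    rw [S.pow_mul_pow_mul_map S.D4 S.D4_ε_mul S.D4_C_mul]
    cases s with
    | zero => simp [S.D4_top]
    | succ s =>
      rw [(S.isHighestWeight_top n).lower, mul_smul_comm]
      exact Submodule.smul_mem _ _ (Submodule.subset_span ⟨i, j, n, s, rfl⟩)
  | zero => simp
  | add Y Z _ _ h1 h2 => rw [map_add]; exact add_mem h1 h2
  | smul c Y _ h => rw [map_smul]; exact Submodule.smul_mem _ _ h

/-- The adjoint representation as a string of `D5`. This is `xm_mul_xp_pow` read at `k = -1`. -/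
theorem xm_eq : S.xm = (-8 : ℂ) • (S.D5 ^ 4) S.xp := by
  simp only [pow_succ, pow_zero, one_mul, Module.End.mul_apply, S.D5_xp, S.D5_t4, S.D5_x3, S.D5_t5,
    map_neg, map_smul]
  module

/-- This is `xm_mul_xp_pow_mul_w` read at `k = -1`, where the coefficients of the terms with `xp ^
k` vanish. -/
theorem xm_mul_w : S.xm * S.w = (-8 / 3 : ℂ) • S.D5 (S.D5 (S.D5 (S.D5 (S.xp * S.w)))) +
    (8 / 3 : ℂ) • (S.C * S.D5 (S.D5 (S.D5 S.xp))) + (-2 : ℂ) • (S.ε * S.D5 (S.D5 S.w)) +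
    (1 / 6 : ℂ) • (S.ε * (S.ε * S.D5 (S.D5 (S.D5 S.xp)))) := by
  rw [S.C_eq]
  simp only [map_add, map_smul, S.D5_ε_mul, S.D5_D5_mul, S.D5_D5_w, S.D5_x3, S.D5_t5, S.D5_t4,
    S.D5_xm, S.D5_xp, map_zero, map_neg, mul_add, add_mul, sub_mul, mul_smul_comm, smul_mul_assoc,
    neg_mul, mul_neg, zero_mul, smul_add, smul_sub, smul_neg, smul_smul, mul_zero, smul_zero,
    zero_add, add_zero]
  simp only [w, mul_assoc, mul_add, mul_sub, add_mul, sub_mul, mul_smul_comm, smul_mul_assoc,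
    mul_neg, S.t4_xm, S.t5_t5, mul_mul_of_eq S.xm_xp, mul_mul_of_eq S.xm_x3, S.ε_left]
  module

theorem xm_mul_top_mem (n : ℕ) : S.xm * S.top n ∈ S.harmonicSpan := by
  have hm : ∀ n, S.top n ∈ S.harmonicSpan := fun n => by simpa using S.basic_mem n 0
  have hx : ∀ k, S.xp ^ k ∈ S.harmonicSpan := fun k => S.top_even k ▸ hm _
  have hw : ∀ k, S.xp ^ k * S.w ∈ S.harmonicSpan := fun k => S.top_odd k ▸ hm _
  have hD : ∀ {Y}, Y ∈ S.harmonicSpan → S.D5 Y ∈ S.harmonicSpan := S.D5_mem_harmonicSpan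
  obtain ⟨k, rfl | rfl⟩ := Nat.even_or_odd' n
  · rw [top_even]
    cases k with
    | zero =>
      rw [pow_zero, mul_one, xm_eq, ← pow_one S.xp, ← S.top_even 1]
      exact Submodule.smul_mem _ _ (S.basic_mem _ _)
    | succ k =>
      rw [xm_mul_xp_pow]
      refine add_mem (add_mem (add_mem (add_mem ?_ ?_) ?_) ?_) ?_ <;>
        refine Submodule.smul_mem _ _ ?_
      · exact hD (hD (hD (hD (hx _))))
      · exact hD (hw _)
      · exact S.C_mul_mem (hx _)
      · exact S.ε_mul_mem (hD (hD (hx _)))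
      · exact S.ε_mul_mem (S.ε_mul_mem (hx _))
  · rw [top_odd]
    cases k with
    | zero =>
      have hx1 := hx 1
      have hw0 := hw 0
      have hw1 := hw 1
      rw [pow_one] at hx1 hw1
      rw [pow_zero, one_mul] at hw0 ⊢
      rw [xm_mul_w]
      refine add_mem (add_mem (add_mem ?_ ?_) ?_) ?_ <;> refine Submodule.smul_mem _ _ ?_
      · exact hD (hD (hD (hD hw1)))
      · exact S.C_mul_mem (hD (hD (hD hx1)))
      · exact S.ε_mul_mem (hD (hD hw0))
      · exact S.ε_mul_mem (S.ε_mul_mem (hD (hD (hD hx1))))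
    | succ k =>
      rw [xm_mul_xp_pow_mul_w]
      refine add_mem (add_mem (add_mem (add_mem (add_mem ?_ ?_) ?_) ?_) ?_) ?_ <;>
        refine Submodule.smul_mem _ _ ?_
      · exact hD (hD (hD (hD (hw _))))
      · exact S.C_mul_mem (hD (hD (hD (hx _))))
      · exact S.C_mul_mem (hw _)
      · exact S.ε_mul_mem (hD (hD (hw _)))
      · exact S.ε_mul_mem (S.ε_mul_mem (hw _))
      · exact S.ε_mul_mem (S.ε_mul_mem (hD (hD (hD (hx _)))))

theorem smul_mem_iff_of_ne {V : Type*} [AddCommGroup V] [Module ℂ V] (p : Submodule ℂ V) {c : ℂ}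
    (hc : c ≠ 0) {Y : V} (h : c • Y ∈ p) : Y ∈ p := by
  simpa [hc] using p.smul_mem c⁻¹ h

/-- All generators multiply `Y` into `harmonicSpan`. -/
def MulMem (Y : R) : Prop := S.xp * Y ∈ S.harmonicSpan ∧ S.xm * Y ∈ S.harmonicSpan ∧
  S.x3 * Y ∈ S.harmonicSpan ∧ S.t4 * Y ∈ S.harmonicSpan ∧ S.t5 * Y ∈ S.harmonicSpan

/-- Since `D4` kills `top n`, it acts on a product `g * top n` through `g` alone. Starting from the
lowest generator `xm` it climbs through `t5`, `x3`, `t4` to `xp`, up to nonzero factors, so the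
single product with `xm` yields all five. -/
theorem mulMem_top (n : ℕ) : S.MulMem (S.top n) := by
  have hm := S.xm_mul_top_mem n
  have h5 := S.D4_mem_harmonicSpan hm
  rw [S.D4_mul, S.D4_top, mul_zero, add_zero, S.D4_xm, neg_mul, neg_mem_iff] at h5
  have h3 := S.D4_mem_harmonicSpan h5
  rw [S.D4_mul, S.D4_top, mul_zero, add_zero, S.D4_t5, smul_mul_assoc] at h3
  replace h3 := smul_mem_iff_of_ne _ (by norm_num) h3
  have h4 := S.D4_mem_harmonicSpan h3
  rw [S.D4_mul, S.D4_top, mul_zero, add_zero, S.D4_x3, smul_mul_assoc] at h4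
  replace h4 := smul_mem_iff_of_ne _ (by norm_num) h4
  have hp := S.D4_mem_harmonicSpan h4
  rw [S.D4_mul, S.D4_top, mul_zero, add_zero, S.D4_t4, smul_mul_assoc] at hp
  replace hp := smul_mem_iff_of_ne _ (by norm_num) hp
  exact ⟨hp, hm, h3, h4, h5⟩

/-- By the Leibniz rule `P g * D5 Y = D5 (g * Y) - D5 g * Y`, and `D5 g` is zero or a multiple of
another generator. -/
theorem MulMem.D5 {Y : R} (h : S.MulMem Y) : S.MulMem (S.D5 Y) := by
  obtain ⟨hp, hm, h3, h4, h5⟩ := h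
  have key : ∀ g, g * Y ∈ S.harmonicSpan → S.D5 g * Y ∈ S.harmonicSpan →
      S.P g * S.D5 Y ∈ S.harmonicSpan := by
    intro g hg hg'
    have := sub_mem (S.D5_mem_harmonicSpan hg) hg'
    rwa [S.D5_mul, add_sub_cancel_left] at this
  refine ⟨?_, ?_, ?_, ?_, ?_⟩
  · rw [← S.P_xp]
    exact key _ hp (by rw [S.D5_xp, neg_mul]; exact neg_mem h4)
  · rw [← S.P_xm]
    exact key _ hm (by rw [S.D5_xm, zero_mul]; exact zero_mem _)
  · rw [← S.P_x3]
    exact key _ h3 (by rw [S.D5_x3, smul_mul_assoc]; exact Submodule.smul_mem _ _ h5)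
  · have := key _ h4 (by rw [S.D5_t4, smul_mul_assoc]; exact Submodule.smul_mem _ _ h3)
    rwa [S.P_t4, neg_mul, neg_mem_iff] at this
  · have := key _ h5 (by rw [S.D5_t5, smul_mul_assoc]; exact Submodule.smul_mem _ _ hm)
    rwa [S.P_t5, neg_mul, neg_mem_iff] at this

theorem mulMem_D5_pow_top (n s : ℕ) : S.MulMem ((S.D5 ^ s) (S.top n)) := by
  induction s with
  | zero => exact S.mulMem_top n
  | succ s ih => rw [pow_succ', Module.End.mul_apply]; exact ih.D5

theorem pow_mul_pow_mul_mem (i j : ℕ) {Y : R} (hY : Y ∈ S.harmonicSpan) :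
    S.ε ^ i * S.C ^ j * Y ∈ S.harmonicSpan := by
  have hC : ∀ j, S.C ^ j * Y ∈ S.harmonicSpan := by
    intro j
    induction j with
    | zero => simpa
    | succ j ih => rw [pow_succ', mul_assoc]; exact S.C_mul_mem ih
  induction i with
  | zero => simpa using hC j
  | succ i ih => rw [pow_succ', mul_assoc, mul_assoc, ← mul_assoc (S.ε ^ i)]; exact S.ε_mul_mem ih

theorem gen_mul_mem {g : R} (hg : g ∈ S.gens) {Y : R} (hY : Y ∈ S.harmonicSpan) :
    g * Y ∈ S.harmonicSpan := by
  induction hY using Submodule.span_induction with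
  | mem Y hY =>
    obtain ⟨i, j, n, s, rfl⟩ := hY
    have hcomm : g * (S.ε ^ i * S.C ^ j * (S.D5 ^ s) (S.top n)) =
        S.ε ^ i * S.C ^ j * (g * (S.D5 ^ s) (S.top n)) := by
      have h1 : Commute g (S.ε ^ i) := Commute.pow_right (S.ε_comm g) i
      have h2 : Commute g (S.C ^ j) := Commute.pow_right (S.C_comm g) j
      rw [← mul_assoc, (h1.mul_right h2).eq, mul_assoc]
    rw [hcomm]
    obtain ⟨hp, hm, h3, h4, h5⟩ := S.mulMem_D5_pow_top n s
    simp only [gens, Set.mem_insert_iff, Set.mem_singleton_iff] at hg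
    refine S.pow_mul_pow_mul_mem i j ?_
    rcases hg with rfl | rfl | rfl | rfl | rfl | rfl
    · exact hp
    · exact hm
    · exact h3
    · exact h4
    · exact h5
    · exact S.ε_mul_mem (S.basic_mem n s)
  | zero => simp
  | add Y Z _ _ h1 h2 => rw [mul_add]; exact add_mem h1 h2
  | smul c Y _ h => rw [mul_smul_comm]; exact Submodule.smul_mem _ _ h

/-- In a product of algebras this provides one expansion of `Y * Z` that holds in all factors at
once; the limit rests on this. -/
theorem mul_mem_harmonicSpan {Y Z : R} (hY : Y ∈ Algebra.adjoin ℂ S.gens)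
    (hZ : Z ∈ S.harmonicSpan) :
    Y * Z ∈ S.harmonicSpan := by
  induction hY using Algebra.adjoin_induction generalizing Z with
  | mem g hg => exact S.gen_mul_mem hg hZ
  | algebraMap r => rw [← Algebra.smul_def]; exact Submodule.smul_mem _ _ hZ
  | add X Y _ _ h1 h2 => rw [add_mul]; exact add_mem (h1 hZ) (h2 hZ)
  | mul X Y _ _ h1 h2 => rw [mul_assoc]; exact h1 (h2 hZ)

theorem adjoin_le_harmonicSpan {Y : R} (hY : Y ∈ Algebra.adjoin ℂ S.gens) : Y ∈ S.harmonicSpan := by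
  have h1 : (1 : R) ∈ S.harmonicSpan := by simpa [top] using S.basic_mem 0 0
  simpa using S.mul_mem_harmonicSpan hY h1

end OspAlgebra

/-! ### Products of deformed algebras and naturality of descendants. -/

namespace OspAlgebra

/-- The product of two deformed algebras. -/
def prod {R Q : Type*} [Ring R] [Algebra ℂ R] [Ring Q] [Algebra ℂ Q]
    (S : OspAlgebra R) (T : OspAlgebra Q) : OspAlgebra (R × Q) where
  P := S.P.prodMap T.P
  D4 := S.D4.prodMap T.D4
  D5 := S.D5.prodMap T.D5
  xp := (S.xp, T.xp)
  xm := (S.xm, T.xm)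
  x3 := (S.x3, T.x3)
  t4 := (S.t4, T.t4)
  t5 := (S.t5, T.t5)
  ε := (S.ε, T.ε)
  C := (S.C, T.C)
  P_one := Prod.ext S.P_one T.P_one
  P_mul _ _ := Prod.ext (S.P_mul _ _) (T.P_mul _ _)
  P_P _ := Prod.ext (S.P_P _) (T.P_P _)
  P_xp := Prod.ext S.P_xp T.P_xp
  P_xm := Prod.ext S.P_xm T.P_xm
  P_x3 := Prod.ext S.P_x3 T.P_x3
  P_t4 := Prod.ext S.P_t4 T.P_t4
  P_t5 := Prod.ext S.P_t5 T.P_t5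
  P_ε := Prod.ext S.P_ε T.P_ε
  P_C := Prod.ext S.P_C T.P_C
  P_D4 _ := Prod.ext (S.P_D4 _) (T.P_D4 _)
  P_D5 _ := Prod.ext (S.P_D5 _) (T.P_D5 _)
  D4_mul _ _ := Prod.ext (S.D4_mul _ _) (T.D4_mul _ _)
  D5_mul _ _ := Prod.ext (S.D5_mul _ _) (T.D5_mul _ _)
  D4_xp := Prod.ext S.D4_xp T.D4_xp
  D4_xm := Prod.ext S.D4_xm T.D4_xm
  D4_x3 := Prod.ext S.D4_x3 T.D4_x3
  D4_t4 := Prod.ext S.D4_t4 T.D4_t4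
  D4_t5 := Prod.ext S.D4_t5 T.D4_t5
  D4_ε := Prod.ext S.D4_ε T.D4_ε
  D4_C := Prod.ext S.D4_C T.D4_C
  D5_xp := Prod.ext S.D5_xp T.D5_xp
  D5_xm := Prod.ext S.D5_xm T.D5_xm
  D5_x3 := Prod.ext S.D5_x3 T.D5_x3
  D5_t4 := Prod.ext S.D5_t4 T.D5_t4
  D5_t5 := Prod.ext S.D5_t5 T.D5_t5
  D5_ε := Prod.ext S.D5_ε T.D5_ε
  D5_C := Prod.ext S.D5_C T.D5_C
  ε_comm _ := Prod.ext (S.ε_comm _) (T.ε_comm _)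
  C_comm _ := Prod.ext (S.C_comm _) (T.C_comm _)
  t4_mul _ := Prod.ext (S.t4_mul _) (T.t4_mul _)
  t5_mul _ := Prod.ext (S.t5_mul _) (T.t5_mul _)
  x3_xp := Prod.ext S.x3_xp T.x3_xp
  xm_xp := Prod.ext S.xm_xp T.xm_xp
  xm_x3 := Prod.ext S.xm_x3 T.xm_x3
  C_eq := Prod.ext S.C_eq T.C_eq

/-- The product of a family of deformed algebras. -/
def pi {ι : Type*} {R : ι → Type*} [∀ i, Ring (R i)] [∀ i, Algebra ℂ (R i)]
    (S : ∀ i, OspAlgebra (R i)) : OspAlgebra (∀ i, R i) where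
  P := LinearMap.pi fun i => (S i).P ∘ₗ LinearMap.proj i
  D4 := LinearMap.pi fun i => (S i).D4 ∘ₗ LinearMap.proj i
  D5 := LinearMap.pi fun i => (S i).D5 ∘ₗ LinearMap.proj i
  xp i := (S i).xp
  xm i := (S i).xm
  x3 i := (S i).x3
  t4 i := (S i).t4
  t5 i := (S i).t5
  ε i := (S i).ε
  C i := (S i).C
  P_one := funext fun i => (S i).P_one
  P_mul _ _ := funext fun i => (S i).P_mul _ _
  P_P _ := funext fun i => (S i).P_P _
  P_xp := funext fun i => (S i).P_xp
  P_xm := funext fun i => (S i).P_xm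
  P_x3 := funext fun i => (S i).P_x3
  P_t4 := funext fun i => (S i).P_t4
  P_t5 := funext fun i => (S i).P_t5
  P_ε := funext fun i => (S i).P_ε
  P_C := funext fun i => (S i).P_C
  P_D4 _ := funext fun i => (S i).P_D4 _
  P_D5 _ := funext fun i => (S i).P_D5 _
  D4_mul _ _ := funext fun i => (S i).D4_mul _ _
  D5_mul _ _ := funext fun i => (S i).D5_mul _ _
  D4_xp := funext fun i => (S i).D4_xp
  D4_xm := funext fun i => (S i).D4_xm
  D4_x3 := funext fun i => (S i).D4_x3
  D4_t4 := funext fun i => (S i).D4_t4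
  D4_t5 := funext fun i => (S i).D4_t5
  D4_ε := funext fun i => (S i).D4_ε
  D4_C := funext fun i => (S i).D4_C
  D5_xp := funext fun i => (S i).D5_xp
  D5_xm := funext fun i => (S i).D5_xm
  D5_x3 := funext fun i => (S i).D5_x3
  D5_t4 := funext fun i => (S i).D5_t4
  D5_t5 := funext fun i => (S i).D5_t5
  D5_ε := funext fun i => (S i).D5_ε
  D5_C := funext fun i => (S i).D5_C
  ε_comm _ := funext fun i => (S i).ε_comm _
  C_comm _ := funext fun i => (S i).C_comm _
  t4_mul _ := funext fun i => (S i).t4_mul _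
  t5_mul _ := funext fun i => (S i).t5_mul _
  x3_xp := funext fun i => (S i).x3_xp
  xm_xp := funext fun i => (S i).xm_xp
  xm_x3 := funext fun i => (S i).xm_x3
  C_eq := funext fun i => (S i).C_eq

/-- Homomorphisms of deformed algebras map descendants to descendants. -/
theorem map_D5_pow_top {R R' : Type*} [Ring R] [Algebra ℂ R] [Ring R'] [Algebra ℂ R']
    (S : OspAlgebra R) (S' : OspAlgebra R') (f : R →ₐ[ℂ] R') (hD : ∀ Y, f (S.D5 Y) = S'.D5 (f Y))
    (hp : f S.xp = S'.xp) (h3 : f S.x3 = S'.x3) (h4 : f S.t4 = S'.t4) (h5 : f S.t5 = S'.t5)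
    (hε : f S.ε = S'.ε) (n s : ℕ) : f ((S.D5 ^ s) (S.top n)) = (S'.D5 ^ s) (S'.top n) := by
  induction s with
  | zero =>
    have hw : f S.w = S'.w := by simp [w, hp, h3, h4, h5, hε]
    simp only [pow_zero, Module.End.one_apply, top]
    split_ifs <;> simp [hp, hw]
  | succ s ih => rw [pow_succ', pow_succ', Module.End.mul_apply, Module.End.mul_apply, hD, ih]

end OspAlgebra

/-! ### The undeformed algebra of superfields -/

/-- The coordinate functions on `ℝ³`. -/
def coord (k : Fin 3) : Smooth := (Superfield.x k).c0

theorem x_eq (k : Fin 3) : Superfield.x k = ⟨coord k, 0, 0, 0⟩ := rfl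

theorem partialDeriv_coord (k j : Fin 3) : partialDeriv k (coord j) = if j = k then 1 else 0 := by
  ext u
  change fderiv ℝ (fun u : Fin 3 → ℝ => (u j : ℂ)) u (Pi.single k 1) = _
  have h : HasFDerivAt (fun u : Fin 3 → ℝ => (u j : ℂ))
      (Complex.ofRealCLM.comp (ContinuousLinearMap.proj j : (Fin 3 → ℝ) →L[ℝ] ℝ)) u :=
    (Complex.ofRealCLM.comp (ContinuousLinearMap.proj j : (Fin 3 → ℝ) →L[ℝ] ℝ)).hasFDerivAt
  rw [h.fderiv]
  by_cases hjk : j = k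
  · subst hjk; simp
  · simp [hjk]

/-- In components, the axioms of `fieldOsp` become identities in the commutative algebra `Smooth`
with its partial derivatives. -/
theorem fieldJ_inr_zero (F : Superfield) : fieldJ (.inr 0) F =
    ⟨(1 / 2 : ℂ) • (coord 0 * F.c4 + Complex.I • (coord 1 * F.c4) - coord 2 * F.c5),
      (1 / 2 : ℂ) • (coord 2 * F.c45 - partialDeriv 2 F.c0),
      (1 / 2 : ℂ) • (coord 0 * F.c45 + Complex.I • (coord 1 * F.c45) -
        (partialDeriv 0 F.c0 + Complex.I • partialDeriv 1 F.c0)),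
      (1 / 2 : ℂ) • (partialDeriv 0 F.c4 + Complex.I • partialDeriv 1 F.c4 -
        partialDeriv 2 F.c5)⟩ := by
  simp [fieldJ, Fin.sum_univ_three, pauli, Superfield.ddx, Superfield.ddθ, Superfield.θ, x_eq,
    Superfield.mul_def, Superfield.smul_def, Superfield.add_def, sub_eq_add_neg, Superfield.neg_def,
    Matrix.mul_apply]
  constructor <;> algebra with ℂ

theorem fieldJ_inr_one (F : Superfield) : fieldJ (.inr 1) F =
    ⟨(1 / 2 : ℂ) • (-(coord 0 * F.c5) + Complex.I • (coord 1 * F.c5) - coord 2 * F.c4),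
      (1 / 2 : ℂ) • (coord 0 * F.c45 - Complex.I • (coord 1 * F.c45) -
        (partialDeriv 0 F.c0 - Complex.I • partialDeriv 1 F.c0)),
      (1 / 2 : ℂ) • (partialDeriv 2 F.c0 - coord 2 * F.c45),
      (1 / 2 : ℂ) • (-partialDeriv 0 F.c5 + Complex.I • partialDeriv 1 F.c5 -
        partialDeriv 2 F.c4)⟩ := by
  simp [fieldJ, Fin.sum_univ_three, pauli, Superfield.ddx, Superfield.ddθ, Superfield.θ, x_eq,
    Superfield.mul_def, Superfield.smul_def, Superfield.add_def, sub_eq_add_neg, Superfield.neg_def,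
    Matrix.mul_apply]
  constructor <;> algebra with ℂ

/-- The parity involution of superfields. -/
def fieldParity : Superfield →ₗ[ℂ] Superfield where
  toFun F := ⟨F.c0, -F.c4, -F.c5, F.c45⟩
  map_add' F G := by simp [Superfield.add_def, add_comm]
  map_smul' c F := by simp [Superfield.smul_def]

theorem fieldParity_apply (F : Superfield) : fieldParity F = ⟨F.c0, -F.c4, -F.c5, F.c45⟩ := rfl

theorem θ_zero : Superfield.θ 0 = ⟨0, 1, 0, 0⟩ := rfl

theorem θ_one : Superfield.θ 1 = ⟨0, 0, 1, 0⟩ := rfl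

/-- The algebra of superfields is the undeformed member of the family. -/
def fieldOsp : OspAlgebra Superfield where
  P := fieldParity
  D4 := fieldJ (.inr 0)
  D5 := fieldJ (.inr 1)
  xp := Superfield.x 0 + Complex.I • Superfield.x 1
  xm := Superfield.x 0 - Complex.I • Superfield.x 1
  x3 := Superfield.x 2
  t4 := Superfield.θ 0
  t5 := Superfield.θ 1
  ε := 0
  C := ∑ k, Superfield.x k ^ 2 + 2 * Superfield.θ 0 * Superfield.θ 1
  P_one := by simp [fieldParity_apply, Superfield.one_def]
  P_mul Y Z := by
    simp only [fieldParity_apply, Superfield.mul_def, Superfield.mk.injEq]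
    refine ⟨trivial, ?_, ?_, ?_⟩ <;> ring
  P_P Y := by simp [fieldParity_apply]
  P_xp := by simp [fieldParity_apply, x_eq, Superfield.add_def, Superfield.smul_def]
  P_xm := by
    simp [fieldParity_apply, x_eq, sub_eq_add_neg, Superfield.neg_def, Superfield.add_def,
      Superfield.smul_def]
  P_x3 := by simp [fieldParity_apply, x_eq]
  P_t4 := by simp [fieldParity_apply, θ_zero, Superfield.neg_def]
  P_t5 := by simp [fieldParity_apply, θ_one, Superfield.neg_def]
  P_ε := map_zero _
  P_C := by
    simp [fieldParity_apply, x_eq, two_mul, pow_two, θ_zero, θ_one, Superfield.add_def,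
      Superfield.mul_def, Fin.sum_univ_three]
  P_D4 Y := by
    simp only [fieldParity_apply, fieldJ_inr_zero, Superfield.neg_def, Superfield.mk.injEq, map_neg]
    refine ⟨?_, trivial, trivial, ?_⟩ <;> algebra with ℂ
  P_D5 Y := by
    simp only [fieldParity_apply, fieldJ_inr_one, Superfield.neg_def, Superfield.mk.injEq, map_neg]
    refine ⟨?_, trivial, trivial, ?_⟩ <;> algebra with ℂ
  D4_mul Y Z := by
    simp only [fieldParity_apply, fieldJ_inr_zero, Superfield.mul_def, Superfield.add_def,
      Superfield.mk.injEq, map_add, partialDeriv_mul]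
    refine ⟨?_, ?_, ?_, ?_⟩ <;> algebra with ℂ
  D5_mul Y Z := by
    simp only [fieldParity_apply, fieldJ_inr_one, Superfield.mul_def, Superfield.add_def,
      Superfield.mk.injEq, map_add, partialDeriv_mul]
    refine ⟨?_, ?_, ?_, ?_⟩ <;> algebra with ℂ
  D4_xp := by
    simp [fieldJ_inr_zero, x_eq, Superfield.add_def, Superfield.smul_def, partialDeriv_coord,
      Superfield.zero_def, smul_smul]
  D4_xm := by
    simp [fieldJ_inr_zero, x_eq, sub_eq_add_neg, Superfield.add_def, Superfield.neg_def,
      Superfield.smul_def, partialDeriv_coord, θ_one, smul_smul]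
    module
  D4_x3 := by
    simp [fieldJ_inr_zero, x_eq, Superfield.smul_def, Superfield.neg_def, partialDeriv_coord,
      θ_zero, neg_div]
  D4_t4 := by
    simp [fieldJ_inr_zero, x_eq, Superfield.add_def, Superfield.smul_def, θ_zero, partialDeriv_one]
  D4_t5 := by
    simp [fieldJ_inr_zero, x_eq, Superfield.smul_def, Superfield.neg_def, θ_one, partialDeriv_one,
      neg_div]
  D4_ε := map_zero _
  D4_C := by
    simp [fieldJ_inr_zero, x_eq, two_mul, pow_two, θ_zero, θ_one, Superfield.add_def,
      Superfield.mul_def, Fin.sum_univ_three, partialDeriv_coord, partialDeriv_mul,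
      Superfield.zero_def]
    constructor <;> algebra with ℂ
  D5_xp := by
    simp [fieldJ_inr_one, x_eq, Superfield.add_def, Superfield.neg_def, Superfield.smul_def,
      partialDeriv_coord, θ_zero, smul_smul]
    module
  D5_xm := by
    simp [fieldJ_inr_one, x_eq, sub_eq_add_neg, Superfield.add_def, Superfield.neg_def,
      Superfield.smul_def, partialDeriv_coord, Superfield.zero_def, smul_smul]
  D5_x3 := by
    simp [fieldJ_inr_one, x_eq, Superfield.smul_def, partialDeriv_coord, θ_one]
  D5_t4 := by
    simp [fieldJ_inr_one, x_eq, Superfield.smul_def, Superfield.neg_def, θ_zero, partialDeriv_one,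
      neg_div]
  D5_t5 := by
    simp [fieldJ_inr_one, x_eq, sub_eq_add_neg, Superfield.add_def, Superfield.neg_def,
      Superfield.smul_def, θ_one, partialDeriv_one, neg_div]
    module
  D5_ε := map_zero _
  D5_C := by
    simp [fieldJ_inr_one, x_eq, two_mul, pow_two, θ_zero, θ_one, Superfield.add_def,
      Superfield.mul_def, Fin.sum_univ_three, partialDeriv_coord, partialDeriv_mul,
      Superfield.zero_def]
    constructor <;> algebra with ℂ
  ε_comm Y := by simp
  C_comm Y := by
    simp [x_eq, two_mul, pow_two, θ_zero, θ_one, Superfield.add_def, Superfield.mul_def,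
      Fin.sum_univ_three]
    refine ⟨?_, ?_, ?_, ?_⟩ <;> ring
  t4_mul Y := by
    simp [fieldParity_apply, θ_zero, Superfield.mul_def]
  t5_mul Y := by
    simp [fieldParity_apply, θ_one, Superfield.mul_def]
  x3_xp := by
    simp [x_eq, Superfield.add_def, Superfield.smul_def, Superfield.mul_def]
    algebra with ℂ
  xm_xp := by
    simp [x_eq, sub_eq_add_neg, Superfield.add_def, Superfield.neg_def, Superfield.smul_def,
      Superfield.mul_def]
    algebra with ℂ
  xm_x3 := by
    simp [x_eq, sub_eq_add_neg, Superfield.add_def, Superfield.neg_def, Superfield.smul_def,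
      Superfield.mul_def]
    algebra with ℂ
  C_eq := by
    have h : (coord 0 + Complex.I • coord 1) * (coord 0 + -(Complex.I • coord 1)) =
        coord 0 * coord 0 - (Complex.I * Complex.I) • (coord 1 * coord 1) := by algebra with ℂ
    rw [Complex.I_mul_I] at h
    simp [x_eq, two_mul, pow_two, θ_zero, θ_one, sub_eq_add_neg, Superfield.add_def,
      Superfield.neg_def, Superfield.mul_def, Superfield.smul_def, Fin.sum_univ_three, two_smul, h]
    ring

/-! ### The irreducible representations -/

/-- The basis vector `e_{j,m}` with `m = a - q/2`, extended by zero. -/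
def basisL (q a : ℕ) : RepSpace q := if h : a < q + 1 then Pi.single (.inl ⟨a, h⟩) 1 else 0

/-- The basis vector `e_{j-1/2,m}` with `m = b - (q-1)/2`, extended by zero. -/
def basisR (q b : ℕ) : RepSpace q := if h : b < q then Pi.single (.inr ⟨b, h⟩) 1 else 0

theorem repEnd_ext {q : ℕ} {f g : RepEnd q} (hl : ∀ a ≤ q, f (basisL q a) = g (basisL q a))
    (hr : ∀ b < q, f (basisR q b) = g (basisR q b)) : f = g := by
  refine LinearMap.pi_ext' fun i => LinearMap.ext_ring ?_
  rcases i with i | i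
  · have := hl i (by omega)
    simpa [basisL, Fin.is_le i] using this
  · have := hr i i.2
    simpa [basisR] using this

theorem toLin_basisL {q a : ℕ} (ha : a ≤ q)
    (M : Matrix (Fin (q + 1) ⊕ Fin q) (Fin (q + 1) ⊕ Fin q) ℂ) :
    Matrix.toLin' M (basisL q a) = fun i => M i (.inl ⟨a, by omega⟩) := by
  have : a < q + 1 := by omega
  ext i
  simp [basisL, this]

theorem toLin_basisR {q b : ℕ} (hb : b < q)
    (M : Matrix (Fin (q + 1) ⊕ Fin q) (Fin (q + 1) ⊕ Fin q) ℂ) :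
    Matrix.toLin' M (basisR q b) = fun i => M i (.inr ⟨b, hb⟩) := by
  ext i
  simp [basisR, hb]

theorem basisL_apply_inl (q a : ℕ) (i : Fin (q + 1)) :
    basisL q a (.inl i) = if i.val = a then 1 else 0 := by
  unfold basisL
  split_ifs with h h' h'
  · subst h'; simp
  · have : i ≠ ⟨a, h⟩ := fun e => h' (congrArg Fin.val e)
    simp [this]
  · omega
  · rfl

theorem basisL_apply_inr (q a : ℕ) (i : Fin q) : basisL q a (.inr i) = 0 := by
  unfold basisL
  split_ifs <;> simp

theorem basisR_apply_inr (q b : ℕ) (i : Fin q) :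
    basisR q b (.inr i) = if i.val = b then 1 else 0 := by
  unfold basisR
  split_ifs with h h' h'
  · subst h'; simp
  · have : i ≠ ⟨b, h⟩ := fun e => h' (congrArg Fin.val e)
    simp [this]
  · omega
  · rfl

theorem basisR_apply_inl (q b : ℕ) (i : Fin (q + 1)) : basisR q b (.inl i) = 0 := by
  unfold basisR
  split_ifs <;> simp

theorem basisL_ne_zero {q a : ℕ} (ha : a ≤ q) : basisL q a ≠ 0 := by
  intro h
  have := congrFun h (.inl ⟨a, by omega⟩)
  simp [basisL_apply_inl] at this

theorem basisR_ne_zero {q b : ℕ} (hb : b < q) : basisR q b ≠ 0 := by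
  intro h
  have := congrFun h (.inr ⟨b, hb⟩)
  simp [basisR_apply_inr] at this

theorem basisR_self (q : ℕ) : basisR q q = 0 := by simp [basisR]

section
variable {q : ℕ}

/-- The case `a = q` is included thanks to `basisR q q = 0`. -/
theorem repJ4_L {a : ℕ} (ha : a ≤ q) :
    repJ4 q (basisL q a) = ((-(1 / 2) * Real.sqrt (q - a) : ℝ) : ℂ) • basisR q a := by
  rw [repJ4, toLin_basisL ha]
  ext (i | i) <;> simp [basisR_apply_inl, basisR_apply_inr]

theorem repJ4_R {b : ℕ} (hb : b < q) :
    repJ4 q (basisR q b) = ((-(1 / 2) * Real.sqrt (b + 1) : ℝ) : ℂ) • basisL q (b + 1) := by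
  rw [repJ4, toLin_basisR hb]
  ext (i | i) <;> simp [basisL_apply_inl, basisL_apply_inr]

theorem repJ5_L {a : ℕ} (ha : a + 1 ≤ q) :
    repJ5 q (basisL q (a + 1)) = ((1 / 2 * Real.sqrt (a + 1) : ℝ) : ℂ) • basisR q a := by
  rw [repJ5, toLin_basisL ha]
  ext (i | i) <;> simp [basisR_apply_inl, basisR_apply_inr]

theorem repJ5_L_zero : repJ5 q (basisL q 0) = 0 := by
  rw [repJ5, toLin_basisL (Nat.zero_le q)]
  ext (i | i) <;> simp

theorem repJ5_R {b : ℕ} (hb : b < q) :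
    repJ5 q (basisR q b) = ((-(1 / 2) * Real.sqrt (q - b) : ℝ) : ℂ) • basisL q b := by
  rw [repJ5, toLin_basisR hb]
  ext (i | i) <;> simp [basisL_apply_inl, basisL_apply_inr]

theorem repRaise_L {a : ℕ} (ha : a ≤ q) :
    repRaise q (basisL q a) = ((Real.sqrt ((q - a) * (a + 1)) : ℝ) : ℂ) • basisL q (a + 1) := by
  rw [repRaise, toLin_basisL ha]
  ext (i | i) <;> simp [basisL_apply_inl, basisL_apply_inr]

theorem repRaise_R {b : ℕ} (hb : b < q) :
    repRaise q (basisR q b) = ((Real.sqrt ((q - 1 - b) * (b + 1)) : ℝ) : ℂ) • basisR q (b + 1) := by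
  rw [repRaise, toLin_basisR hb]
  ext (i | i) <;> simp [basisR_apply_inl, basisR_apply_inr]

theorem repLower_L {a : ℕ} (ha : a + 1 ≤ q) :
    repLower q (basisL q (a + 1)) = ((Real.sqrt (a + 1) * Real.sqrt (q - a) : ℝ) : ℂ) •
      basisL q a := by
  rw [repLower, toLin_basisL ha]
  ext (i | i) <;> simp [basisL_apply_inl, basisL_apply_inr,
    show (q : ℝ) - (a + 1) + 1 = q - a by ring]

theorem repLower_L_zero : repLower q (basisL q 0) = 0 := by
  rw [repLower, toLin_basisL (Nat.zero_le q)]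
  ext (i | i) <;> simp

theorem repLower_R {b : ℕ} (hb : b + 1 < q) :
    repLower q (basisR q (b + 1)) = ((Real.sqrt (b + 1) * Real.sqrt (q - (b + 1)) : ℝ) : ℂ) •
      basisR q b := by
  rw [repLower, toLin_basisR hb]
  ext (i | i) <;> simp [basisR_apply_inl, basisR_apply_inr]

theorem repLower_R_zero (hq : 0 < q) : repLower q (basisR q 0) = 0 := by
  rw [repLower, toLin_basisR hq]
  ext (i | i) <;> simp

theorem repWeight_L {a : ℕ} (ha : a ≤ q) :
    repWeight q (basisL q a) = ((a : ℂ) - q / 2) • basisL q a := by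
  rw [repWeight, toLin_basisL ha]
  ext (i | i) <;> simp [basisL_apply_inl, basisL_apply_inr, Matrix.diagonal_apply, Fin.ext_iff]
  split_ifs with h <;> simp [h]

theorem repWeight_R {b : ℕ} (hb : b < q) :
    repWeight q (basisR q b) = ((b : ℂ) - (q - 1) / 2) • basisR q b := by
  rw [repWeight, toLin_basisR hb]
  ext (i | i) <;> simp [basisR_apply_inl, basisR_apply_inr, Matrix.diagonal_apply, Fin.ext_iff]
  split_ifs with h <;> simp [h]

theorem repParity_L {a : ℕ} (ha : a ≤ q) : repParity q (basisL q a) = -basisL q a := by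
  rw [repParity, toLin_basisL ha]
  ext (i | i) <;> simp [basisL_apply_inl, basisL_apply_inr, Matrix.one_apply, Fin.ext_iff]

theorem repParity_R {b : ℕ} (hb : b < q) : repParity q (basisR q b) = basisR q b := by
  rw [repParity, toLin_basisR hb]
  ext (i | i) <;> simp [basisR_apply_inl, basisR_apply_inr, Matrix.one_apply, Fin.ext_iff]

theorem repParity_sq : repParity q * repParity q = 1 := by
  refine repEnd_ext (fun a ha => ?_) (fun b hb => ?_)
  · simp [repParity_L ha]
  · simp [repParity_R hb]

theorem repParity_R' (b : ℕ) : repParity q (basisR q b) = basisR q b := by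
  by_cases hb : b < q
  · exact repParity_R hb
  · simp [basisR, hb]

theorem repParity_repJ4 : repParity q * repJ4 q = -(repJ4 q * repParity q) := by
  refine repEnd_ext (fun a ha => ?_) (fun b hb => ?_)
  · simp [repParity_L ha, repJ4_L ha, repParity_R']
  · simp [repParity_R hb, repJ4_R hb, repParity_L hb]

theorem repParity_repJ5 : repParity q * repJ5 q = -(repJ5 q * repParity q) := by
  refine repEnd_ext (fun a ha => ?_) (fun b hb => ?_)
  · cases a with
    | zero => simp [repParity_L ha, repJ5_L_zero]
    | succ a => simp [repParity_L ha, repJ5_L ha, repParity_R']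
  · simp [repParity_R hb, repJ5_R hb, repParity_L hb.le]

theorem sqrt_cast_mul_self {x : ℝ} (hx : 0 ≤ x) :
    ((Real.sqrt x : ℝ) : ℂ) * (Real.sqrt x : ℝ) = x := by
  rw [← Complex.ofReal_mul, Real.mul_self_sqrt hx]

/-- The mixed products of the odd generators are diagonal, and in them each square root meets
itself. -/
theorem repJ4_repJ5_L {a : ℕ} (ha : a ≤ q) :
    repJ4 q (repJ5 q (basisL q a)) = (-(a / 4) : ℂ) • basisL q a := by
  cases a with
  | zero => simp [repJ5_L_zero]
  | succ a =>
    rw [repJ5_L ha, map_smul, repJ4_R ha, smul_smul]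
    have h := sqrt_cast_mul_self (x := a + 1) (by positivity)
    congr 1
    push_cast at h ⊢
    linear_combination (-1 / 4) * h

theorem repJ4_repJ5_R {b : ℕ} (hb : b < q) :
    repJ4 q (repJ5 q (basisR q b)) = ((q - b) / 4 : ℂ) • basisR q b := by
  have hbq : (b : ℝ) ≤ q := by exact_mod_cast hb.le
  rw [repJ5_R hb, map_smul, repJ4_L hb.le, smul_smul]
  have h := sqrt_cast_mul_self (x := q - b) (by linarith)
  congr 1
  push_cast at h ⊢
  linear_combination (1 / 4) * h

theorem repJ5_repJ4_L {a : ℕ} (ha : a ≤ q) :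
    repJ5 q (repJ4 q (basisL q a)) = ((q - a) / 4 : ℂ) • basisL q a := by
  rw [repJ4_L ha, map_smul]
  rcases ha.lt_or_eq with h | rfl
  · have hbq : (a : ℝ) ≤ q := by exact_mod_cast ha
    rw [repJ5_R h, smul_smul]
    have h := sqrt_cast_mul_self (x := q - a) (by linarith)
    congr 1
    push_cast at h ⊢
    linear_combination (1 / 4) * h
  · simp [basisR_self]

theorem repJ5_repJ4_R {b : ℕ} (hb : b < q) :
    repJ5 q (repJ4 q (basisR q b)) = (-((b + 1) / 4) : ℂ) • basisR q b := by
  rw [repJ4_R hb, map_smul, repJ5_L hb, smul_smul]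
  have h := sqrt_cast_mul_self (x := b + 1) (by positivity)
  congr 1
  push_cast at h ⊢
  linear_combination (-1 / 4) * h

/-- Together with `repRaise_eq` and `repLower_eq` this turns the relations of the representation
into identities between words in `repJ4` and `repJ5`. -/
theorem repWeight_eq : repWeight q = (-2 : ℂ) • (repJ4 q * repJ5 q + repJ5 q * repJ4 q) := by
  refine repEnd_ext (fun a ha => ?_) (fun b hb => ?_)
  · simp only [LinearMap.smul_apply, LinearMap.add_apply, Module.End.mul_apply, repWeight_L ha,
    repJ4_repJ5_L ha, repJ5_repJ4_L ha]
    module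
  · simp only [LinearMap.smul_apply, LinearMap.add_apply, Module.End.mul_apply, repWeight_R hb,
    repJ4_repJ5_R hb, repJ5_repJ4_R hb]
    module

theorem repRaise_eq : repRaise q = (4 : ℂ) • (repJ4 q * repJ4 q) := by
  refine repEnd_ext (fun a ha => ?_) (fun b hb => ?_)
  · rw [LinearMap.smul_apply, Module.End.mul_apply, repRaise_L ha, repJ4_L ha, map_smul]
    have hq : (a : ℝ) ≤ q := by exact_mod_cast ha
    rcases ha.lt_or_eq with h | rfl
    · rw [repJ4_R h, smul_smul, smul_smul, Real.sqrt_mul (by linarith)]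
      congr 1
      push_cast
      ring
    · simp [basisR_self]
  · have hq : (b : ℝ) + 1 ≤ q := by exact_mod_cast hb
    rw [LinearMap.smul_apply, Module.End.mul_apply, repRaise_R hb, repJ4_R hb, map_smul, repJ4_L hb,
      smul_smul, smul_smul, Real.sqrt_mul (by linarith)]
    congr 1
    push_cast
    rw [show (q : ℝ) - (b + 1) = q - 1 - b by ring]
    ring

theorem repLower_eq : repLower q = (-4 : ℂ) • (repJ5 q * repJ5 q) := by
  refine repEnd_ext (fun a ha => ?_) (fun b hb => ?_)
  · rw [LinearMap.smul_apply, Module.End.mul_apply]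
    cases a with
    | zero => simp [repLower_L_zero, repJ5_L_zero]
    | succ a =>
      rw [repLower_L ha, repJ5_L ha, map_smul, repJ5_R ha, smul_smul, smul_smul]
      congr 1
      push_cast
      ring
  · rw [LinearMap.smul_apply, Module.End.mul_apply, repJ5_R hb, map_smul]
    cases b with
    | zero => simp [repLower_R_zero hb, repJ5_L_zero]
    | succ b =>
      rw [repLower_R hb, repJ5_L hb.le, smul_smul, smul_smul]
      congr 1
      push_cast
      ring

theorem repWeight_R' {b : ℕ} : repWeight q (basisR q b) = ((b : ℂ) - (q - 1) / 2) • basisR q b := by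
  by_cases hb : b < q
  · exact repWeight_R hb
  · simp [basisR, hb]

theorem repWeight_repJ4 :
    repWeight q * repJ4 q = repJ4 q * repWeight q + (1 / 2 : ℂ) • repJ4 q := by
  refine repEnd_ext (fun a ha => ?_) (fun b hb => ?_)
  · simp only [LinearMap.smul_apply, LinearMap.add_apply, Module.End.mul_apply, repJ4_L ha,
    repWeight_L ha, map_smul, repWeight_R', smul_smul]
    module
  · simp only [LinearMap.smul_apply, LinearMap.add_apply, Module.End.mul_apply, repJ4_R hb,
    repWeight_R hb, map_smul, repWeight_L hb, smul_smul]
    push_cast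
    module

theorem repWeight_repJ5 :
    repWeight q * repJ5 q = repJ5 q * repWeight q - (1 / 2 : ℂ) • repJ5 q := by
  refine repEnd_ext (fun a ha => ?_) (fun b hb => ?_)
  · cases a with
    | zero => simp [repJ5_L_zero, repWeight_L ha]
    | succ a =>
      simp only [LinearMap.smul_apply, LinearMap.sub_apply, Module.End.mul_apply, repJ5_L ha,
        repWeight_L ha, map_smul, repWeight_R', smul_smul]
      push_cast
      module
  · simp only [LinearMap.smul_apply, LinearMap.sub_apply, Module.End.mul_apply, repJ5_R hb,
    repWeight_R hb, map_smul, repWeight_L hb.le, smul_smul]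
    module

/-- The quadratic Casimir element is a scalar. -/
theorem rep_casimir : repWeight q * repWeight q + repRaise q * repLower q -
    (1 / 2 : ℂ) • repWeight q + (2 : ℂ) • (repJ4 q * repJ5 q) = (q * (q + 1) / 4 : ℂ) • 1 := by
  rw [repRaise_eq, repLower_eq]
  refine repEnd_ext (fun a ha => ?_) (fun b hb => ?_)
  -- The inner product `J₄ J₅` is diagonal on `basisR`, which leaves the diagonal outer product `J₄
  -- J₅`.
  · have h : repJ4 q (repJ4 q (repJ5 q (repJ5 q (basisL q a)))) =
        (-(a * (q - a + 1)) / 16 : ℂ) • basisL q a := by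
      cases a with
      | zero => simp [repJ5_L_zero]
      | succ a =>
        have h1 := repJ4_repJ5_L ha
        rw [repJ5_L ha, map_smul] at h1
        rw [repJ5_L ha, map_smul, map_smul, map_smul, repJ4_repJ5_R ha, map_smul, smul_comm, h1,
          smul_smul]
        congr 1
        push_cast
        ring
    simp only [LinearMap.smul_apply, LinearMap.add_apply, LinearMap.sub_apply, Module.End.mul_apply,
      map_smul, repWeight_L ha, repJ4_repJ5_L ha, h, Module.End.one_apply]
    module
  · have h : repJ4 q (repJ4 q (repJ5 q (repJ5 q (basisR q b)))) =
        (-(b * (q - b)) / 16 : ℂ) • basisR q b := by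
      have h1 := repJ4_repJ5_R hb
      rw [repJ5_R hb, map_smul] at h1
      rw [repJ5_R hb, map_smul, map_smul, map_smul, repJ4_repJ5_L hb.le, map_smul, smul_comm, h1,
        smul_smul]
      congr 1
      ring
    simp only [LinearMap.smul_apply, LinearMap.add_apply, LinearMap.sub_apply, Module.End.mul_apply,
      map_smul, repWeight_R hb, repJ4_repJ5_R hb, h, Module.End.one_apply]
    module

end

/-! ### The endomorphism algebra as a deformed algebra. -/

section
variable {q : ℕ}

/-- This is `[J₃, J₄] = J₄ / 2` after `repWeight_eq`. Read from left to right it moves `J₅` behind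
`J₄²`; with the companion rule for `J₅²` it brings the words occurring in `repOsp` to a common
order. -/
theorem repJ5_repJ4_repJ4 : repJ5 q * (repJ4 q * repJ4 q) =
    repJ4 q * (repJ4 q * repJ5 q) - (1 / 4 : ℂ) • repJ4 q := by
  have h := repWeight_repJ4 (q := q)
  rw [repWeight_eq] at h
  simp only [smul_mul_assoc, mul_smul_comm, add_mul, mul_add, smul_add, mul_assoc] at h
  calc repJ5 q * (repJ4 q * repJ4 q) = (-1 / 2 : ℂ) • ((-2 : ℂ) • (repJ4 q * (repJ5 q * repJ4 q)) +
        (-2 : ℂ) • (repJ5 q * (repJ4 q * repJ4 q))) - repJ4 q * (repJ5 q * repJ4 q) := by module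
    _ = _ := by
      rw [h]
      module

theorem repJ5_repJ5_repJ4 : repJ5 q * (repJ5 q * repJ4 q) =
    repJ4 q * (repJ5 q * repJ5 q) - (1 / 4 : ℂ) • repJ5 q := by
  have h := repWeight_repJ5 (q := q)
  rw [repWeight_eq] at h
  simp only [smul_mul_assoc, mul_smul_comm, add_mul, mul_add, smul_add, mul_assoc] at h
  calc repJ5 q * (repJ5 q * repJ4 q) = (-1 / 2 : ℂ) • ((-2 : ℂ) • (repJ5 q * (repJ4 q * repJ5 q)) +
        (-2 : ℂ) • (repJ5 q * (repJ5 q * repJ4 q)) - (1 / 2 : ℂ) • repJ5 q)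
        - repJ5 q * (repJ4 q * repJ5 q) - (1 / 4 : ℂ) • repJ5 q := by module
    _ = _ := by
      rw [← h]
      module

theorem repJ5_mul_repJ4_mul_repJ4_mul (Y : RepEnd q) : repJ5 q * (repJ4 q * (repJ4 q * Y)) =
    repJ4 q * (repJ4 q * (repJ5 q * Y)) - (1 / 4 : ℂ) • (repJ4 q * Y) := by
  rw [← mul_assoc (repJ4 q) (repJ4 q) Y, ← mul_assoc, repJ5_repJ4_repJ4]
  simp only [sub_mul, smul_mul_assoc, mul_assoc]

theorem repJ5_mul_repJ5_mul_repJ4_mul (Y : RepEnd q) : repJ5 q * (repJ5 q * (repJ4 q * Y)) =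
    repJ4 q * (repJ5 q * (repJ5 q * Y)) - (1 / 4 : ℂ) • (repJ5 q * Y) := by
  rw [← mul_assoc (repJ5 q) (repJ4 q) Y, ← mul_assoc, repJ5_repJ5_repJ4]
  simp only [sub_mul, smul_mul_assoc, mul_assoc]

theorem repEnd_neg_mul (Y Z : RepEnd q) : -Y * Z = -(Y * Z) := neg_mul Y Z

theorem repEnd_mul_neg (Y Z : RepEnd q) : Y * -Z = -(Y * Z) := mul_neg Y Z

theorem gradeInvolution_apply (Y : RepEnd q) :
    gradeInvolution q Y = repParity q * (Y * repParity q) := rfl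

theorem repAd_four (Y : RepEnd q) :
    repAd q (.inr 0) Y = repJ4 q * Y - repParity q * (Y * repParity q) * repJ4 q := rfl

theorem repAd_five (Y : RepEnd q) :
    repAd q (.inr 1) Y = repJ5 q * Y - repParity q * (Y * repParity q) * repJ5 q := rfl

theorem repParity_mul_repParity_mul (Y : RepEnd q) : repParity q * (repParity q * Y) = Y := by
  rw [← mul_assoc, repParity_sq, one_mul]

theorem repParity_mul_repJ4_mul (Y : RepEnd q) :
    repParity q * (repJ4 q * Y) = -(repJ4 q * (repParity q * Y)) := by
  rw [← mul_assoc, repParity_repJ4, repEnd_neg_mul, mul_assoc]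

theorem repParity_mul_repJ5_mul (Y : RepEnd q) :
    repParity q * (repJ5 q * Y) = -(repJ5 q * (repParity q * Y)) := by
  rw [← mul_assoc, repParity_repJ5, repEnd_neg_mul, mul_assoc]

/-- The endomorphism algebra of an irreducible representation, with the generators rescaled by
`e`. -/
def repOsp (q : ℕ) (e : ℂ) : OspAlgebra (RepEnd q) where
  P := gradeInvolution q
  D4 := repAd q (.inr 0)
  D5 := repAd q (.inr 1)
  xp := e • repRaise q
  xm := e • repLower q
  x3 := e • repWeight q
  t4 := e • repJ4 q
  t5 := e • repJ5 q
  ε := e • 1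
  C := (e ^ 2 * (q * (q + 1) / 4) : ℂ) • 1
  P_one := by simp [gradeInvolution_apply, repParity_sq]
  P_mul Y Z := by simp only [gradeInvolution_apply, mul_assoc, repParity_mul_repParity_mul]
  P_P Y := by simp only [gradeInvolution_apply, mul_assoc, repParity_mul_repParity_mul,
    repParity_sq, mul_one]
  P_xp := by
    simp only [gradeInvolution_apply, repRaise_eq, smul_mul_assoc, mul_smul_comm, mul_assoc,
      repParity_mul_repJ4_mul, repParity_sq, repEnd_mul_neg, neg_neg, mul_one]
  P_xm := by
    simp only [gradeInvolution_apply, repLower_eq, smul_mul_assoc, mul_smul_comm, mul_assoc,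
      repParity_mul_repJ5_mul, repParity_sq, repEnd_mul_neg, neg_neg, mul_one]
  P_x3 := by
    simp only [gradeInvolution_apply, repWeight_eq, smul_mul_assoc, mul_smul_comm, mul_assoc,
      add_mul, mul_add, repParity_mul_repJ5_mul, repParity_mul_repJ4_mul, repParity_sq,
      repEnd_mul_neg, neg_neg, mul_one]
  P_t4 := by
    simp only [gradeInvolution_apply, smul_mul_assoc, mul_smul_comm, repParity_mul_repJ4_mul,
      repParity_sq, smul_neg, mul_one]
  P_t5 := by
    simp only [gradeInvolution_apply, smul_mul_assoc, mul_smul_comm, repParity_mul_repJ5_mul,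
      repParity_sq, smul_neg, mul_one]
  P_ε := by simp [gradeInvolution_apply, repParity_sq]
  P_C := by simp [gradeInvolution_apply, repParity_sq]
  P_D4 Y := by
    simp only [gradeInvolution_apply, repAd_four, mul_sub, sub_mul, mul_assoc,
      repParity_mul_repParity_mul, repParity_mul_repJ4_mul, repParity_repJ4, repParity_sq,
      repEnd_mul_neg, repEnd_neg_mul, mul_one]
    abel
  P_D5 Y := by
    simp only [gradeInvolution_apply, repAd_five, mul_sub, sub_mul, mul_assoc,
      repParity_mul_repParity_mul, repParity_mul_repJ5_mul, repParity_repJ5, repParity_sq,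
      repEnd_mul_neg, repEnd_neg_mul, mul_one]
    abel
  D4_mul Y Z := by
    simp only [gradeInvolution_apply, repAd_four, mul_sub, sub_mul, mul_assoc,
      repParity_mul_repParity_mul]
    abel
  D5_mul Y Z := by
    simp only [gradeInvolution_apply, repAd_five, mul_sub, sub_mul, mul_assoc,
      repParity_mul_repParity_mul]
    abel
  D4_xp := by
    simp only [repAd_four, repRaise_eq, smul_mul_assoc, mul_smul_comm, mul_assoc,
      repParity_mul_repJ4_mul, repParity_mul_repParity_mul, repEnd_mul_neg, neg_neg]
    module
  D4_xm := by
    simp only [repAd_four, repLower_eq, smul_mul_assoc, mul_smul_comm, mul_assoc,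
      repParity_mul_repJ5_mul, repParity_mul_repParity_mul, repEnd_mul_neg, neg_neg,
      repJ5_repJ5_repJ4]
    module
  D4_x3 := by
    simp only [repAd_four, repWeight_eq, smul_mul_assoc, mul_smul_comm, mul_assoc, add_mul, mul_add,
      repParity_mul_repJ4_mul, repParity_mul_repJ5_mul, repParity_mul_repParity_mul, repEnd_mul_neg,
      neg_neg, repJ5_repJ4_repJ4]
    module
  D4_t4 := by
    simp only [repAd_four, repRaise_eq, smul_mul_assoc, mul_smul_comm, mul_assoc,
      repParity_mul_repJ4_mul, repParity_mul_repParity_mul, repEnd_neg_mul]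
    module
  D4_t5 := by
    simp only [repAd_four, repWeight_eq, smul_mul_assoc, mul_smul_comm, mul_assoc,
      repParity_mul_repJ5_mul, repParity_mul_repParity_mul, repEnd_neg_mul]
    module
  D4_ε := by simp [repAd_four, repParity_sq]
  D4_C := by simp [repAd_four, repParity_sq]
  D5_xp := by
    simp only [repAd_five, repRaise_eq, smul_mul_assoc, mul_smul_comm, mul_assoc,
      repParity_mul_repJ4_mul, repParity_mul_repParity_mul, repEnd_mul_neg, neg_neg,
      repJ5_repJ4_repJ4]
    module
  D5_xm := by
    simp only [repAd_five, repLower_eq, smul_mul_assoc, mul_smul_comm, mul_assoc,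
      repParity_mul_repJ5_mul, repParity_mul_repParity_mul, repEnd_mul_neg, neg_neg]
    module
  D5_x3 := by
    simp only [repAd_five, repWeight_eq, smul_mul_assoc, mul_smul_comm, mul_assoc, add_mul, mul_add,
      repParity_mul_repJ4_mul, repParity_mul_repJ5_mul, repParity_mul_repParity_mul, repEnd_mul_neg,
      neg_neg, repJ5_repJ5_repJ4]
    module
  D5_t4 := by
    simp only [repAd_five, repWeight_eq, smul_mul_assoc, mul_smul_comm, mul_assoc,
      repParity_mul_repJ4_mul, repParity_mul_repParity_mul, repEnd_neg_mul]
    module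
  D5_t5 := by
    simp only [repAd_five, repLower_eq, smul_mul_assoc, mul_smul_comm, mul_assoc,
      repParity_mul_repJ5_mul, repParity_mul_repParity_mul, repEnd_neg_mul]
    module
  D5_ε := by simp [repAd_five, repParity_sq]
  D5_C := by simp [repAd_five, repParity_sq]
  ε_comm Y := by simp
  C_comm Y := by simp
  t4_mul Y := by
    simp only [gradeInvolution_apply, repAd_four, smul_mul_assoc, mul_smul_comm, one_mul]
    module
  t5_mul Y := by
    simp only [gradeInvolution_apply, repAd_five, smul_mul_assoc, mul_smul_comm, one_mul]
    module
  x3_xp := by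
    simp only [repWeight_eq, repRaise_eq, smul_mul_assoc, mul_smul_comm, one_mul, mul_assoc,
      add_mul, mul_add, mul_sub, repJ5_repJ4_repJ4, repJ5_mul_repJ4_mul_repJ4_mul]
    module
  xm_xp := by
    simp only [repWeight_eq, repRaise_eq, repLower_eq, smul_mul_assoc, mul_smul_comm, one_mul,
      mul_assoc, mul_sub, repJ5_repJ4_repJ4, repJ5_mul_repJ4_mul_repJ4_mul]
    module
  xm_x3 := by
    simp only [repWeight_eq, repLower_eq, smul_mul_assoc, mul_smul_comm, one_mul, mul_assoc,
      add_mul, mul_add, mul_sub, repJ5_mul_repJ5_mul_repJ4_mul, repJ5_repJ5_repJ4]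
    module
  C_eq := by
    have h := rep_casimir (q := q)
    rw [mul_smul, ← h]
    simp only [smul_mul_assoc, mul_smul_comm, one_mul]
    module

/-- Graded commutation with an odd element, applied twice, is the ordinary commutator with its
square, because the parity signs cancel. -/
theorem repAd_raise (Y : RepEnd q) : repRaise q * Y - Y * repRaise q =
    (4 : ℂ) • repAd q (.inr 0) (repAd q (.inr 0) Y) := by
  simp only [repAd_four, repRaise_eq, smul_mul_assoc, mul_smul_comm, mul_assoc, mul_sub, sub_mul,
    repParity_mul_repParity_mul, repParity_mul_repJ4_mul, repEnd_mul_neg, repEnd_neg_mul]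
  module

theorem repAd_lower (Y : RepEnd q) : repLower q * Y - Y * repLower q =
    (-4 : ℂ) • repAd q (.inr 1) (repAd q (.inr 1) Y) := by
  simp only [repAd_five, repLower_eq, smul_mul_assoc, mul_smul_comm, mul_assoc, mul_sub, sub_mul,
    repParity_mul_repParity_mul, repParity_mul_repJ5_mul, repEnd_mul_neg, repEnd_neg_mul]
  module

theorem repAd_weight (Y : RepEnd q) : repWeight q * Y - Y * repWeight q =
    (-2 : ℂ) • (repAd q (.inr 0) (repAd q (.inr 1) Y) + repAd q (.inr 1) (repAd q (.inr 0) Y)) := by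
  simp only [repAd_four, repAd_five, repWeight_eq, smul_mul_assoc, mul_smul_comm, mul_assoc,
    mul_sub, sub_mul, add_mul, mul_add, repParity_mul_repParity_mul, repParity_mul_repJ4_mul,
    repParity_mul_repJ5_mul, repEnd_mul_neg, repEnd_neg_mul]
  module

end

/-! ### Local nilpotency of `D5` and the length of the strings. -/

namespace OspAlgebra

variable {R : Type*} [Ring R] [Algebra ℂ R] (S : OspAlgebra R)

/-- Elements killed by powers of a derivation. -/
theorem derivation_pow_mul_eq_zero {D : Module.End ℂ R}
    (hD : ∀ Y Z, D (Y * Z) = D Y * Z + Y * D Z) (N : ℕ) :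
    ∀ (m k : ℕ) (Y Z : R), m + k = N → (D ^ m) Y = 0 → (D ^ k) Z = 0 → (D ^ N) (Y * Z) = 0 := by
  induction N with
  | zero =>
    intro m k Y Z h hY hZ
    obtain rfl : m = 0 := by omega
    simp only [pow_zero, Module.End.one_apply] at hY
    simp [hY]
  | succ N ih =>
    intro m k Y Z h hY hZ
    rcases m with _ | m
    · simp only [pow_zero, Module.End.one_apply] at hY
      simp [hY]
    rcases k with _ | k
    · simp only [pow_zero, Module.End.one_apply] at hZ
      simp [hZ]
    rw [pow_succ, Module.End.mul_apply, hD, map_add]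
    have hY' := hY
    have hZ' := hZ
    rw [pow_succ, Module.End.mul_apply] at hY' hZ'
    rw [ih m (k + 1) _ _ (by omega) hY' hZ, ih (m + 1) k _ _ (by omega) hY hZ', add_zero]

/-- The square of `D5` is an ordinary derivation whose third power kills every generator; on
products the exponents add. -/
theorem D5_locally_nilpotent {Y : R} (hY : Y ∈ Algebra.adjoin ℂ S.gens) :
    ∃ N : ℕ, ((S.D5 * S.D5) ^ N) Y = 0 := by
  induction hY using Algebra.adjoin_induction with
  | mem Y hY =>
    refine ⟨3, ?_⟩
    simp only [gens, Set.mem_insert_iff, Set.mem_singleton_iff] at hY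
    rcases hY with rfl | rfl | rfl | rfl | rfl | rfl <;>
      simp [pow_succ, Module.End.mul_apply, S.D5_xp, S.D5_xm, S.D5_x3, S.D5_t4, S.D5_t5, S.D5_ε]
  | algebraMap r =>
    exact ⟨1, by simp [Algebra.algebraMap_eq_smul_one, S.D5_one]⟩
  | add Y Z _ _ h1 h2 =>
    obtain ⟨m, hm⟩ := h1
    obtain ⟨k, hk⟩ := h2
    refine ⟨m + k, ?_⟩
    rw [map_add, pow_add, Module.End.mul_apply, Module.End.mul_apply, hk, map_zero, add_zero,
      ← Module.End.mul_apply, ← pow_add, add_comm, pow_add, Module.End.mul_apply, hm, map_zero]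
  | mul Y Z _ _ h1 h2 =>
    obtain ⟨m, hm⟩ := h1
    obtain ⟨k, hk⟩ := h2
    exact ⟨m + k, derivation_pow_mul_eq_zero (fun Y Z => S.D5_D5_mul Y Z) (m + k) m k Y Z rfl hm hk⟩

theorem D5_pow_top_eq_zero {n s : ℕ} (hs : 2 * n < s) : (S.D5 ^ s) (S.top n) = 0 := by
  obtain ⟨N, hN⟩ := S.D5_locally_nilpotent (S.top_mem n)
  rw [← pow_two, ← pow_mul] at hN
  have h := (S.isHighestWeight_top n).pow_eq_zero hN
  obtain ⟨r, rfl⟩ := Nat.exists_eq_add_of_le (show 2 * n + 1 ≤ s by omega)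
  rw [add_comm, pow_add, Module.End.mul_apply, h, map_zero]

end OspAlgebra

/-! ### The even generators as quadratic expressions in the odd ones. -/

/-- The even generators of `osp(1|2)` in terms of the odd generators `A = J₄` and `B = J₅`. -/
def evenGen {V : Type*} [AddCommGroup V] [Module ℂ V] (A B : Module.End ℂ V) :
    Fin 3 → Module.End ℂ V :=
  ![(2 : ℂ) • (A * A) - (2 : ℂ) • (B * B), (-2 * Complex.I) • (A * A + B * B),
    (-2 : ℂ) • (A * B + B * A)]

theorem repAd_inl (q : ℕ) (i : Fin 3) (Y : RepEnd q) :
    repAd q (.inl i) Y = evenGen (repAd q (.inr 0)) (repAd q (.inr 1)) i Y := by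
  have h : repAd q (.inl i) Y = repJ q (.inl i) * Y - Y * repJ q (.inl i) := rfl
  have hp := repAd_raise Y
  have hm := repAd_lower Y
  rw [h]
  fin_cases i
  · have e : repJ q (.inl 0) = (1 / 2 : ℂ) • (repRaise q + repLower q) := rfl
    simp only [Fin.zero_eta, e, smul_mul_assoc, mul_smul_comm, add_mul, mul_add]
    calc _ = (1 / 2 : ℂ) • ((repRaise q * Y - Y * repRaise q) +
          (repLower q * Y - Y * repLower q)) := by module
      _ = _ := by
        rw [hp, hm]
        simp only [evenGen, Matrix.cons_val_zero, LinearMap.sub_apply, LinearMap.smul_apply,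
          Module.End.mul_apply]
        module
  · have e : repJ q (.inl 1) = (-(Complex.I / 2)) • (repRaise q - repLower q) := rfl
    simp only [Fin.mk_one, e, smul_mul_assoc, mul_smul_comm, sub_mul, mul_sub]
    calc _ = (-(Complex.I / 2)) • ((repRaise q * Y - Y * repRaise q) -
          (repLower q * Y - Y * repLower q)) := by module
      _ = _ := by
        rw [hp, hm]
        simp only [evenGen, Matrix.cons_val_one, LinearMap.add_apply, LinearMap.smul_apply,
          Module.End.mul_apply, Matrix.cons_val_zero]
        module
  · exact repAd_weight Y

/-- Even derivations. -/
def IsDer {R : Type*} [Ring R] [Algebra ℂ R] (D : Module.End ℂ R) : Prop :=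
  ∀ F G, D (F * G) = D F * G + F * D G

namespace IsDer

variable {R : Type*} [Ring R] [Algebra ℂ R] {D E : Module.End ℂ R}

theorem add (hD : IsDer D) (hE : IsDer E) : IsDer (D + E) := by
  intro F G
  simp only [LinearMap.add_apply, hD F G, hE F G, add_mul, mul_add]
  abel

theorem smul (hD : IsDer D) (c : ℂ) : IsDer (c • D) := by
  intro F G
  simp only [LinearMap.smul_apply, hD F G, smul_add, smul_mul_assoc, mul_smul_comm]

theorem sub (hD : IsDer D) (hE : IsDer E) : IsDer (D - E) := by
  intro F G
  simp only [LinearMap.sub_apply, hD F G, hE F G, sub_mul, mul_sub]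
  abel

theorem eqOn_adjoin (hD : IsDer D) (hE : IsDer E) {s : Set R} (h : ∀ F ∈ s, D F = E F) {F : R}
    (hF : F ∈ Algebra.adjoin ℂ s) : D F = E F := by
  have h1 : ∀ {D : Module.End ℂ R}, IsDer D → D 1 = 0 := by
    intro D hD
    have := hD 1 1
    simpa using this
  induction hF using Algebra.adjoin_induction with
  | mem F hF => exact h F hF
  | algebraMap r => rw [Algebra.algebraMap_eq_smul_one, map_smul, map_smul, h1 hD, h1 hE]
  | add F G _ _ hF hG => rw [map_add, map_add, hF, hG]
  | mul F G _ _ hF hG => rw [hD, hE, hF, hG]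

end IsDer

/-- The operators `D4` and `D5` anticommute with `P`, so the cross terms in the Leibniz rule cancel
for `D4²`, `D5²` and `D4 D5 + D5 D4`. -/
theorem OspAlgebra.isDer_evenGen {R : Type*} [Ring R] [Algebra ℂ R] (S : OspAlgebra R) (i : Fin 3) :
    IsDer (evenGen S.D4 S.D5 i) := by
  have h44 : IsDer (S.D4 * S.D4 : Module.End ℂ R) := by
    intro F G
    simp only [Module.End.mul_apply, S.D4_mul, map_add, S.P_D4, S.P_P]
    noncomm_ring
  have h55 : IsDer (S.D5 * S.D5 : Module.End ℂ R) := fun F G => S.D5_D5_mul F G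
  have h45 : IsDer (S.D4 * S.D5 + S.D5 * S.D4 : Module.End ℂ R) := by
    intro F G
    simp only [Module.End.mul_apply, LinearMap.add_apply, S.D4_mul, S.D5_mul, map_add, S.P_D4,
      S.P_D5, S.P_P]
    noncomm_ring
  fin_cases i
  · exact (h44.smul _).sub (h55.smul _)
  · exact (h44.add h55).smul _
  · exact h45.smul _

theorem isDer_x_ddx (j k : Fin 3) :
    IsDer (LinearMap.mulLeft ℂ (Superfield.x j) * Superfield.ddx k) := by
  intro F G
  simp only [Module.End.mul_apply, LinearMap.mulLeft_apply, x_eq, Superfield.ddx, LinearMap.coe_mk,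
    AddHom.coe_mk, Superfield.mul_def, Superfield.add_def, Superfield.mk.injEq, map_add, map_sub,
    partialDeriv_mul]
  refine ⟨?_, ?_, ?_, ?_⟩ <;> ring

theorem isDer_θ_ddθ (α β : Fin 2) :
    IsDer (LinearMap.mulLeft ℂ (Superfield.θ α) * Superfield.ddθ β) := by
  intro F G
  fin_cases α <;> fin_cases β <;>
  · simp [θ_zero, θ_one, Superfield.ddθ, Superfield.mul_def, Superfield.add_def]
    try ring_nf
    try simp

theorem isDer_fieldJ (i : Fin 3) : IsDer (fieldJ (.inl i)) := by
  refine IsDer.add (((isDer_x_ddx _ _).sub (isDer_x_ddx _ _)).smul _) (IsDer.smul ?_ _)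
  rw [Fin.sum_univ_two, Fin.sum_univ_two, Fin.sum_univ_two]
  exact (((isDer_θ_ddθ _ _).smul _).add ((isDer_θ_ddθ _ _).smul _)).add
    (((isDer_θ_ddθ _ _).smul _).add ((isDer_θ_ddθ _ _).smul _))

theorem fieldJ_inl_x (i j : Fin 3) : fieldJ (.inl i) (Superfield.x j) = (-Complex.I) •
    (Superfield.x (i + 1) * (if j = i + 2 then 1 else 0) -
      Superfield.x (i + 2) * (if j = i + 1 then 1 else 0)) := by
  have hd : ∀ k, Superfield.ddx k (Superfield.x j) = if j = k then 1 else 0 := by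
    intro k
    simp only [Superfield.ddx, x_eq, LinearMap.coe_mk, AddHom.coe_mk, map_zero, partialDeriv_coord]
    split_ifs <;> rfl
  have hθ : ∀ α, Superfield.ddθ α (Superfield.x j) = 0 := by
    intro α
    simp [Superfield.ddθ, x_eq, Superfield.zero_def]
  simp [fieldJ, hd, hθ]

theorem fieldJ_inl_θ (i : Fin 3) (β : Fin 2) : fieldJ (.inl i) (Superfield.θ β) = (1 / 2 : ℂ) •
    (pauli i 0 β • Superfield.θ 0 + pauli i 1 β • Superfield.θ 1) := by
  have hd : ∀ k β, Superfield.ddx k (Superfield.θ β) = 0 := by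
    intro k β
    fin_cases β <;> simp [Superfield.ddx, θ_zero, θ_one, partialDeriv_one, Superfield.zero_def]
  have hdθ : ∀ α β, Superfield.ddθ α (Superfield.θ β) = if β = α then 1 else 0 := by
    intro α β
    fin_cases α <;> fin_cases β <;>
      simp [Superfield.ddθ, θ_zero, θ_one, Superfield.zero_def, Superfield.one_def]
  fin_cases β <;> simp [fieldJ, hd, hdθ]

/-- Two even derivations that agree on generators agree on all polynomials, and only polynomial
superfields occur in the modules of harmonics. -/
theorem fieldJ_inl {F : Superfield} (hF : F ∈ Algebra.adjoin ℂ fieldOsp.gens) (i : Fin 3) :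
    fieldJ (.inl i) F = evenGen fieldOsp.D4 fieldOsp.D5 i F := by
  refine (isDer_fieldJ i).eqOn_adjoin (fieldOsp.isDer_evenGen i) (fun F hF => ?_) hF
  have hI : ∀ F : Superfield, Complex.I • Complex.I • F = -F := by
    intro F
    rw [smul_smul, Complex.I_mul_I, neg_one_smul]
  have hi : i = 0 ∨ i = 1 ∨ i = 2 := by fin_cases i <;> simp
  simp only [OspAlgebra.gens, Set.mem_insert_iff, Set.mem_singleton_iff] at hF
  rcases hF with rfl | rfl | rfl | rfl | rfl | rfl <;> rcases hi with rfl | rfl | rfl <;>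
    simp only [evenGen, LinearMap.sub_apply, LinearMap.add_apply, LinearMap.smul_apply,
      Module.End.mul_apply, fieldOsp.D4_xp, fieldOsp.D4_xm, fieldOsp.D4_x3, fieldOsp.D4_t4,
      fieldOsp.D4_t5, fieldOsp.D4_ε, fieldOsp.D5_xp, fieldOsp.D5_xm, fieldOsp.D5_x3, fieldOsp.D5_t4,
      fieldOsp.D5_t5, fieldOsp.D5_ε, map_neg, map_smul, map_zero, smul_neg, Matrix.cons_val_zero,
      Matrix.cons_val_one, Matrix.cons_val] <;>
    simp [fieldOsp, fieldJ_inl_x, fieldJ_inl_θ, pauli, hI] <;> match_scalars <;>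
    ring_nf <;> norm_num

/-! ### Functions vanishing on the supersphere -/

theorem coeff_smul {L : ℕ} (c : ℂ) (y : Grassmann L) (M : Finset (Fin L)) :
    coeff (c • y) M = c * coeff y M := by
  simp [coeff]

theorem coeff_add {L : ℕ} (y z : Grassmann L) (M : Finset (Fin L)) :
    coeff (y + z) M = coeff y M + coeff z M := by
  simp [coeff]

theorem coeff_monomialBasis {L : ℕ} (N M : Finset (Fin L)) :
    coeff (monomialBasis L N) M = if N = M then 1 else 0 := by
  simp [coeff, Finsupp.single_apply]

/-- The scalar is the sign of a permutation; only its being real and nonzero is used. -/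
theorem exists_monomialBasis_mul {L : ℕ} {i j : Fin L} (hij : i ≠ j) : ∃ σ : ℝ, σ ≠ 0 ∧
    monomialBasis L {i} * monomialBasis L {j} = (σ : ℂ) • monomialBasis L {i, j} := by
  have hd : Disjoint (Set.powersetCard.ofCard (Finset.card_singleton i)).val
      (Set.powersetCard.ofCard (Finset.card_singleton j)).val := by
    simpa [Set.powersetCard.ofCard] using hij
  have h := ExteriorAlgebra.basis_mul_of_disjoint (R := ℂ) (Pi.basisFun ℂ (Fin L))
    (Set.powersetCard.ofCard (Finset.card_singleton i))
    (Set.powersetCard.ofCard (Finset.card_singleton j)) hd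
  have hu : (Set.powersetCard.disjUnion hd).val = {i, j} := by
    ext
    simp [Set.powersetCard.disjUnion, Set.powersetCard.ofCard]
  rw [hu] at h
  change monomialBasis L {i} * monomialBasis L {j} = _ • monomialBasis L {i, j} at h
  rcases Int.units_eq_one_or (Equiv.Perm.sign (Set.powersetCard.permOfDisjoint hd)) with e | e
  · exact ⟨1, one_ne_zero, by rw [h, e]; simp⟩
  · exact ⟨-1, by norm_num, by rw [h, e]; simp⟩

/-- A nilpotent expansion of first order. -/
theorem taylorStep_of_sq_eq_zero {L : ℕ} (hL : 1 ≤ L) (p : SuperSpace L) (k : Fin 3)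
    (φ : Smooth →ₗ[ℂ] Grassmann L) (h : soul (p.x k) ^ 2 = 0) (f : Smooth) :
    taylorStep p k φ f = φ f + φ (partialDeriv k f) * soul (p.x k) := by
  rw [taylorStep_apply, ← Finset.sum_subset (Finset.range_mono (show 2 ≤ L + 1 by omega))]
  · simp [Finset.sum_range_succ]
  · intro n _ hn
    rw [pow_eq_zero_of_le (by simpa [Nat.succ_le_iff] using hn) h]
    simp

/-- On the body sphere, the rotational derivatives of a function vanishing there are zero. -/
theorem rotation_derivative {ρ : ℝ} {f : Smooth}
    (hf : ∀ u : Fin 3 → ℝ, ∑ k, u k ^ 2 = ρ ^ 2 → f.1 u = 0) {u : Fin 3 → ℝ}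
    (hu : ∑ k, u k ^ 2 = ρ ^ 2) (j k : Fin 3) :
    (u j : ℂ) * (partialDeriv k f).1 u = u k * (partialDeriv j f).1 u := by
  by_cases hjk : j = k
  · rw [hjk]
  -- The curve `γ` rotates `u` in the plane of the coordinates `j` and `k`: `a` is the component of
  -- `u` in that plane and `b` is `a` turned by a right angle.
  let a : Fin 3 → ℝ := Pi.single j (u j) + Pi.single k (u k)
  let b : Fin 3 → ℝ := Pi.single k (u j) - Pi.single j (u k)
  let γ : ℝ → Fin 3 → ℝ := fun t => u + (Real.cos t - 1) • a + Real.sin t • b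
  have hγ : ∀ t, ∑ i, γ t i ^ 2 = ρ ^ 2 := by
    intro t
    have hcs := Real.sin_sq_add_cos_sq t
    rw [← hu, Fin.sum_univ_three, Fin.sum_univ_three]
    fin_cases j <;> fin_cases k <;> simp [γ, a, b] at hjk ⊢ <;> nlinarith [hcs]
  have hd : HasDerivAt γ b 0 := by
    have h1 := ((Real.hasDerivAt_cos 0).sub_const 1).smul_const a
    have h2 := (Real.hasDerivAt_sin 0).smul_const b
    have h3 := (h1.const_add u).add h2
    simp only [Real.sin_zero, Real.cos_zero, neg_zero, zero_smul, one_smul, zero_add] at h3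
    exact h3
  have h0 : γ 0 = u := by simp [γ]
  have hfd : HasFDerivAt f.1 (fderiv ℝ f.1 u) (γ 0) := by
    rw [h0]
    exact (smooth_differentiableAt f u).hasFDerivAt
  have hc := hfd.comp_hasDerivAt 0 hd
  have hz : f.1 ∘ γ = fun _ => 0 := funext fun t => hf _ (hγ t)
  rw [hz] at hc
  have h := hc.unique (hasDerivAt_const (0 : ℝ) (0 : ℂ))
  have hs : ∀ (i : Fin 3) (c : ℝ), (Pi.single i c : Fin 3 → ℝ) = c • Pi.single i 1 := by
    intro i c
    rw [← Pi.single_smul', smul_eq_mul, mul_one]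
  simp only [b] at h
  rw [map_sub, hs k, hs j, map_smul, map_smul, sub_eq_zero, Complex.real_smul, Complex.real_smul]
    at h
  exact h

/-- The gradient of a function that is zero on the sphere is radial there: contract the relation of
`rotation_derivative` with `u j`. -/
theorem partialDeriv_of_eqOn_sphere {ρ : ℝ} {f : Smooth}
    (hf : ∀ u : Fin 3 → ℝ, ∑ k, u k ^ 2 = ρ ^ 2 → f.1 u = 0) {u : Fin 3 → ℝ}
    (hu : ∑ k, u k ^ 2 = ρ ^ 2) (k : Fin 3) :
    (ρ : ℂ) ^ 2 * (partialDeriv k f).1 u = u k * ∑ j, u j * (partialDeriv j f).1 u := by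
  have h : ((ρ : ℂ)) ^ 2 = ∑ j, (u j : ℂ) ^ 2 := by exact_mod_cast hu.symm
  rw [h, Finset.sum_mul, Finset.mul_sum]
  refine Finset.sum_congr rfl fun j _ => ?_
  have := rotation_derivative hf hu j k
  rw [pow_two, mul_assoc, this]
  ring

/-- The superfields that vanish on the supersphere, in terms of their components. -/
def sphereKer (ρ : ℝ) : Submodule ℂ Superfield where
  carrier := {F | ∀ u : Fin 3 → ℝ, ∑ k, u k ^ 2 = ρ ^ 2 → F.c0.1 u = 0 ∧ F.c4.1 u = 0 ∧
    F.c5.1 u = 0 ∧ (ρ : ℂ) ^ 2 * F.c45.1 u = ∑ k, u k * (partialDeriv k F.c0).1 u}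
  add_mem' {F G} hF hG u hu := by
    obtain ⟨a0, a4, a5, a45⟩ := hF u hu
    obtain ⟨b0, b4, b5, b45⟩ := hG u hu
    simp [Superfield.add_def, a0, a4, a5, b0, b4, b5, mul_add, a45, b45, Finset.sum_add_distrib]
  zero_mem' u _ := by simp [Superfield.zero_def]
  smul_mem' c F hF u hu := by
    obtain ⟨a0, a4, a5, a45⟩ := hF u hu
    simp only [Fin.sum_univ_three] at a45
    simp [Superfield.smul_def, a0, a4, a5, Fin.sum_univ_three]
    linear_combination c * a45

/-- On the sphere the gradient of `c0` is radial, and the condition on `c45` says that it equals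
`c45` times `u`; hence the odd components of the image vanish. The condition on the last component
of the image follows from the radial gradients of `c4` and `c5`. -/
theorem fieldJ_four_mem_sphereKer {ρ : ℝ} (hρ : ρ ≠ 0) {F : Superfield} (hF : F ∈ sphereKer ρ) :
    fieldJ (.inr 0) F ∈ sphereKer ρ := by
  intro u hu
  obtain ⟨a0, a4, a5, a45⟩ := hF u hu
  have h0 := fun k => partialDeriv_of_eqOn_sphere (fun u hu => (hF u hu).1) hu k
  have h4 := fun k => partialDeriv_of_eqOn_sphere (fun u hu => (hF u hu).2.1) hu k
  have h5 := fun k => partialDeriv_of_eqOn_sphere (fun u hu => (hF u hu).2.2.1) hu k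
  have hρ' : (ρ : ℂ) ^ 2 ≠ 0 := by simpa using hρ
  have hc : ∀ k, (coord k).1 u = u k := fun _ => rfl
  have e : ∀ k, (u k : ℂ) * F.c45.1 u = (partialDeriv k F.c0).1 u := by
    intro k
    refine mul_left_cancel₀ hρ' ?_
    rw [h0 k, ← a45]
    ring
  rw [fieldJ_inr_zero]
  simp only [Fin.sum_univ_three] at h4 h5 ⊢
  simp [partialDeriv_mul, partialDeriv_coord, a4, a5, hc, e]
  linear_combination (1 / 2) * h4 0 + (Complex.I / 2) * h4 1 - (1 / 2) * h5 2

theorem fieldJ_five_mem_sphereKer {ρ : ℝ} (hρ : ρ ≠ 0) {F : Superfield} (hF : F ∈ sphereKer ρ) :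
    fieldJ (.inr 1) F ∈ sphereKer ρ := by
  intro u hu
  obtain ⟨a0, a4, a5, a45⟩ := hF u hu
  have h0 := fun k => partialDeriv_of_eqOn_sphere (fun u hu => (hF u hu).1) hu k
  have h4 := fun k => partialDeriv_of_eqOn_sphere (fun u hu => (hF u hu).2.1) hu k
  have h5 := fun k => partialDeriv_of_eqOn_sphere (fun u hu => (hF u hu).2.2.1) hu k
  have hρ' : (ρ : ℂ) ^ 2 ≠ 0 := by simpa using hρ
  have hc : ∀ k, (coord k).1 u = u k := fun _ => rfl
  have e : ∀ k, (u k : ℂ) * F.c45.1 u = (partialDeriv k F.c0).1 u := by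
    intro k
    refine mul_left_cancel₀ hρ' ?_
    rw [h0 k, ← a45]
    ring
  rw [fieldJ_inr_one]
  simp only [Fin.sum_univ_three] at h4 h5 ⊢
  simp [partialDeriv_mul, partialDeriv_coord, a4, a5, hc, e]
  linear_combination -(1 / 2) * h5 0 + (Complex.I / 2) * h5 1 - (1 / 2) * h4 2

theorem fieldOsp_xp_pow (k : ℕ) :
    fieldOsp.xp ^ k = ⟨(coord 0 + Complex.I • coord 1) ^ k, 0, 0, 0⟩ := by
  have h : fieldOsp.xp = ⟨coord 0 + Complex.I • coord 1, 0, 0, 0⟩ := by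
    simp [fieldOsp, x_eq, Superfield.add_def, Superfield.smul_def]
  induction k with
  | zero => simp [Superfield.one_def]
  | succ k ih => rw [pow_succ, ih, h, Superfield.mul_def]; simp [pow_succ]

/-- At the point `(ρ, 0, 0)` the function `xp` equals `ρ`. For odd `n` the component to inspect is
`c5`, to which `w` contributes `xp`. -/
theorem fieldOsp_top_notMem_sphereKer {ρ : ℝ} (hρ : ρ ≠ 0) (n : ℕ) :
    fieldOsp.top n ∉ sphereKer ρ := by
  intro h
  obtain ⟨h0, -, h5, -⟩ := h ![ρ, 0, 0] (by simp [Fin.sum_univ_three])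
  have hc0 : (coord 0).1 ![ρ, 0, 0] = ρ := rfl
  have hc1 : (coord 1).1 ![ρ, 0, 0] = 0 := Complex.ofReal_zero
  have hρ' : (ρ : ℂ) ≠ 0 := by exact_mod_cast hρ
  rcases Nat.even_or_odd' n with ⟨k, rfl | rfl⟩
  · rw [OspAlgebra.top_even, fieldOsp_xp_pow] at h0
    simp [hc0, hc1, hρ'] at h0
  · have hw : fieldOsp.w.c5 = coord 0 + Complex.I • coord 1 := by
      simp [OspAlgebra.w, fieldOsp, x_eq, θ_zero, θ_one, Superfield.add_def, Superfield.smul_def,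
        Superfield.mul_def]
    rw [OspAlgebra.top_odd, fieldOsp_xp_pow, Superfield.mul_def] at h5
    simp [hw, hc0, hc1, hρ'] at h5

theorem isOdd_monomialBasis_singleton {L : ℕ} (i : Fin L) : IsOdd (monomialBasis L {i}) := by
  intro M hM
  rw [coeff_monomialBasis, if_neg]
  rintro rfl
  simp at hM

theorem isReal_monomialBasis {L : ℕ} (N : Finset (Fin L)) : IsReal (monomialBasis L N) := by
  intro M
  rw [coeff_monomialBasis]
  split_ifs <;> simp

/-- The restriction to the supersphere vanishes only on `sphereKer`. -/
theorem ker_restrict_le {L : ℕ} (hL : 2 ≤ L) {ρ : ℝ} (hρ : ρ ≠ 0) {F : Superfield}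
    (hF : restrict L ρ F = 0) : F ∈ sphereKer ρ := by
  intro u hu
  let i : Fin L := ⟨0, by omega⟩
  let j : Fin L := ⟨1, by omega⟩
  have hij : i ≠ j := by simp [i, j]
  have hρ' : (ρ : ℂ) ≠ 0 := by exact_mod_cast hρ
  obtain ⟨σ, hσ, hmul⟩ := exists_monomialBasis_mul hij
  have hodd := fun i => isOdd_monomialBasis_singleton (L := L) i
  set s := monomialBasis L {i} with hs
  set t := monomialBasis L {j} with ht
  set z := monomialBasis L {i, j} with hz
  have hst : ∀ (c : ℂ), c • (s * t) = (c * σ) • z := by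
    intro c
    rw [hmul, smul_smul]
  have hσ' : (σ : ℂ) ≠ 0 := by exact_mod_cast hσ
  have hszt : z = (σ : ℂ)⁻¹ • (s * t) := by
    rw [hst, inv_mul_cancel₀ hσ', one_smul]
  have hzs : z * s = 0 := by
    rw [hszt, smul_mul_assoc, mul_assoc, (hodd j).anticomm (hodd i), mul_neg, ← mul_assoc,
      (hodd i).mul_self, zero_mul, neg_zero, smul_zero]
  have hzt : z * t = 0 := by
    rw [hszt, smul_mul_assoc, mul_assoc, (hodd j).mul_self, mul_zero, smul_zero]
  have hzz : z * z = 0 := by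
    nth_rewrite 2 [hszt]
    rw [mul_smul_comm, ← mul_assoc, hzs, zero_mul, smul_zero]
  have cz : ∀ M, coeff z M = if {i, j} = M then 1 else 0 := coeff_monomialBasis _
  have ne0 : ({i, j} : Finset (Fin L)) ≠ ∅ := by simp
  -- The superfield is evaluated at one point above `u`: `θ = (s, t)` and `x = u + c z`. The
  -- constants are chosen so that `2 ∑ u k * c k` cancels the contribution `2 σ` of `2 θ⁴ θ⁵` to the
  -- equation of the sphere. As `z² = 0`, the expansion of every coefficient stops after first
  -- order.
  let c : Fin 3 → ℝ := fun k => -(u k / ρ ^ 2 * σ)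
  have bodyx : ∀ k, body (algebraMap ℂ (Grassmann L) (u k) + (c k : ℂ) • z) = u k := by
    intro k
    rw [body, coeff_add, coeff_algebraMap, coeff_smul, cz, if_neg ne0]
    simp
  let p : SuperSpace L :=
    { x := fun k => algebraMap ℂ (Grassmann L) (u k) + (c k : ℂ) • z
      θ := ![s, t]
      x_real := by
        intro k M
        rw [coeff_add, coeff_algebraMap, coeff_smul, cz]
        split_ifs <;> simp
      x_even := by
        intro k M hM
        have h1 : M ≠ ∅ := by rintro rfl; simp at hM
        have h2 : ({i, j} : Finset (Fin L)) ≠ M := by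
          rintro rfl
          rw [Finset.card_pair hij] at hM
          exact hM even_two
        rw [coeff_add, coeff_algebraMap, coeff_smul, cz, if_neg h1, if_neg h2]
        simp
      θ_real := by
        intro α
        fin_cases α
        · exact isReal_monomialBasis _
        · exact isReal_monomialBasis _
      θ_odd := by
        intro α
        fin_cases α
        · exact hodd i
        · exact hodd j }
  have hsoul : ∀ k, soul (p.x k) = (c k : ℂ) • z := by
    intro k
    simp only [soul, p, bodyx, add_sub_cancel_left]
  have hbody : bodyPoint p = u := by
    ext k
    simp only [bodyPoint, p, bodyx, Complex.ofReal_re]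
  have hp : p ∈ superSphere L ρ := by
    have e : ∀ k, p.x k ^ 2 = algebraMap ℂ (Grassmann L) ((u k : ℂ) ^ 2) +
        (2 * (u k * c k) : ℂ) • z := by
      intro k
      simp only [p, pow_two, mul_add, add_mul, hzz, smul_zero, add_zero, map_mul,
        Algebra.algebraMap_eq_smul_one, smul_mul_assoc, mul_smul_comm, one_mul, mul_one, smul_smul]
      module
    have e2 : (2 : Grassmann L) * p.θ 0 * p.θ 1 = (2 * σ : ℂ) • z := by
      change 2 * s * t = _
      rw [mul_assoc, two_mul, ← two_smul ℂ, hst]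
    have hu' : ∑ k, (u k : ℂ) ^ 2 = (ρ : ℂ) ^ 2 := by exact_mod_cast hu
    have hcu : ∑ k, (2 * (u k * c k) : ℂ) = -(2 * σ) := by
      rw [← Finset.mul_sum]
      have : ∑ k, (u k * c k : ℂ) = (∑ k, (u k : ℂ) ^ 2) * (-(σ / ρ ^ 2)) := by
        rw [Finset.sum_mul]
        refine Finset.sum_congr rfl fun k _ => ?_
        simp only [c]
        push_cast
        ring
      rw [this, hu']
      field_simp
    change _ - _ = 0
    rw [Finset.sum_congr rfl fun k _ => e k, Finset.sum_add_distrib, ← map_sum, hu',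
      ← Finset.sum_smul, hcu, e2]
    module
  have hz' : ∀ f : Smooth, zExpansion p f = algebraMap ℂ (Grassmann L) (f.1 u) +
      (∑ k, (c k : ℂ) * (partialDeriv k f).1 u) • z := by
    intro f
    have hsq : ∀ k, soul (p.x k) ^ 2 = 0 := by
      intro k
      rw [hsoul, pow_two, smul_mul_smul_comm, hzz, smul_zero]
    have he : ∀ f : Smooth, evalBody p f = algebraMap ℂ (Grassmann L) (f.1 u) := by
      intro f
      simp only [evalBody, LinearMap.coe_mk, AddHom.coe_mk, hbody]
    rw [zExpansion_eq]
    simp only [taylorStep_of_sq_eq_zero (show 1 ≤ L by omega) p _ _ (hsq _), hsoul, he,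
      Algebra.algebraMap_eq_smul_one, add_mul, smul_mul_smul_comm, one_mul, hzz, smul_zero,
      add_zero, Fin.sum_univ_three]
    module
  have h0 : evalFun L F p = 0 := congrFun (congrArg Subtype.val hF) ⟨p, hp⟩
  have h1 : evalFun L F p = algebraMap ℂ (Grassmann L) (F.c0.1 u) + F.c4.1 u • s + F.c5.1 u • t +
      ((∑ k, (c k : ℂ) * (partialDeriv k F.c0).1 u) + σ * F.c45.1 u) • z := by
    have hzst : z * (s * t) = 0 := by rw [← mul_assoc, hzs, zero_mul]
    change zExpansion p F.c0 + zExpansion p F.c4 * s + zExpansion p F.c5 * t +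
      zExpansion p F.c45 * (s * t) = _
    simp only [hz', add_mul, smul_mul_assoc, hzs, hzt, hzst, smul_zero, add_zero,
      Algebra.algebraMap_eq_smul_one, one_mul, hst]
    module
  rw [h0] at h1
  have hcoeff : ∀ M, coeff (0 : Grassmann L) M = 0 := by simp [coeff]
  have key : ∀ M : Finset (Fin L), (0 : ℂ) = (if M = ∅ then F.c0.1 u else 0) + F.c4.1 u *
    (if {i} = M then 1 else 0) +
      F.c5.1 u * (if {j} = M then 1 else 0) +
      ((∑ k, (c k : ℂ) * (partialDeriv k F.c0).1 u) + σ * F.c45.1 u) *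
        (if {i, j} = M then 1 else 0) := by
    intro M
    have := congrArg (fun y => coeff y M) h1
    simpa only [hcoeff, coeff_add, coeff_smul, coeff_algebraMap, hs, ht, hz, coeff_monomialBasis]
      using this
  have d1 : ({i, j} : Finset (Fin L)) ≠ {i} := by
    intro h; have := congrArg Finset.card h; simp [Finset.card_pair hij] at this
  have d2 : ({i, j} : Finset (Fin L)) ≠ {j} := by
    intro h; have := congrArg Finset.card h; simp [Finset.card_pair hij] at this
  -- The coefficients of `1`, `s`, `t` and `z` give the four conditions of `sphereKer`.
  have k0 := key ∅
  have k4 := key {i}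
  have k5 := key {j}
  have k45 := key {i, j}
  simp [d1, hij.symm] at k4
  simp [d2, hij] at k5
  simp at k0
  simp [d1.symm, d2.symm] at k45
  refine ⟨k0.symm, k4.symm, k5.symm, ?_⟩
  have e : ∑ k, (c k : ℂ) * (partialDeriv k F.c0).1 u =
      (-(σ / ρ ^ 2)) * ∑ k, u k * (partialDeriv k F.c0).1 u := by
    rw [Finset.mul_sum]
    refine Finset.sum_congr rfl fun k _ => ?_
    simp only [c]
    push_cast
    ring
  rw [e] at k45
  field_simp at k45
  refine mul_left_cancel₀ hσ' ?_
  linear_combination -k45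

/-- The argument runs in the quotient by `sphereKer`, where `J₄` and `J₅` act and the highest weight
vectors remain nonzero. A linear relation between the restrictions is a relation there, as the
kernel of `restrict` lies in `sphereKer`. -/
theorem linearIndependent_restrict {L : ℕ} (hL : 2 ≤ L) {ρ : ℝ} (hρ : ρ ≠ 0) (N : ℕ) :
    LinearIndependent ℂ (fun i : (n : Fin N) × Fin (2 * n.val + 1) =>
      restrict L ρ ((fieldOsp.D5 ^ i.2.val) (fieldOsp.top i.1.val))) := by
  let K := sphereKer ρ
  let A : Module.End ℂ (Superfield ⧸ K) := K.mapQ K fieldOsp.D4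
    fun F hF => fieldJ_four_mem_sphereKer hρ hF
  let B : Module.End ℂ (Superfield ⧸ K) := K.mapQ K fieldOsp.D5
    fun F hF => fieldJ_five_mem_sphereKer hρ hF
  have hp : ∀ s x, K.mkQ ((fieldOsp.D5 ^ s) x) = (B ^ s) (K.mkQ x) := by
    intro s x
    induction s with
    | zero => simp
    | succ s ih => rw [pow_succ', pow_succ', Module.End.mul_apply, Module.End.mul_apply, ← ih]; rfl
  have h := linearIndependent_descendants A B (fun n => K.mkQ (fieldOsp.top n)) N
    (fun n _ => (fieldOsp.isHighestWeight_top n).map K.mkQ (fun _ => rfl) (fun _ => rfl))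
    (fun n _ h0 => fieldOsp_top_notMem_sphereKer hρ n (by simpa [K] using h0))
  rw [Fintype.linearIndependent_iff] at h ⊢
  intro g hg
  refine h g ?_
  have h1 : restrict L ρ (∑ i, g i • (fieldOsp.D5 ^ i.2.val) (fieldOsp.top i.1.val)) = 0 := by
    rw [map_sum, ← hg]
    exact Finset.sum_congr rfl fun i _ => map_smul _ _ _
  have h2 := (Submodule.Quotient.mk_eq_zero K).mpr (ker_restrict_le hL hρ h1)
  rw [← Submodule.mkQ_apply, map_sum] at h2
  rw [← h2]
  refine Finset.sum_congr rfl fun i _ => ?_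
  rw [map_smul, hp]

theorem taylorStep_of_deriv_eq_zero {L : ℕ} (hL : 1 ≤ L) (p : SuperSpace L) (k : Fin 3)
    (φ : Smooth →ₗ[ℂ] Grassmann L) {f : Smooth} (h : partialDeriv k (partialDeriv k f) = 0) :
    taylorStep p k φ f = φ f + φ (partialDeriv k f) * soul (p.x k) := by
  rw [taylorStep_apply, ← Finset.sum_subset (Finset.range_mono (show 2 ≤ L + 1 by omega))]
  · simp [Finset.sum_range_succ]
  · intro n _ hn
    obtain ⟨m, rfl⟩ := Nat.exists_eq_add_of_le (show 2 ≤ n by simpa [Nat.succ_le_iff] using hn)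
    rw [add_comm, pow_add, pow_two, Module.End.mul_apply, Module.End.mul_apply, h]
    simp

theorem zExpansion_coord {L : ℕ} (hL : 1 ≤ L) (p : SuperSpace L) (j : Fin 3) :
    zExpansion p (coord j) = p.x j := by
  have hd : ∀ k, partialDeriv k (partialDeriv k (coord j)) = 0 := by
    intro k
    rw [partialDeriv_coord]
    split_ifs <;> simp [partialDeriv_one]
  have h1 : ∀ (k : Fin 3) (φ : Smooth →ₗ[ℂ] Grassmann L) (l : Fin 3), φ 1 = 1 →
      taylorStep p k φ (if j = l then 1 else 0) = if j = l then 1 else 0 := by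
    intro k φ l h
    split_ifs
    · exact taylorStep_one p k φ h
    · exact map_zero _
  have he1 : evalBody p 1 = 1 := by simp [evalBody]
  have ht := taylorStep_one p 0 _ he1
  have hif : (evalBody p) (if j = 0 then 1 else 0) = if j = 0 then 1 else 0 := by
    split_ifs <;> simp [he1]
  rw [zExpansion_eq, taylorStep_of_deriv_eq_zero hL _ _ _ (hd _),
    taylorStep_of_deriv_eq_zero hL _ _ _ (hd _), taylorStep_of_deriv_eq_zero hL _ _ _ (hd _),
    partialDeriv_coord, partialDeriv_coord, partialDeriv_coord, h1 1 _ 2 ht, h1 0 _ 1 he1, hif]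
  -- The body point consists of real parts, which loses nothing because the coordinates have real
  -- coefficients.
  have hb : evalBody p (coord j) = algebraMap ℂ (Grassmann L) (body (p.x j)) := by
    change algebraMap ℂ (Grassmann L) ((body (p.x j)).re : ℂ) = _
    congr 1
    exact Complex.ext rfl (p.x_real j ∅).symm
  have hs : p.x j = algebraMap ℂ (Grassmann L) (body (p.x j)) + soul (p.x j) := by
    rw [soul, add_sub_cancel]
  rw [hb]
  refine Eq.trans ?_ hs.symm
  have hj : j = 0 ∨ j = 1 ∨ j = 2 := by fin_cases j <;> simp
  rcases hj with rfl | rfl | rfl <;> simp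

/-- The Casimir element restricts to the constant `ρ²`. -/
theorem restrict_fieldOsp_C {L : ℕ} (hL : 1 ≤ L) (ρ : ℝ) :
    restrict L ρ fieldOsp.C = algebraMap ℂ _ ((ρ : ℂ) ^ 2) := by
  refine Subtype.ext (funext fun p => ?_)
  have hx : ∀ k, evalHom L (Superfield.x k) p = p.1.x k := by
    intro k
    change zExpansion p.1 (coord k) + zExpansion p.1 0 * _ + zExpansion p.1 0 * _ +
      zExpansion p.1 0 * _ = _
    rw [zExpansion_coord hL, zExpansion_zero]
    simp
  have hθ : ∀ α, evalHom L (Superfield.θ α) p = p.1.θ α := by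
    intro α
    have hα : α = 0 ∨ α = 1 := by fin_cases α <;> simp
    rcases hα with rfl | rfl
    · change zExpansion p.1 0 + zExpansion p.1 1 * _ + zExpansion p.1 0 * _ +
        zExpansion p.1 0 * _ = _
      rw [zExpansion_one, zExpansion_zero]
      simp
    · change zExpansion p.1 0 + zExpansion p.1 0 * _ + zExpansion p.1 1 * _ +
        zExpansion p.1 0 * _ = _
      rw [zExpansion_one, zExpansion_zero]
      simp
  have h := sub_eq_zero.mp p.2
  change evalHom L fieldOsp.C p = algebraMap ℂ (Grassmann L) ((ρ : ℂ) ^ 2)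
  rw [← h]
  simp only [fieldOsp, map_add, map_sum, map_mul, map_pow, Pi.add_apply, Finset.sum_apply,
    Pi.mul_apply, Pi.pow_apply, hx, hθ, map_ofNat]
  rfl

/-! ### Highest weight vectors of the endomorphism algebra -/

section
variable {q : ℕ}

theorem repRaise_pow_L {k : ℕ} (hk : k ≤ q) :
    ∃ c : ℂ, c ≠ 0 ∧ (repRaise q ^ k) (basisL q 0) = c • basisL q k := by
  induction k with
  | zero => exact ⟨1, one_ne_zero, by simp⟩
  | succ k ih =>
    obtain ⟨c, hc, h⟩ := ih (by omega)
    have hk' : (k : ℝ) < q := by exact_mod_cast hk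
    refine ⟨c * (Real.sqrt ((q - k) * (k + 1)) : ℝ), mul_ne_zero hc ?_, ?_⟩
    · have : 0 < (q - k : ℝ) * (k + 1) := mul_pos (by linarith) (by positivity)
      exact_mod_cast (Real.sqrt_pos.mpr this).ne'
    · rw [pow_succ', Module.End.mul_apply, h, map_smul, repRaise_L (by omega), smul_smul]

theorem repRaise_pow_R {k : ℕ} (hk : k < q) :
    ∃ c : ℂ, c ≠ 0 ∧ (repRaise q ^ k) (basisR q 0) = c • basisR q k := by
  induction k with
  | zero => exact ⟨1, one_ne_zero, by simp⟩
  | succ k ih =>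
    obtain ⟨c, hc, h⟩ := ih (by omega)
    have hk' : (k : ℝ) + 1 < q := by exact_mod_cast hk
    refine ⟨c * (Real.sqrt ((q - 1 - k) * (k + 1)) : ℝ), mul_ne_zero hc ?_, ?_⟩
    · have : 0 < (q - 1 - k : ℝ) * (k + 1) := mul_pos (by linarith) (by positivity)
      exact_mod_cast (Real.sqrt_pos.mpr this).ne'
    · rw [pow_succ', Module.End.mul_apply, h, map_smul, repRaise_R (by omega), smul_smul]

/-- It suffices to look at the lowest vector `basisL q 0`. For even `n` it is raised `k ≤ q` times.
For odd `n`, `J₅` kills it, so `w` maps it to a nonzero multiple of `basisR q 0`, which can be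
raised `k < q` times. -/
theorem repOsp_top_ne_zero {n : ℕ} (hn : n ≤ 2 * q) : (repOsp q 1).top n ≠ 0 := by
  intro h0
  have hx : (repOsp q 1).xp = repRaise q := one_smul _ _
  rcases Nat.even_or_odd' n with ⟨k, rfl | rfl⟩
  · rw [OspAlgebra.top_even, hx] at h0
    obtain ⟨c, hc, h⟩ := repRaise_pow_L (show k ≤ q by omega)
    rw [h0, LinearMap.zero_apply] at h
    exact smul_ne_zero hc (basisL_ne_zero (by omega)) h.symm
  · rw [OspAlgebra.top_odd, hx] at h0
    obtain ⟨c, hc, h⟩ := repRaise_pow_R (show k < q by omega)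
    have hq : (0 : ℝ) < q := by exact_mod_cast (show 0 < q by omega)
    have hw : (repOsp q 1).w (basisL q 0) =
        ((1 / 8 * (2 * q + 1) * Real.sqrt q : ℝ) : ℂ) • basisR q 0 := by
      simp only [OspAlgebra.w, repOsp, one_smul, LinearMap.add_apply, Module.End.mul_apply,
        LinearMap.sub_apply, LinearMap.smul_apply, Module.End.one_apply, repJ5_L_zero, map_zero,
        add_zero, repJ4_L (Nat.zero_le q), map_smul, repWeight_R (show 0 < q by omega)]
      rw [← sub_smul, smul_smul]
      congr 1
      push_cast
      simp
      ring
    have h1 := congrArg (fun f => f (basisL q 0)) h0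
    simp only [Module.End.mul_apply, hw, map_smul, h, LinearMap.zero_apply] at h1
    refine smul_ne_zero ?_ (smul_ne_zero hc (basisR_ne_zero (by omega))) h1
    have : 0 < 1 / 8 * (2 * q + 1) * Real.sqrt q := by positivity
    exact_mod_cast this.ne'

/-- The number of generators in a highest weight vector. -/
def topDegree (n : ℕ) : ℕ := n / 2 + 2 * (n % 2)

theorem repOsp_top (e : ℂ) (n : ℕ) :
    (repOsp q e).top n = e ^ topDegree n • (repOsp q 1).top n := by
  have hx : ∀ k, (repOsp q e).xp ^ k = e ^ k • (repOsp q 1).xp ^ k := by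
    intro k
    simp only [repOsp, one_smul, smul_pow]
  have hw : (repOsp q e).w = e ^ 2 • (repOsp q 1).w := by
    simp only [OspAlgebra.w, repOsp, one_smul, smul_add, pow_two, sub_mul, smul_sub, smul_mul_assoc,
      mul_smul_comm, smul_smul]
    module
  rcases Nat.even_or_odd' n with ⟨k, rfl | rfl⟩
  · rw [OspAlgebra.top_even, OspAlgebra.top_even, hx, topDegree]
    simp
  · have h1 : (2 * k + 1) / 2 = k := by omega
    have h2 : (2 * k + 1) % 2 = 1 := by omega
    rw [OspAlgebra.top_odd, OspAlgebra.top_odd, hx, hw, smul_mul_smul_comm, ← pow_add, topDegree,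
      h1, h2]

end

/-! ### Normalizations and the basis of the endomorphism algebra. -/

/-- The normalization of the harmonics on the supersphere. -/
def fieldConst (ρ : ℝ) (n : ℕ) : ℝ :=
  Real.sqrt n.factorial / (2 ^ (n / 2) * (n / 2).factorial * ρ ^ topDegree n)

/-- The normalization of the noncommutative harmonics. -/
def repConst (q n : ℕ) : ℝ :=
  if Even n then Real.sqrt (2 ^ (n / 2) * (n - 1).doubleFactorial * (q - n / 2).factorial /
      ((n / 2).factorial * (q + n / 2).factorial))
  else 1 / (q + 1 / 2) * Real.sqrt (2 ^ (n / 2 + 4) * n.doubleFactorial *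
    (q - n / 2 - 1).factorial / ((n / 2).factorial * (q + n / 2 + 1).factorial))

theorem fieldConst_pos {ρ : ℝ} (hρ : 0 < ρ) (n : ℕ) : 0 < fieldConst ρ n := by
  have : (0 : ℝ) < n.factorial := by positivity
  unfold fieldConst
  positivity

theorem repConst_pos (q n : ℕ) : 0 < repConst q n := by
  have h1 : (0 : ℝ) < (n - 1).doubleFactorial := by exact_mod_cast Nat.doubleFactorial_pos _
  have h2 : (0 : ℝ) < n.doubleFactorial := by exact_mod_cast Nat.doubleFactorial_pos _
  unfold repConst
  split_ifs <;> positivity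

theorem harmonicTop_eq (ρ : ℝ) (n : ℕ) :
    harmonicTop ρ n = (fieldConst ρ n : ℂ) • fieldOsp.top n := by
  rcases Nat.even_or_odd' n with ⟨k, rfl | rfl⟩
  · rw [OspAlgebra.top_even]
    simp [harmonicTop, fieldConst, topDegree, fieldOsp]
  · have h1 : (2 * k + 1) / 2 = k := by omega
    have h2 : (2 * k + 1) % 2 = 1 := by omega
    rw [OspAlgebra.top_odd]
    simp [harmonicTop, fieldConst, topDegree, fieldOsp, OspAlgebra.w, h1, h2]

theorem ncHarmonicTop_eq (q n : ℕ) :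
    ncHarmonicTop q n = (repConst q n : ℂ) • (repOsp q 1).top n := by
  rcases Nat.even_or_odd' n with ⟨k, rfl | rfl⟩
  · rw [OspAlgebra.top_even]
    simp [ncHarmonicTop, repConst, repOsp]
  · have h1 : (2 * k + 1) / 2 = k := by omega
    rw [OspAlgebra.top_odd]
    simp [ncHarmonicTop, repConst, repOsp, OspAlgebra.w, h1]

/-- Indices of the superspherical harmonics of superspin at most `q`. -/
abbrev HarmonicIndex (q : ℕ) : Type := (n : Fin (2 * q + 1)) × Fin (2 * n.val + 1)

/-- A sum of consecutive odd numbers. Its agreement with `finrank_repEnd` is what makes the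
independent descendants a basis. -/
theorem card_harmonicIndex (q : ℕ) : Fintype.card (HarmonicIndex q) = (2 * q + 1) ^ 2 := by
  rw [Fintype.card_sigma]
  simp only [Fintype.card_fin]
  rw [Fin.sum_univ_eq_sum_range (fun n => 2 * n + 1)]
  generalize 2 * q + 1 = N
  induction N with
  | zero => simp
  | succ N ih => rw [Finset.sum_range_succ, ih]; ring

theorem isHighestWeight_ncHarmonicTop (q n : ℕ) :
    IsHighestWeight (repAd q (.inr 0)) (repAd q (.inr 1)) n (ncHarmonicTop q n) := by
  rw [ncHarmonicTop_eq]
  exact ((repOsp q 1).isHighestWeight_top n).smul _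

theorem linearIndependent_ncHarmonic (q : ℕ) : LinearIndependent ℂ
    (fun i : HarmonicIndex q => (repAd q (.inr 1) ^ i.2.val) (ncHarmonicTop q i.1)) := by
  refine linearIndependent_descendants _ _ (ncHarmonicTop q) _
    (fun n _ => isHighestWeight_ncHarmonicTop q n) fun n hn => ?_
  rw [ncHarmonicTop_eq]
  exact smul_ne_zero (by exact_mod_cast (repConst_pos q n).ne') (repOsp_top_ne_zero (by omega))

theorem finrank_repEnd (q : ℕ) : Module.finrank ℂ (RepEnd q) = (2 * q + 1) ^ 2 := by
  rw [Module.finrank_linearMap]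
  simp
  ring

/-- The basis of the endomorphism algebra of descendants of the highest weight vectors. -/
def repBasis (q : ℕ) : Module.Basis (HarmonicIndex q) ℂ (RepEnd q) :=
  basisOfLinearIndependentOfCardEqFinrank (linearIndependent_ncHarmonic q)
    (by rw [card_harmonicIndex, finrank_repEnd])

theorem repBasis_apply (q : ℕ) (i : HarmonicIndex q) :
    repBasis q i = (repAd q (.inr 1) ^ i.2.val) (ncHarmonicTop q i.1) := by
  simp [repBasis]

theorem ncHarmonicTop_pow_eq_zero {q n s : ℕ} (hs : 2 * n < s) :
    (repAd q (.inr 1) ^ s) (ncHarmonicTop q n) = 0 := by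
  rw [ncHarmonicTop_eq, map_smul]
  have := (repOsp q 1).D5_pow_top_eq_zero hs
  exact (congrArg _ this).trans (smul_zero _)

/-! ### The modules of superspherical harmonics -/

theorem evenGen_mem {V : Type*} [AddCommGroup V] [Module ℂ V] {A B : Module.End ℂ V}
    {W : Submodule ℂ V} (hA : ∀ v ∈ W, A v ∈ W) (hB : ∀ v ∈ W, B v ∈ W) (i : Fin 3) {v : V}
    (hv : v ∈ W) : evenGen A B i v ∈ W := by
  have hAA := hA _ (hA v hv)
  have hBB := hB _ (hB v hv)
  have hAB := hA _ (hB v hv)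
  have hBA := hB _ (hA v hv)
  fin_cases i
  · exact W.sub_mem (W.smul_mem _ hAA) (W.smul_mem _ hBB)
  · exact W.smul_mem _ (W.add_mem hAA hBB)
  · exact W.smul_mem _ (W.add_mem hAB hBA)

theorem lowering_evenGen {V : Type*} [AddCommGroup V] [Module ℂ V] (A B : Module.End ℂ V) (v : V) :
    evenGen A B 0 v - Complex.I • evenGen A B 1 v = (-4 : ℂ) • B (B v) := by
  simp only [evenGen, Matrix.cons_val_zero, Matrix.cons_val_one, LinearMap.sub_apply,
    LinearMap.add_apply, LinearMap.smul_apply, Module.End.mul_apply]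
  match_scalars <;> ring_nf <;> norm_num

/-- Descendants in terms of the odd lowering operator. -/
theorem descendant_eq {V : Type*} [AddCommGroup V] [Module ℂ V]
    (J : Fin 3 ⊕ Fin 2 → Module.End ℂ V) (v : V) (n μ r : ℕ)
    (h : ∀ s, lowering J ((J (.inr 1) ^ s) v) = (-4 : ℂ) • (J (.inr 1) ^ (s + 2)) v) :
    descendant J v n μ r = (((Real.sqrt (4 ^ μ * (n - μ - r).factorial /
      (n.factorial * r.factorial)) : ℝ) : ℂ) * (-4) ^ r) • (J (.inr 1) ^ (μ + 2 * r)) v := by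
  have hr : (lowering J ^ r) ((J (.inr 1) ^ μ) v) =
      (-4 : ℂ) ^ r • (J (.inr 1) ^ (μ + 2 * r)) v := by
    induction r with
    | zero => simp
    | succ r ih =>
      rw [pow_succ', Module.End.mul_apply, ih, map_smul, h, smul_smul, pow_succ]
      rfl
  rw [descendant, hr, smul_smul]

theorem pow_add_two_apply {V : Type*} [AddCommGroup V] [Module ℂ V] (B : Module.End ℂ V) (s : ℕ)
    (v : V) : (B ^ (s + 2)) v = B (B ((B ^ s) v)) := by
  rw [pow_succ', pow_succ', Module.End.mul_apply, Module.End.mul_apply]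

theorem fieldOsp_D4 : fieldOsp.D4 = fieldJ (.inr 0) := rfl

theorem fieldOsp_D5 : fieldOsp.D5 = fieldJ (.inr 1) := rfl

theorem harmonicTop_pow (ρ : ℝ) (n s : ℕ) : (fieldJ (.inr 1) ^ s) (harmonicTop ρ n) =
    (fieldConst ρ n : ℂ) • (fieldOsp.D5 ^ s) (fieldOsp.top n) := by
  rw [harmonicTop_eq, map_smul]
  rfl

theorem ncHarmonicTop_pow (q n s : ℕ) : (repAd q (.inr 1) ^ s) (ncHarmonicTop q n) =
    (repConst q n : ℂ) • ((repOsp q 1).D5 ^ s) ((repOsp q 1).top n) := by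
  rw [ncHarmonicTop_eq, map_smul]
  rfl

theorem harmonicTop_pow_mem_adjoin (ρ : ℝ) (n s : ℕ) :
    (fieldJ (.inr 1) ^ s) (harmonicTop ρ n) ∈ Algebra.adjoin ℂ fieldOsp.gens := by
  rw [harmonicTop_pow]
  exact Subalgebra.smul_mem _ (fieldOsp.D5_pow_top_mem n s) _

theorem harmonicTop_pow_eq_zero {ρ : ℝ} {n s : ℕ} (hs : 2 * n < s) :
    (fieldJ (.inr 1) ^ s) (harmonicTop ρ n) = 0 := by
  rw [harmonicTop_pow, fieldOsp.D5_pow_top_eq_zero hs, smul_zero]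

theorem isHighestWeight_harmonicTop (ρ : ℝ) (n : ℕ) :
    IsHighestWeight (fieldJ (.inr 0)) (fieldJ (.inr 1)) n (harmonicTop ρ n) := by
  rw [harmonicTop_eq]
  exact (fieldOsp.isHighestWeight_top n).smul _

theorem lowering_fieldJ (ρ : ℝ) (n s : ℕ) :
    lowering fieldJ ((fieldJ (.inr 1) ^ s) (harmonicTop ρ n)) =
      (-4 : ℂ) • (fieldJ (.inr 1) ^ (s + 2)) (harmonicTop ρ n) := by
  have h := harmonicTop_pow_mem_adjoin ρ n s
  rw [lowering, LinearMap.sub_apply, LinearMap.smul_apply, fieldJ_inl h, fieldJ_inl h,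
    lowering_evenGen, pow_add_two_apply, fieldOsp_D5]

theorem lowering_repAd (q n s : ℕ) :
    lowering (repAd q) ((repAd q (.inr 1) ^ s) (ncHarmonicTop q n)) =
      (-4 : ℂ) • (repAd q (.inr 1) ^ (s + 2)) (ncHarmonicTop q n) := by
  rw [lowering, LinearMap.sub_apply, LinearMap.smul_apply, repAd_inl, repAd_inl, lowering_evenGen,
    pow_add_two_apply]

/-- The modules of harmonics are spanned by the descendants. -/
theorem fieldModule_eq (ρ : ℝ) (n : ℕ) : fieldModule ρ n =
    Submodule.span ℂ (Set.range fun s : ℕ => (fieldJ (.inr 1) ^ s) (harmonicTop ρ n)) := by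
  set W := Submodule.span ℂ (Set.range fun s : ℕ => (fieldJ (.inr 1) ^ s) (harmonicTop ρ n)) with hW
  have hs : ∀ s, (fieldJ (.inr 1) ^ s) (harmonicTop ρ n) ∈ W := fun s =>
    Submodule.subset_span ⟨s, rfl⟩
  apply le_antisymm
  · refine sInf_le ⟨by simpa using hs 0, ?_⟩
    have h5 : ∀ F ∈ W, fieldJ (.inr 1) F ∈ W := by
      intro F hF
      refine Submodule.span_induction ?_ (by simp) (fun F G _ _ hF hG => ?_)
        (fun c F _ hF => ?_) hF
      · rintro _ ⟨s, rfl⟩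
        have := hs (s + 1)
        rwa [pow_succ', Module.End.mul_apply] at this
      · rw [map_add]; exact W.add_mem hF hG
      · rw [map_smul]; exact W.smul_mem c hF
    have h4 : ∀ F ∈ W, fieldJ (.inr 0) F ∈ W := by
      intro F hF
      refine Submodule.span_induction ?_ (by simp) (fun F G _ _ hF hG => ?_)
        (fun c F _ hF => ?_) hF
      · rintro _ ⟨s, rfl⟩
        have hw := isHighestWeight_harmonicTop ρ n
        rcases s with _ | s
        · simp only [pow_zero, Module.End.one_apply, hw.raise, W.zero_mem]
        · simp only [hw.lower]
          exact W.smul_mem _ (hs s)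
      · rw [map_add]; exact W.add_mem hF hG
      · rw [map_smul]; exact W.smul_mem c hF
    -- The quadratic formula for the even generators is available on polynomials only.
    have hadj : ∀ F ∈ W, F ∈ Algebra.adjoin ℂ fieldOsp.gens := by
      intro F hF
      have : W ≤ Subalgebra.toSubmodule (Algebra.adjoin ℂ fieldOsp.gens) := by
        rw [hW, Submodule.span_le]
        rintro _ ⟨s, rfl⟩
        exact harmonicTop_pow_mem_adjoin ρ n s
      exact this hF
    rintro (i | α) F hF
    · rw [fieldJ_inl (hadj F hF)]
      exact evenGen_mem h4 h5 i hF
    · have hα : α = 0 ∨ α = 1 := by fin_cases α <;> simp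
      rcases hα with rfl | rfl
      · exact h4 F hF
      · exact h5 F hF
  · rw [hW, Submodule.span_le]
    rintro _ ⟨s, rfl⟩
    refine Submodule.mem_sInf.mpr fun W hW => ?_
    induction s with
    | zero => simpa using hW.1
    | succ s ih => simp only [pow_succ', Module.End.mul_apply]; exact hW.2 _ _ ih

theorem pow_mem_fieldModule (ρ : ℝ) (n s : ℕ) :
    (fieldJ (.inr 1) ^ s) (harmonicTop ρ n) ∈ fieldModule ρ n := by
  rw [fieldModule_eq]
  exact Submodule.subset_span ⟨s, rfl⟩

theorem mem_adjoin_of_mem_fieldModule {ρ : ℝ} {n : ℕ} {F : Superfield} (hF : F ∈ fieldModule ρ n) :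
    F ∈ Algebra.adjoin ℂ fieldOsp.gens := by
  have : fieldModule ρ n ≤ Subalgebra.toSubmodule (Algebra.adjoin ℂ fieldOsp.gens) := by
    rw [fieldModule_eq, Submodule.span_le]
    rintro _ ⟨s, rfl⟩
    exact harmonicTop_pow_mem_adjoin ρ n s
  exact this hF

/-- A descendant, as an element of the truncation. -/
def truncElem (L : ℕ) (ρ : ℝ) (q : ℕ) (n s : ℕ) (hn : n ≤ 2 * q) : trunc L ρ q :=
  ⟨restrict L ρ ((fieldJ (.inr 1) ^ s) (harmonicTop ρ n)),
    restrict_mem L hn (pow_mem_fieldModule ρ n s)⟩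

theorem linearIndependent_truncElem {L : ℕ} (hL : 2 ≤ L) {ρ : ℝ} (hρ : 0 < ρ) (q : ℕ) :
    LinearIndependent ℂ (fun i : HarmonicIndex q =>
      truncElem L ρ q i.1 i.2 (Nat.lt_succ_iff.mp i.1.2)) := by
  refine LinearIndependent.of_comp (trunc L ρ q).subtype ?_
  have h := linearIndependent_restrict hL hρ.ne' (2 * q + 1)
  have h' := h.units_smul fun i : HarmonicIndex q => Units.mk0 ((fieldConst ρ i.1 : ℝ) : ℂ)
    (by exact_mod_cast (fieldConst_pos hρ _).ne')
  convert h' using 1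
  funext i
  change restrict L ρ _ = ((fieldConst ρ i.1 : ℝ) : ℂ) • _
  rw [harmonicTop_pow, map_smul]

theorem span_truncElem (L : ℕ) (ρ : ℝ) (q : ℕ) :
    ⊤ ≤ Submodule.span ℂ (Set.range (fun i : HarmonicIndex q =>
      truncElem L ρ q i.1 i.2 (Nat.lt_succ_iff.mp i.1.2))) := by
  set W := Submodule.span ℂ (Set.range (fun i : HarmonicIndex q =>
      truncElem L ρ q i.1 i.2 (Nat.lt_succ_iff.mp i.1.2))) with hW
  have h : trunc L ρ q ≤ W.map (trunc L ρ q).subtype := by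
    refine iSup_le fun n => ?_
    rw [sphereModule, fieldModule_eq, Submodule.map_span, Submodule.span_le]
    rintro _ ⟨_, ⟨s, rfl⟩, rfl⟩
    by_cases hs : 2 * n.1 < s
    · simp only [harmonicTop_pow_eq_zero hs, map_zero]
      exact Submodule.zero_mem _
    · refine ⟨truncElem L ρ q n s n.2, Submodule.subset_span
        ⟨⟨⟨n, Nat.lt_succ_iff.mpr n.2⟩, ⟨s, show s < 2 * n.1 + 1 by omega⟩⟩, rfl⟩, rfl⟩
  rintro ⟨f, hf⟩ -
  obtain ⟨g, hg, rfl⟩ := h hf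
  exact hg

/-- The basis of the truncation of descendants of the highest weight vectors. -/
def truncBasis {L : ℕ} (hL : 2 ≤ L) {ρ : ℝ} (hρ : 0 < ρ) (q : ℕ) :
    Module.Basis (HarmonicIndex q) ℂ (trunc L ρ q) :=
  Module.Basis.mk (linearIndependent_truncElem hL hρ q) (span_truncElem L ρ q)

/-! ### The isomorphisms -/

/-- `ψ` sends the descendants of highest weight vectors to each other. -/
def SendsDescendants (L : ℕ) (ρ : ℝ) (q : ℕ) (ψ : trunc L ρ q ≃ₗ[ℂ] RepEnd q) : Prop :=
  ∀ (n s : ℕ) (hn : n ≤ 2 * q),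
    ψ (truncElem L ρ q n s hn) = (repAd q (.inr 1) ^ s) (ncHarmonicTop q n)

theorem harmonic_eq (L : ℕ) (ρ : ℝ) (q n μ r : ℕ) (hn : n ≤ 2 * q) :
    (⟨harmonic L ρ n μ r, harmonic_mem L ρ q n μ r hn⟩ : trunc L ρ q) =
      (((Real.sqrt (4 ^ μ * (n - μ - r).factorial / (n.factorial * r.factorial)) : ℝ) : ℂ) *
        (-4) ^ r) • truncElem L ρ q n (μ + 2 * r) hn := by
  refine Subtype.ext ?_
  change restrict L ρ (descendant fieldJ (harmonicTop ρ n) n μ r) = _ • restrict L ρ _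
  rw [descendant_eq _ _ _ _ _ (lowering_fieldJ ρ n), map_smul]

theorem ncHarmonic_eq (q n μ r : ℕ) : ncHarmonic q n μ r =
    (((Real.sqrt (4 ^ μ * (n - μ - r).factorial / (n.factorial * r.factorial)) : ℝ) : ℂ) *
      (-4) ^ r) • (repAd q (.inr 1) ^ (μ + 2 * r)) (ncHarmonicTop q n) :=
  descendant_eq _ _ _ _ _ (lowering_repAd q n)

/-- On descendants `J₋ = -4 J₅²`, so the harmonic with indices `μ, r` is a multiple of the
descendant with `s = μ + 2 r`, by the same nonzero factor on both sides. Conversely `s ≤ 2 n` comes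
from `μ = s % 2` and `r = s / 2`; for `s > 2 n` both descendants vanish. -/
theorem sendsHarmonics_iff {L : ℕ} {ρ : ℝ} {q : ℕ} {ψ : trunc L ρ q ≃ₗ[ℂ] RepEnd q} :
    SendsHarmonics L ρ q ψ ↔ SendsDescendants L ρ q ψ := by
  constructor
  · intro h n s hn
    by_cases hs : 2 * n < s
    · have : truncElem L ρ q n s hn = 0 := by
        refine Subtype.ext ?_
        simp [truncElem, harmonicTop_pow_eq_zero hs]
      rw [this, LinearEquiv.map_zero, ncHarmonicTop_pow_eq_zero hs]
    · have h1 := h n (s % 2) (s / 2) hn (by omega) (by omega)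
      rw [harmonic_eq _ _ _ _ _ _ hn, ncHarmonic_eq, map_smul, Nat.mod_add_div] at h1
      refine smul_right_injective _ (mul_ne_zero ?_ (pow_ne_zero _ (by norm_num))) h1
      have : (0 : ℝ) < 4 ^ (s % 2) * (n - s % 2 - s / 2).factorial /
        (n.factorial * (s / 2).factorial) := by positivity
      exact_mod_cast (Real.sqrt_pos.mpr this).ne'
  · intro h n μ r hn _ _
    rw [harmonic_eq _ _ _ _ _ _ hn, ncHarmonic_eq, map_smul, h]

theorem existsUnique_sendsHarmonics {L : ℕ} (hL : 2 ≤ L) {ρ : ℝ} (hρ : 0 < ρ) (q : ℕ) :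
    ∃! ψ : trunc L ρ q ≃ₗ[ℂ] RepEnd q, SendsHarmonics L ρ q ψ := by
  have hb : ∀ i, truncBasis hL hρ q i = truncElem L ρ q i.1 i.2 (Nat.lt_succ_iff.mp i.1.2) := by
    intro i
    simp [truncBasis]
  refine ⟨(truncBasis hL hρ q).equiv (repBasis q) (Equiv.refl _), ?_, ?_⟩
  · beta_reduce
    rw [sendsHarmonics_iff]
    intro n s hn
    by_cases hs : 2 * n < s
    · have : truncElem L ρ q n s hn = 0 := by
        refine Subtype.ext ?_
        simp [truncElem, harmonicTop_pow_eq_zero hs]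
      rw [this, LinearEquiv.map_zero, ncHarmonicTop_pow_eq_zero hs]
    · let i : HarmonicIndex q := ⟨⟨n, by omega⟩, ⟨s, show s < 2 * n + 1 by omega⟩⟩
      have h1 := (truncBasis hL hρ q).equiv_apply i (repBasis q) (Equiv.refl _)
      rw [hb, Equiv.refl_apply, repBasis_apply] at h1
      exact h1
  · intro ψ hψ
    rw [sendsHarmonics_iff] at hψ
    refine (truncBasis hL hρ q).ext' fun i => ?_
    rw [Module.Basis.equiv_apply, Equiv.refl_apply, repBasis_apply, hb, hψ]

section
variable {L : ℕ} {ρ : ℝ} {q : ℕ} {ψ : trunc L ρ q ≃ₗ[ℂ] RepEnd q}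

/-- The inverse of `ψ`, with values in the functions on the supersphere. -/
def symbol (ψ : trunc L ρ q ≃ₗ[ℂ] RepEnd q) : RepEnd q →ₗ[ℂ] HInfSphere L ρ :=
  (trunc L ρ q).subtype ∘ₗ ψ.symm.toLinearMap

theorem symbol_apply (Y : RepEnd q) : symbol ψ Y = ψ.symm Y := rfl

theorem eq_of_symbol_eq {f : trunc L ρ q} {Y : RepEnd q} (h : f.1 = symbol ψ Y) : ψ f = Y := by
  rw [← LinearEquiv.eq_symm_apply]
  exact Subtype.ext h

theorem symbol_injective : Function.Injective (symbol ψ) := by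
  intro Y Z h
  exact ψ.symm.injective (Subtype.ext h)

/-- Parity and both odd generators are carried through a single span induction. Stated through
`symbol`, the four equations are linear in `F` and `Y` and free of membership proofs. -/
theorem exists_preimage (hψ : SendsDescendants L ρ q ψ) {n : ℕ} (hn : n ≤ 2 * q) {F : Superfield}
    (hF : F ∈ fieldModule ρ n) : ∃ Y, restrict L ρ F = symbol ψ Y ∧
      restrict L ρ (fieldParity F) = symbol ψ (gradeInvolution q Y) ∧
      restrict L ρ (fieldJ (.inr 0) F) = symbol ψ (repAd q (.inr 0) Y) ∧
      restrict L ρ (fieldJ (.inr 1) F) = symbol ψ (repAd q (.inr 1) Y) := by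
  have hs : ∀ s, restrict L ρ ((fieldJ (.inr 1) ^ s) (harmonicTop ρ n)) =
      symbol ψ ((repAd q (.inr 1) ^ s) (ncHarmonicTop q n)) := by
    intro s
    rw [← hψ n s hn, symbol_apply, LinearEquiv.symm_apply_apply]
    rfl
  rw [fieldModule_eq] at hF
  induction hF using Submodule.span_induction with
  | mem F hF =>
    obtain ⟨s, rfl⟩ := hF
    refine ⟨_, hs s, ?_, ?_, ?_⟩
    · have h1 : fieldParity ((fieldJ (.inr 1) ^ s) (harmonicTop ρ n)) =
          (-1 : ℂ) ^ (n + s) • (fieldJ (.inr 1) ^ s) (harmonicTop ρ n) := by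
        rw [harmonicTop_pow, map_smul, smul_comm]
        exact congrArg _ (fieldOsp.P_D5_pow_top n s)
      have h2 : gradeInvolution q ((repAd q (.inr 1) ^ s) (ncHarmonicTop q n)) =
          (-1 : ℂ) ^ (n + s) • (repAd q (.inr 1) ^ s) (ncHarmonicTop q n) := by
        rw [ncHarmonicTop_pow, map_smul, smul_comm]
        exact congrArg _ ((repOsp q 1).P_D5_pow_top n s)
      rw [h1, h2, map_smul, LinearMap.map_smul, hs]
    · rcases s with _ | s
      · simp only [pow_zero, Module.End.one_apply, (isHighestWeight_harmonicTop ρ n).raise,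
        (isHighestWeight_ncHarmonicTop q n).raise, map_zero]
      · simp only [(isHighestWeight_harmonicTop ρ n).lower,
        (isHighestWeight_ncHarmonicTop q n).lower, map_smul, hs]
    · have := hs (s + 1)
      rwa [pow_succ', pow_succ', Module.End.mul_apply, Module.End.mul_apply] at this
  | zero => exact ⟨0, by simp⟩
  | add F G _ _ hF hG =>
    obtain ⟨Y, h1, h2, h3, h4⟩ := hF
    obtain ⟨Z, k1, k2, k3, k4⟩ := hG
    exact ⟨Y + Z, by simp only [map_add, h1, k1], by simp only [map_add, h2, k2],
      by simp only [map_add, h3, k3], by simp only [map_add, h4, k4]⟩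
  | smul c F _ hF =>
    obtain ⟨Y, h1, h2, h3, h4⟩ := hF
    exact ⟨c • Y, by simp only [map_smul, h1], by simp only [map_smul, h2],
      by simp only [map_smul, h3], by simp only [map_smul, h4]⟩

theorem SendsDescendants.isEvenMap (hψ : SendsDescendants L ρ q ψ) : IsEvenMap L ρ q ψ := by
  intro n hn F hF
  obtain ⟨Y, h1, h2, -, -⟩ := exists_preimage hψ hn hF
  have hY : ψ ⟨restrict L ρ F, restrict_mem L hn hF⟩ = Y :=
    eq_of_symbol_eq h1
  rw [hY]
  constructor
  · intro h4 h5
    have : fieldParity F = F := by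
      ext1 <;> simp [fieldParity_apply, h4, h5]
    rw [this, h1] at h2
    exact (symbol_injective h2).symm
  · intro h0 h45
    have : fieldParity F = -F := by
      rw [fieldParity_apply, Superfield.neg_def, h0, h45, neg_zero]
    rw [this, map_neg, h1] at h2
    refine symbol_injective (ψ := ψ) ?_
    rw [← h2, map_neg]

theorem SendsDescendants.isModuleHom (hψ : SendsDescendants L ρ q ψ) : IsModuleHom L ρ q ψ := by
  intro n hn A F hF
  -- This form can be iterated, since `fieldModule` is stable; applied twice it settles the even
  -- generators, which are quadratic in the odd ones.
  have key : ∀ {F : Superfield} {Y : RepEnd q} (_ : F ∈ fieldModule ρ n)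
      (_ : restrict L ρ F = symbol ψ Y) (α : Fin 2),
      restrict L ρ (fieldJ (.inr α) F) = symbol ψ (repAd q (.inr α) Y) := by
    intro F Y hF hY α
    obtain ⟨Z, h1, -, h3, h4⟩ := exists_preimage hψ hn hF
    obtain rfl : Y = Z := symbol_injective (hY.symm.trans h1)
    have hα : α = 0 ∨ α = 1 := by fin_cases α <;> simp
    rcases hα with rfl | rfl
    · exact h3
    · exact h4
  obtain ⟨Y, h1, -, -, -⟩ := exists_preimage hψ hn hF
  have hY : ψ ⟨restrict L ρ F, restrict_mem L hn hF⟩ = Y :=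
    eq_of_symbol_eq h1
  rw [hY]
  refine eq_of_symbol_eq ?_
  change restrict L ρ (fieldJ A F) = _
  rcases A with i | α
  · rw [fieldJ_inl (mem_adjoin_of_mem_fieldModule hF), repAd_inl, fieldOsp_D4, fieldOsp_D5]
    have h : ∀ α β, restrict L ρ (fieldJ (.inr α) (fieldJ (.inr β) F)) =
        symbol ψ (repAd q (.inr α) (repAd q (.inr β) Y)) := fun α β =>
      key (fieldModule_invariant ρ n _ hF) (key hF h1 β) α
    have hi : i = 0 ∨ i = 1 ∨ i = 2 := by fin_cases i <;> simp
    rcases hi with rfl | rfl | rfl <;>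
      simp only [evenGen, Matrix.cons_val_zero, Matrix.cons_val_one, Matrix.cons_val,
        LinearMap.sub_apply, LinearMap.add_apply, LinearMap.smul_apply, Module.End.mul_apply,
        map_sub, map_add, map_smul, h]
  · exact key hF h1 α

end

theorem directedSystem_connect {L : ℕ} {ρ : ℝ} (ψ : (q : ℕ) → trunc L ρ q ≃ₗ[ℂ] RepEnd q) :
    DirectedSystem RepEnd (fun _ _ h => connect ψ h) where
  map_self q Y := (ψ q).apply_symm_apply Y
  map_map q q' q'' h h' Y := by
    simp only [connect, LinearMap.comp_apply, LinearEquiv.coe_coe, LinearEquiv.symm_apply_apply]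
    rfl

/-! ### Convergence in the Fréchet topology -/

/-- Continuity of all coefficients of a Grassmann-valued function. -/
def CoeffContinuous {L : ℕ} (g : SuperSpace L → Grassmann L) : Prop :=
  ∀ M, Continuous fun p => coeff (g p) M

namespace CoeffContinuous

variable {L : ℕ} {g h : SuperSpace L → Grassmann L}

theorem add (hg : CoeffContinuous g) (hh : CoeffContinuous h) :
    CoeffContinuous fun p => g p + h p := by
  intro M
  simp only [coeff_add]
  exact (hg M).add (hh M)

theorem sub (hg : CoeffContinuous g) (hh : CoeffContinuous h) :
    CoeffContinuous fun p => g p - h p := by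
  intro M
  simp only [coeff_sub]
  exact (hg M).sub (hh M)

theorem smul (hg : CoeffContinuous g) {c : SuperSpace L → ℂ} (hc : Continuous c) :
    CoeffContinuous fun p => c p • g p := by
  intro M
  simp only [coeff_smul]
  exact hc.mul (hg M)

theorem const (y : Grassmann L) : CoeffContinuous fun _ : SuperSpace L => y :=
  fun _ => continuous_const

theorem sum {ι : Type*} (s : Finset ι) {g : ι → SuperSpace L → Grassmann L}
    (hg : ∀ i ∈ s, CoeffContinuous (g i)) : CoeffContinuous fun p => ∑ i ∈ s, g i p := by
  intro M
  have : ∀ p, coeff (∑ i ∈ s, g i p) M = ∑ i ∈ s, coeff (g i p) M := by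
    intro p
    simp [coeff]
  simp only [this]
  exact continuous_finsetSum s fun i hi => hg i hi M

/-- The product is bilinear in finitely many coefficients, with the constant vectors `monomialBasis
L A * monomialBasis L B`. -/
theorem mul (hg : CoeffContinuous g) (hh : CoeffContinuous h) :
    CoeffContinuous fun p => g p * h p := by
  have : (fun p => g p * h p) = fun p => ∑ A, ∑ B, (coeff (g p) A * coeff (h p) B) •
      (monomialBasis L A * monomialBasis L B) := by
    funext p
    nth_rewrite 1 [eq_sum_coeff (g p), eq_sum_coeff (h p)]
    rw [Finset.sum_mul_sum]
    simp only [smul_mul_smul_comm]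
  rw [this]
  exact sum _ fun A _ => sum _ fun B _ => (const _).smul ((hg A).mul (hh B))

theorem pow (hg : CoeffContinuous g) (n : ℕ) : CoeffContinuous fun p => g p ^ n := by
  induction n with
  | zero => simpa using const 1
  | succ n ih => simpa only [pow_succ] using ih.mul hg

end CoeffContinuous

theorem norm_coeff_le_gnorm {L : ℕ} (y : Grassmann L) (M : Finset (Fin L)) :
    ‖coeff y M‖ ≤ gnorm y :=
  Finset.single_le_sum (f := fun M => ‖coeff y M‖) (fun _ _ => norm_nonneg _) (Finset.mem_univ M)

theorem coeffContinuous_x {L : ℕ} (k : Fin 3) : CoeffContinuous fun p : SuperSpace L => p.x k := by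
  intro M
  refine (LipschitzWith.of_dist_le_mul (K := 1) fun p p' => ?_).continuous
  rw [NNReal.coe_one, one_mul, dist_eq_norm, ← coeff_sub]
  refine (norm_coeff_le_gnorm _ M).trans ?_
  refine (Finset.single_le_sum (f := fun k => gnorm (p.x k - p'.x k))
    (fun _ _ => gnorm_nonneg _) (Finset.mem_univ k)).trans ?_
  exact le_add_of_nonneg_right (Finset.sum_nonneg fun _ _ => gnorm_nonneg _)

theorem coeffContinuous_θ {L : ℕ} (α : Fin 2) : CoeffContinuous fun p : SuperSpace L => p.θ α := by
  intro M
  refine (LipschitzWith.of_dist_le_mul (K := 1) fun p p' => ?_).continuous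
  rw [NNReal.coe_one, one_mul, dist_eq_norm, ← coeff_sub]
  refine (norm_coeff_le_gnorm _ M).trans ?_
  refine (Finset.single_le_sum (f := fun α => gnorm (p.θ α - p'.θ α))
    (fun _ _ => gnorm_nonneg _) (Finset.mem_univ α)).trans ?_
  exact le_add_of_nonneg_left (Finset.sum_nonneg fun _ _ => gnorm_nonneg _)

theorem coeffContinuous_soul {L : ℕ} (k : Fin 3) :
    CoeffContinuous fun p : SuperSpace L => soul (p.x k) := by
  have h := coeffContinuous_x (L := L) k
  simp only [soul, Algebra.algebraMap_eq_smul_one]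
  exact h.sub ((CoeffContinuous.const 1).smul (h ∅))

theorem continuous_bodyPoint {L : ℕ} : Continuous (bodyPoint : SuperSpace L → Fin 3 → ℝ) :=
  continuous_pi fun k => Complex.continuous_re.comp (coeffContinuous_x k ∅)

theorem coeffContinuous_zExpansion {L : ℕ} (f : Smooth) :
    CoeffContinuous fun p : SuperSpace L => zExpansion p f := by
  refine CoeffContinuous.sum _ fun a _ => CoeffContinuous.sum _ fun b _ =>
    CoeffContinuous.sum _ fun c _ => CoeffContinuous.smul ?_ ?_
  · exact (((coeffContinuous_soul 0).pow a).mul ((coeffContinuous_soul 1).pow b)).mul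
      ((coeffContinuous_soul 2).pow c)
  · exact continuous_const.mul ((smooth_contDiff _).continuous.comp continuous_bodyPoint)

theorem coeffContinuous_evalHom {L : ℕ} (F : Superfield) : CoeffContinuous (evalHom L F) := by
  have h0 := coeffContinuous_θ (L := L) 0
  have h1 := coeffContinuous_θ (L := L) 1
  exact (((coeffContinuous_zExpansion F.c0).add ((coeffContinuous_zExpansion F.c4).mul h0)).add
    ((coeffContinuous_zExpansion F.c5).mul h1)).add
      ((coeffContinuous_zExpansion F.c45).mul (h0.mul h1))

/-- The seminorms are finite on compact sets. -/
theorem superSeminorm_lt_top {L : ℕ} {K : Set (SuperSpace L)} (hK : IsCompact K) (n : ℕ)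
    (F : Superfield) : superSeminorm K n F < ⊤ := by
  have hb : ∀ G : Superfield, ∃ C : ℝ, ∀ p ∈ K, gnorm (evalHom L G p) ≤ C := by
    intro G
    have hc : Continuous fun p => gnorm (evalHom L G p) :=
      continuous_finsetSum _ fun M _ => (coeffContinuous_evalHom G M).norm
    obtain ⟨C, hC⟩ := hK.exists_bound_of_continuousOn hc.continuousOn
    exact ⟨C, fun p hp => (le_abs_self _).trans (hC p hp)⟩
  choose C hC using hb
  -- All multi-indices with `|N| ≤ n` lie in this finite box, so a finite sum bounds the supremum.
  let s : Finset (Fin 3 → ℕ) := Fintype.piFinset fun _ => Finset.range (n + 1)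
  refine lt_of_le_of_lt (b := ∑ N ∈ s, ∑ M : Fin 2 → Fin 2,
    ENNReal.ofReal (C (superDeriv N M F))) ?_ ?_
  · refine iSup₂_le fun p hp => iSup₂_le fun N hN => iSup_le fun M => ?_
    have hNs : N ∈ s := by
      rw [Fintype.mem_piFinset]
      intro k
      have := Finset.single_le_sum (f := N) (fun _ _ => Nat.zero_le _) (Finset.mem_univ k)
      exact Finset.mem_range.mpr (by omega)
    refine (ENNReal.ofReal_le_ofReal (hC _ p hp)).trans ?_
    refine (Finset.single_le_sum (f := fun M => ENNReal.ofReal (C (superDeriv N M F)))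
      (fun _ _ => bot_le) (Finset.mem_univ M)).trans ?_
    exact Finset.single_le_sum (f := fun N => ∑ M, ENNReal.ofReal (C (superDeriv N M F)))
      (fun _ _ => bot_le) hNs
  · exact ENNReal.sum_lt_top.mpr fun N _ => ENNReal.sum_lt_top.mpr fun M _ => ENNReal.ofReal_lt_top

theorem superSeminorm_smul_le {L : ℕ} (K : Set (SuperSpace L)) (n : ℕ) (c : ℂ) (F : Superfield) :
    superSeminorm K n (c • F) ≤ ENNReal.ofReal ‖c‖ * superSeminorm K n F := by
  refine iSup₂_le fun p hp => iSup₂_le fun N hN => iSup_le fun M => ?_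
  have h : gnorm (evalHom L (superDeriv N M (c • F)) p) =
      ‖c‖ * gnorm (evalHom L (superDeriv N M F) p) := by
    rw [map_smul, map_smul, Pi.smul_apply, gnorm, gnorm, Finset.mul_sum]
    simp only [coeff_smul, norm_mul]
  rw [h, ENNReal.ofReal_mul (norm_nonneg c)]
  gcongr
  exact le_iSup₂_of_le p hp (le_iSup₂_of_le N hN (le_iSup_of_le M le_rfl))

section
variable {L : ℕ} {ρ : ℝ}

theorem sphereSeminorm_lt_top {K : Set (SuperSpace L)} (hK : IsCompact K) (n : ℕ)
    (f : HInfSphere L ρ) : sphereSeminorm K n f < ⊤ := by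
  obtain ⟨F, hF⟩ := (sphereHom L ρ).rangeRestrict_surjective f
  exact lt_of_le_of_lt (iInf₂_le F hF) (superSeminorm_lt_top hK n F)

theorem sphereSeminorm_smul_le (K : Set (SuperSpace L)) (n : ℕ) (c : ℂ) (f : HInfSphere L ρ) :
    sphereSeminorm K n (c • f) ≤ ENNReal.ofReal ‖c‖ * sphereSeminorm K n f := by
  rcases eq_or_ne c 0 with rfl | hc
  · rw [zero_smul]
    exact iInf₂_le_of_le 0 (map_zero _) ((superSeminorm_zero K n).le.trans bot_le)
  have h0 : ENNReal.ofReal ‖c‖ ≠ 0 := (ENNReal.ofReal_pos.mpr (norm_pos_iff.mpr hc)).ne'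
  simp only [sphereSeminorm, ENNReal.mul_iInf_of_ne h0 ENNReal.ofReal_ne_top]
  refine le_iInf₂ fun F hF => ?_
  subst hF
  exact iInf₂_le_of_le (c • F) (map_smul _ c F) (superSeminorm_smul_le K n c F)

theorem tendsto_frechet_iff {ι : Type*} {l : Filter ι} {u : ι → HInfSphere L ρ}
    {f : HInfSphere L ρ} : Filter.Tendsto u l (nhds f) ↔
      ∀ (K : Set (SuperSpace L)) (_ : IsCompact K) (n : ℕ),
        Filter.Tendsto (fun i => sphereSeminorm K n (u i - f)) l (nhds 0) := by
  have h : nhds f = ⨅ (K : {K : Set (SuperSpace L) // IsCompact K}) (n : ℕ),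
      @nhds _ (sphereEMetric ρ K.1 n).toUniformSpace.toTopologicalSpace f := by
    rw [frechetTopology, nhds_iInf]
    simp only [nhds_iInf]
  rw [h, Filter.tendsto_iInf, Subtype.forall]
  refine forall_congr' fun K => forall_congr' fun hK => ?_
  rw [Filter.tendsto_iInf]
  refine forall_congr' fun n => ?_
  letI := sphereEMetric ρ K n
  exact tendsto_iff_edist_tendsto_0

theorem tendsto_add_frechet {ι : Type*} {l : Filter ι} {u v : ι → HInfSphere L ρ}
    {f g : HInfSphere L ρ} (hu : Filter.Tendsto u l (nhds f)) (hv : Filter.Tendsto v l (nhds g)) :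
    Filter.Tendsto (fun i => u i + v i) l (nhds (f + g)) := by
  rw [tendsto_frechet_iff] at hu hv ⊢
  intro K hK n
  have h := (hu K hK n).add (hv K hK n)
  rw [add_zero] at h
  refine tendsto_of_tendsto_of_tendsto_of_le_of_le tendsto_const_nhds h (fun _ => bot_le)
    fun i => ?_
  dsimp only
  rw [add_sub_add_comm]
  exact sphereSeminorm_add K n _ _

/-- Write `c i • u i - a • f` as `c i • (u i - f) + (c i - a) • f`. The second term tends to zero
because the seminorms of `f` are finite, which uses the compactness of `K`. -/
theorem tendsto_smul_frechet {ι : Type*} {l : Filter ι} {u : ι → HInfSphere L ρ}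
    {f : HInfSphere L ρ} {c : ι → ℂ} {a : ℂ} (hu : Filter.Tendsto u l (nhds f))
    (hc : Filter.Tendsto c l (nhds a)) : Filter.Tendsto (fun i => c i • u i) l (nhds (a • f)) := by
  rw [tendsto_frechet_iff] at hu ⊢
  intro K hK n
  have h1 : Filter.Tendsto (fun i => ENNReal.ofReal ‖c i‖ * sphereSeminorm K n (u i - f)) l
      (nhds 0) := by
    have := ENNReal.Tendsto.mul (ENNReal.tendsto_ofReal hc.norm)
      (Or.inr ENNReal.zero_ne_top) (hu K hK n) (Or.inr ENNReal.ofReal_ne_top)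
    rwa [mul_zero] at this
  have h2 : Filter.Tendsto (fun i => ENNReal.ofReal ‖c i - a‖ * sphereSeminorm K n f) l
      (nhds 0) := by
    have h3 : Filter.Tendsto (fun i => ENNReal.ofReal ‖c i - a‖) l (nhds 0) := by
      have := ENNReal.tendsto_ofReal (tendsto_iff_norm_sub_tendsto_zero.mp hc)
      rwa [ENNReal.ofReal_zero] at this
    have := ENNReal.Tendsto.mul_const h3 (b := sphereSeminorm K n f)
      (Or.inr (sphereSeminorm_lt_top hK n f).ne)
    rwa [zero_mul] at this
  have h := h1.add h2
  rw [add_zero] at h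
  refine tendsto_of_tendsto_of_tendsto_of_le_of_le tendsto_const_nhds h (fun _ => bot_le)
    fun i => ?_
  have e : c i • u i - a • f = c i • (u i - f) + (c i - a) • f := by module
  dsimp only
  rw [e]
  exact (sphereSeminorm_add K n _ _).trans
    (add_le_add (sphereSeminorm_smul_le K n _ _) (sphereSeminorm_smul_le K n _ _))

end

/-! ### Asymptotics of the normalizations -/

/-- Passing from `m` to `m + 1` multiplies the quotient by `(q + m + 1) (q - m) / (q (q + 1))`,
which tends to one. -/
theorem tendsto_factorial_ratio (m : ℕ) : Filter.Tendsto
    (fun q : ℕ => ((q + m).factorial / ((q - m).factorial * (q * (q + 1)) ^ m) : ℝ))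
    Filter.atTop (nhds 1) := by
  induction m with
  | zero =>
    refine tendsto_const_nhds.congr fun q => ?_
    have : (q.factorial : ℝ) ≠ 0 := by positivity
    simp [this]
  | succ m ih =>
    have h1 : Filter.Tendsto (fun q : ℕ => ((1 + (m + 1) * (q : ℝ)⁻¹) * (1 - m * (q : ℝ)⁻¹) /
        (1 + (q : ℝ)⁻¹) : ℝ)) Filter.atTop (nhds ((1 + (m + 1) * 0) * (1 - m * 0) / (1 + 0))) := by
      have hi : Filter.Tendsto (fun q : ℕ => (q : ℝ)⁻¹) Filter.atTop (nhds 0) :=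
        tendsto_inv_atTop_nhds_zero_nat
      exact (((hi.const_mul _).const_add 1).mul ((hi.const_mul _).const_sub 1)).div
        (hi.const_add 1) (by norm_num)
    have h := ih.mul h1
    norm_num at h
    refine h.congr' ?_
    -- From here on the truncated differences inside the factorials are genuine.
    filter_upwards [Filter.eventually_ge_atTop (m + 1)] with q hq
    obtain ⟨r, rfl⟩ := Nat.exists_eq_add_of_le hq
    have e1 : m + 1 + r - m = r + 1 := by omega
    have e2 : m + 1 + r - (m + 1) = r := by omega
    have e3 : m + 1 + r + (m + 1) = m + 1 + r + m + 1 := by omega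
    rw [e1, e2, e3, Nat.factorial_succ (m + 1 + r + m), Nat.factorial_succ r]
    have h0 : (r.factorial : ℝ) ≠ 0 := by positivity
    push_cast
    have h1 : (m + 1 + r : ℝ) ≠ 0 := by positivity
    have h2 : (m + 1 + r + 1 : ℝ) ≠ 0 := by positivity
    have h3 : (r + 1 : ℝ) ≠ 0 := by positivity
    field_simp
    ring

/-- The scale of the generators. -/
def scale (ρ : ℝ) (q : ℕ) : ℝ := 2 * ρ / Real.sqrt (q * (q + 1))

/-- The ratio of the normalizations. -/
def ratio (ρ : ℝ) (q n : ℕ) : ℝ := scale ρ q ^ topDegree n * fieldConst ρ n / repConst q n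

theorem tendsto_scale (ρ : ℝ) : Filter.Tendsto (scale ρ) Filter.atTop (nhds 0) := by
  refine Filter.Tendsto.div_atTop tendsto_const_nhds (Real.tendsto_sqrt_atTop.comp ?_)
  have h : Filter.Tendsto (fun q : ℕ => (q : ℝ)) Filter.atTop Filter.atTop :=
    tendsto_natCast_atTop_atTop
  exact h.atTop_mul_atTop₀ (Filter.tendsto_atTop_add_const_right _ 1 h)

/-- The scale is chosen for this: the Casimir element of the rescaled representation gets its value
`ρ²` on the supersphere. For `q = 0` the scale is zero by the convention for division. -/
theorem scale_sq {ρ : ℝ} {q : ℕ} (hq : q ≠ 0) : scale ρ q ^ 2 * (q * (q + 1) / 4) = ρ ^ 2 := by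
  have h : (0 : ℝ) < q * (q + 1) := by
    have : (0 : ℝ) < q := by exact_mod_cast Nat.pos_of_ne_zero hq
    positivity
  rw [scale, div_pow, Real.sq_sqrt h.le]
  field_simp
  ring

theorem scale_pos {ρ : ℝ} (hρ : 0 < ρ) {q : ℕ} (hq : q ≠ 0) : 0 < scale ρ q := by
  have : (0 : ℝ) < q := by exact_mod_cast Nat.pos_of_ne_zero hq
  unfold scale
  positivity

theorem ratio_pos {ρ : ℝ} (hρ : 0 < ρ) {q : ℕ} (hq : q ≠ 0) (n : ℕ) : 0 < ratio ρ q n :=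
  div_pos (mul_pos (pow_pos (scale_pos hρ hq) _) (fieldConst_pos hρ n)) (repConst_pos q n)

theorem factorial_two_mul (k : ℕ) :
    ((2 * k).factorial : ℝ) = 2 ^ k * k.factorial * (2 * k - 1).doubleFactorial := by
  rcases k with _ | k
  · simp
  · have h := Nat.factorial_eq_mul_doubleFactorial (2 * k + 1)
    rw [show 2 * k + 1 + 1 = 2 * (k + 1) by ring, Nat.doubleFactorial_two_mul] at h
    rw [h, show 2 * (k + 1) - 1 = 2 * k + 1 by omega]
    push_cast
    ring

theorem factorial_two_mul_add_one (k : ℕ) :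
    ((2 * k + 1).factorial : ℝ) = 2 ^ k * k.factorial * (2 * k + 1).doubleFactorial := by
  have h := Nat.factorial_eq_mul_doubleFactorial (2 * k)
  rw [Nat.doubleFactorial_two_mul] at h
  rw [h]
  push_cast
  ring

/-- Squaring removes the roots; `ρ`, the powers of two and the factors depending on `k` alone cancel
by `factorial_two_mul`. -/
theorem ratio_sq_even {ρ : ℝ} (hρ : 0 < ρ) {q : ℕ} (hq : q ≠ 0) (k : ℕ) :
    ratio ρ q (2 * k) ^ 2 = (q + k).factorial / ((q - k).factorial * (q * (q + 1)) ^ k) := by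
  have hq' : (0 : ℝ) < q := by exact_mod_cast Nat.pos_of_ne_zero hq
  have h1 : 2 * k / 2 = k := by omega
  have h2 : 2 * k % 2 = 0 := by omega
  have hd : (0 : ℝ) < (2 * k - 1).doubleFactorial := by exact_mod_cast Nat.doubleFactorial_pos _
  have hs : (Real.sqrt (q * (q + 1)) ^ k) ^ 2 = (q * (q + 1)) ^ k := by
    rw [← pow_mul, mul_comm k 2, pow_mul, Real.sq_sqrt (by positivity)]
  rw [ratio, repConst, if_pos (even_two_mul k), fieldConst, scale, topDegree, h1, h2, div_pow,
    mul_pow, Real.sq_sqrt (by positivity), mul_zero, add_zero, div_pow, div_pow, div_pow, hs,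
    Real.sq_sqrt (by positivity), factorial_two_mul]
  field_simp
  ring

/-- The degree `k + 2` of the odd highest weight vector leaves one power of `q (q + 1)` more than
the factorials absorb; the prefactor `1 / (q + 1/2)` of the noncommutative normalization compensates
it in the limit. -/
theorem ratio_sq_odd {ρ : ℝ} (hρ : 0 < ρ) {q : ℕ} (hq : q ≠ 0) (k : ℕ) :
    ratio ρ q (2 * k + 1) ^ 2 = (q + (k + 1)).factorial /
      ((q - (k + 1)).factorial * (q * (q + 1)) ^ (k + 1)) * ((q + 1 / 2) ^ 2 / (q * (q + 1))) := by
  have hq' : (0 : ℝ) < q := by exact_mod_cast Nat.pos_of_ne_zero hq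
  have h1 : (2 * k + 1) / 2 = k := by omega
  have h2 : (2 * k + 1) % 2 = 1 := by omega
  have h3 : q - k - 1 = q - (k + 1) := by omega
  have hd : (0 : ℝ) < (2 * k + 1).doubleFactorial := by exact_mod_cast Nat.doubleFactorial_pos _
  have hs : (Real.sqrt (q * (q + 1)) ^ (k + 2)) ^ 2 = (q * (q + 1)) ^ (k + 2) := by
    rw [← pow_mul, mul_comm (k + 2) 2, pow_mul, Real.sq_sqrt (by positivity)]
  rw [ratio, repConst, if_neg (by simp), fieldConst, scale, topDegree, h1, h2, div_pow, mul_pow,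
    mul_pow, Real.sq_sqrt (by positivity), mul_one, div_pow, div_pow, div_pow, hs,
    Real.sq_sqrt (by positivity), factorial_two_mul_add_one, h3, add_assoc q]
  field_simp
  ring

theorem tendsto_ratio {ρ : ℝ} (hρ : 0 < ρ) (n : ℕ) :
    Filter.Tendsto (fun q => ratio ρ q n) Filter.atTop (nhds 1) := by
  have key : Filter.Tendsto (fun q => ratio ρ q n ^ 2) Filter.atTop (nhds 1) := by
    rcases Nat.even_or_odd' n with ⟨k, rfl | rfl⟩
    · refine (tendsto_factorial_ratio k).congr' ?_
      filter_upwards [Filter.eventually_ne_atTop 0] with q hq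
      rw [ratio_sq_even hρ hq]
    · have h1 : Filter.Tendsto (fun q : ℕ => ((1 + 1 / 2 * (q : ℝ)⁻¹) ^ 2 / (1 + (q : ℝ)⁻¹) : ℝ))
          Filter.atTop (nhds ((1 + 1 / 2 * 0) ^ 2 / (1 + 0))) := by
        have hi : Filter.Tendsto (fun q : ℕ => (q : ℝ)⁻¹) Filter.atTop (nhds 0) :=
          tendsto_inv_atTop_nhds_zero_nat
        exact (((hi.const_mul _).const_add 1).pow 2).div (hi.const_add 1) (by norm_num)
      have h := (tendsto_factorial_ratio (k + 1)).mul h1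
      rw [mul_zero, add_zero, one_pow, div_one, mul_one] at h
      refine h.congr' ?_
      filter_upwards [Filter.eventually_ne_atTop 0] with q hq
      have hq' : (q : ℝ) ≠ 0 := by exact_mod_cast hq
      have hq2 : (q + 1 : ℝ) ≠ 0 := by positivity
      rw [ratio_sq_odd hρ hq]
      congr 1
      field_simp
  have h := key.sqrt
  rw [Real.sqrt_one] at h
  refine h.congr' ?_
  filter_upwards [Filter.eventually_ne_atTop 0] with q hq
  exact Real.sqrt_sq (ratio_pos hρ hq n).le

/-! ### The graded-commutative limit -/

theorem polynomial_le_adjoin_gens :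
    Algebra.adjoin ℂ (Set.range Superfield.x ∪ Set.range Superfield.θ) ≤
      Algebra.adjoin ℂ fieldOsp.gens := by
  have hg : ∀ g ∈ fieldOsp.gens, g ∈ Algebra.adjoin ℂ fieldOsp.gens := fun g hg =>
    Algebra.subset_adjoin hg
  have hp := hg fieldOsp.xp (by simp [OspAlgebra.gens])
  have hm := hg fieldOsp.xm (by simp [OspAlgebra.gens])
  refine Algebra.adjoin_le ?_
  rintro _ (⟨k, rfl⟩ | ⟨α, rfl⟩)
  · have hk : k = 0 ∨ k = 1 ∨ k = 2 := by fin_cases k <;> simp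
    rcases hk with rfl | rfl | rfl
    · have e : Superfield.x 0 = (1 / 2 : ℂ) • (fieldOsp.xp + fieldOsp.xm) := by
        simp only [fieldOsp]
        module
      rw [e]
      exact Subalgebra.smul_mem _ (Subalgebra.add_mem _ hp hm) _
    · have e : Superfield.x 1 = (-Complex.I / 2) • (fieldOsp.xp - fieldOsp.xm) := by
        simp only [fieldOsp]
        match_scalars <;> ring_nf <;> norm_num
      rw [e]
      exact Subalgebra.smul_mem _ (Subalgebra.sub_mem _ hp hm) _
    · exact hg fieldOsp.x3 (by simp [OspAlgebra.gens])
  · have hα : α = 0 ∨ α = 1 := by fin_cases α <;> simp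
    rcases hα with rfl | rfl
    · exact hg fieldOsp.t4 (by simp [OspAlgebra.gens])
    · exact hg fieldOsp.t5 (by simp [OspAlgebra.gens])

section
variable {L : ℕ} {ρ : ℝ}

/-- On the supersphere `ε` and `C` become the constants `0` and `ρ²`; for `i = 0` the convention `0
^ 0 = 1` gives the right coefficient. -/
theorem restrict_monomial (hL : 1 ≤ L) (i j : ℕ) (F : Superfield) :
    restrict L ρ (fieldOsp.ε ^ i * fieldOsp.C ^ j * F) =
      ((0 : ℂ) ^ i * ((ρ : ℂ) ^ 2) ^ j) • restrict L ρ F := by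
  have hε : fieldOsp.ε ^ i = algebraMap ℂ Superfield ((0 : ℂ) ^ i) := by
    rw [map_pow, map_zero]
    rfl
  rw [map_mul, map_mul, hε, AlgHom.commutes, map_pow (restrict L ρ), restrict_fieldOsp_C hL,
    ← map_pow, ← map_mul, Algebra.smul_def]

theorem restrict_top_mem (hρ : 0 < ρ) {n q : ℕ} (hn : n ≤ 2 * q) (s : ℕ) :
    restrict L ρ ((fieldOsp.D5 ^ s) (fieldOsp.top n)) ∈ trunc L ρ q := by
  have hc : (fieldConst ρ n : ℂ) ≠ 0 := by exact_mod_cast (fieldConst_pos hρ n).ne'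
  have h := restrict_mem L hn (pow_mem_fieldModule ρ n s)
  rw [harmonicTop_pow, map_smul] at h
  exact (Submodule.smul_mem_iff _ hc).mp h

/-- By `adjoin_le_harmonicSpan` a polynomial is a combination of descendants over the polynomials in
`ε` and `C`, which are constant on the supersphere. -/
theorem exists_mem_trunc (hL : 1 ≤ L) (hρ : 0 < ρ) {f : HInfSphere L ρ} (hf : f ∈ PolSphere L ρ) :
    ∃ p, f ∈ trunc L ρ p := by
  obtain ⟨F, hF, rfl⟩ := hf
  have h := fieldOsp.adjoin_le_harmonicSpan (polynomial_le_adjoin_gens hF)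
  change ∃ p, restrict L ρ F ∈ _
  refine Submodule.span_induction ?_ ⟨0, by simp⟩ ?_ ?_ h
  · rintro _ ⟨i, j, n, s, rfl⟩
    refine ⟨n, ?_⟩
    simp only [restrict_monomial hL]
    exact Submodule.smul_mem _ _ (restrict_top_mem hρ (by omega) _)
  · rintro F G _ _ ⟨p, hp⟩ ⟨p', hp'⟩
    refine ⟨max p p', ?_⟩
    rw [map_add]
    exact Submodule.add_mem _ (trunc_mono L ρ (le_max_left _ _) hp)
      (trunc_mono L ρ (le_max_right _ _) hp')
  · rintro c F _ ⟨p, hp⟩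
    refine ⟨p, ?_⟩
    rw [map_smul]
    exact Submodule.smul_mem _ _ hp

end

/-- The algebra of superfields together with all endomorphism algebras. -/
def jointOsp (ρ : ℝ) : OspAlgebra (Superfield × ∀ q, RepEnd q) :=
  fieldOsp.prod (OspAlgebra.pi fun q => repOsp q (scale ρ q : ℂ))

/-- Projections are homomorphisms of deformed algebras, so a descendant in the product is the family
of the descendants in the factors. -/
theorem jointOsp_fst (ρ : ℝ) (n s : ℕ) : (((jointOsp ρ).D5 ^ s) ((jointOsp ρ).top n)).1 =
    (fieldOsp.D5 ^ s) (fieldOsp.top n) :=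
  (jointOsp ρ).map_D5_pow_top fieldOsp (AlgHom.fst ℂ Superfield (∀ q, RepEnd q)) (fun _ => rfl)
    rfl rfl rfl rfl rfl n s

theorem jointOsp_snd (ρ : ℝ) (n s q : ℕ) : (((jointOsp ρ).D5 ^ s) ((jointOsp ρ).top n)).2 q =
    ((repOsp q (scale ρ q : ℂ)).D5 ^ s) ((repOsp q (scale ρ q : ℂ)).top n) :=
  (jointOsp ρ).map_D5_pow_top (repOsp q (scale ρ q : ℂ))
    ((Pi.evalAlgHom ℂ RepEnd q).comp (AlgHom.snd ℂ Superfield (∀ q, RepEnd q))) (fun _ => rfl)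
    rfl rfl rfl rfl rfl n s

section
variable {L : ℕ} {ρ : ℝ}

/-- Rescaling the generators contributes `scale ρ q ^ topDegree n`; with the two normalizations this
makes up `ratio`. -/
theorem symbol_top {q : ℕ} {ψ : trunc L ρ q ≃ₗ[ℂ] RepEnd q}
    (hψ : SendsDescendants L ρ q ψ) {n : ℕ} (hn : n ≤ 2 * q) (s : ℕ) :
    symbol ψ (((repOsp q (scale ρ q : ℂ)).D5 ^ s) ((repOsp q (scale ρ q : ℂ)).top n)) =
      (ratio ρ q n : ℂ) • restrict L ρ ((fieldOsp.D5 ^ s) (fieldOsp.top n)) := by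
  have hr : (repConst q n : ℂ) ≠ 0 := by exact_mod_cast (repConst_pos q n).ne'
  have h : symbol ψ ((repAd q (.inr 1) ^ s) (ncHarmonicTop q n)) =
      restrict L ρ ((fieldJ (.inr 1) ^ s) (harmonicTop ρ n)) := by
    rw [← hψ n s hn, symbol_apply, LinearEquiv.symm_apply_apply]
    rfl
  rw [ncHarmonicTop_pow, harmonicTop_pow, map_smul, map_smul] at h
  have hD : (repOsp q (scale ρ q : ℂ)).D5 = (repOsp q 1).D5 := rfl
  rw [repOsp_top, hD, map_smul, map_smul]
  refine smul_right_injective _ hr ?_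
  dsimp only
  rw [smul_comm, h, smul_smul, smul_smul]
  congr 1
  rw [ratio]
  push_cast
  field_simp

/-- Pairs of a superfield and a family of endomorphisms converging to it. -/
def convergent (ψ : (q : ℕ) → trunc L ρ q ≃ₗ[ℂ] RepEnd q) :
    Submodule ℂ (Superfield × ∀ q, RepEnd q) where
  carrier := {Z | Filter.Tendsto (fun q => symbol (ψ q) (Z.2 q)) Filter.atTop
    (nhds (restrict L ρ Z.1))}
  add_mem' {Y Z} hY hZ := by
    have h := tendsto_add_frechet hY hZ
    simp only [← map_add] at h
    exact h
  zero_mem' := by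
    change Filter.Tendsto (fun q => symbol (ψ q) 0) _ (nhds (restrict L ρ 0))
    simp only [map_zero]
    exact tendsto_const_nhds
  smul_mem' c Z hZ := by
    have h := tendsto_smul_frechet hZ (tendsto_const_nhds (x := c))
    simp only [← map_smul] at h
    exact h

/-- For each spanning element, the symbols for large `q` and the limit are multiples of one fixed
function, so only the scalars `scale ^ i * ρ ^ (2 j) * ratio` have to converge. -/
theorem harmonicSpan_le_convergent (hL : 1 ≤ L) (hρ : 0 < ρ)
    {ψ : (q : ℕ) → trunc L ρ q ≃ₗ[ℂ] RepEnd q} (hψ : ∀ q, SendsDescendants L ρ q (ψ q)) :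
    (jointOsp ρ).harmonicSpan ≤ convergent ψ := by
  refine Submodule.span_le.mpr ?_
  rintro _ ⟨i, j, n, s, rfl⟩
  change Filter.Tendsto _ _ (nhds (restrict L ρ (fieldOsp.ε ^ i * fieldOsp.C ^ j * _)))
  rw [jointOsp_fst, restrict_monomial hL]
  have hc : Filter.Tendsto (fun q => ((scale ρ q : ℂ) ^ i * ((ρ : ℂ) ^ 2) ^ j * (ratio ρ q n : ℂ)))
      Filter.atTop (nhds ((0 : ℂ) ^ i * ((ρ : ℂ) ^ 2) ^ j * 1)) := by
    refine Filter.Tendsto.mul (Filter.Tendsto.mul_const _ (Filter.Tendsto.pow ?_ i)) ?_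
    · exact_mod_cast (Complex.continuous_ofReal.tendsto 0).comp (tendsto_scale ρ)
    · exact_mod_cast (Complex.continuous_ofReal.tendsto 1).comp (tendsto_ratio hρ n)
  rw [mul_one] at hc
  refine (tendsto_smul_frechet tendsto_const_nhds hc).congr' ?_
  -- The bound gives `n ≤ 2 q`, as `symbol_top` requires, and `q ≠ 0`, so that `C` is exactly `ρ²`.
  filter_upwards [Filter.eventually_ge_atTop (n + 1)] with q hq
  have hC : (repOsp q (scale ρ q : ℂ)).C = ((ρ : ℂ) ^ 2) • 1 := by
    have := scale_sq (ρ := ρ) (q := q) (by omega)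
    change ((scale ρ q : ℂ) ^ 2 * (q * (q + 1) / 4) : ℂ) • (1 : RepEnd q) = _
    congr 1
    have h := congrArg (fun x : ℝ => (x : ℂ)) this
    push_cast at h
    exact h
  have hε : (repOsp q (scale ρ q : ℂ)).ε = (scale ρ q : ℂ) • 1 := rfl
  change _ = symbol (ψ q) ((repOsp q (scale ρ q : ℂ)).ε ^ i * (repOsp q (scale ρ q : ℂ)).C ^ j * _)
  rw [jointOsp_snd, hC, hε, smul_pow, smul_pow, one_pow, one_pow, smul_mul_smul_comm, one_mul,
    smul_mul_assoc, one_mul, map_smul, symbol_top (hψ q) (by omega), smul_smul]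

/-- The lifts of a harmonic multiply in the limit like functions. -/
theorem tendsto_symbol_mul (hL : 1 ≤ L) (hρ : 0 < ρ)
    {ψ : (q : ℕ) → trunc L ρ q ≃ₗ[ℂ] RepEnd q} (hψ : ∀ q, SendsDescendants L ρ q (ψ q))
    (n s n' s' : ℕ) : Filter.Tendsto (fun q => symbol (ψ q)
      (((repOsp q (scale ρ q : ℂ)).D5 ^ s) ((repOsp q (scale ρ q : ℂ)).top n) *
        ((repOsp q (scale ρ q : ℂ)).D5 ^ s') ((repOsp q (scale ρ q : ℂ)).top n')))
      Filter.atTop (nhds (restrict L ρ ((fieldOsp.D5 ^ s) (fieldOsp.top n)) *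
        restrict L ρ ((fieldOsp.D5 ^ s') (fieldOsp.top n')))) := by
  -- The product of two joint descendants lies in the joint `harmonicSpan` and is thus a convergent
  -- pair; its components are the products of the components.
  have h := harmonicSpan_le_convergent hL hρ hψ ((jointOsp ρ).mul_mem_harmonicSpan
    ((jointOsp ρ).D5_pow_top_mem n s) ((jointOsp ρ).basic_mem n' s'))
  change Filter.Tendsto (fun q => symbol (ψ q) (_ * _)) _ (nhds (restrict L ρ (_ * _))) at h
  rw [map_mul, jointOsp_fst, jointOsp_fst] at h
  simpa only [jointOsp_snd] using h

/-- The lift of a harmonic to the endomorphism algebras. -/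
def lift (ρ : ℝ) (q n s : ℕ) : RepEnd q := (ratio ρ q n : ℂ)⁻¹ •
  ((repOsp q (scale ρ q : ℂ)).D5 ^ s) ((repOsp q (scale ρ q : ℂ)).top n)

theorem symbol_lift (hρ : 0 < ρ) {q : ℕ} (hq : q ≠ 0) {ψ : trunc L ρ q ≃ₗ[ℂ] RepEnd q}
    (hψ : SendsDescendants L ρ q ψ) {n : ℕ} (hn : n ≤ 2 * q) (s : ℕ) :
    symbol ψ (lift ρ q n s) = restrict L ρ ((fieldOsp.D5 ^ s) (fieldOsp.top n)) := by
  have hr : (ratio ρ q n : ℂ) ≠ 0 := by exact_mod_cast (ratio_pos hρ hq n).ne'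
  rw [lift, map_smul, symbol_top hψ hn, smul_smul, inv_mul_cancel₀ hr, one_smul]

theorem tendsto_symbol_lift_mul_lift (hL : 1 ≤ L) (hρ : 0 < ρ)
    {ψ : (q : ℕ) → trunc L ρ q ≃ₗ[ℂ] RepEnd q} (hψ : ∀ q, SendsDescendants L ρ q (ψ q))
    (n s n' s' : ℕ) : Filter.Tendsto (fun q => symbol (ψ q) (lift ρ q n s * lift ρ q n' s'))
      Filter.atTop (nhds (restrict L ρ ((fieldOsp.D5 ^ s) (fieldOsp.top n)) *
        restrict L ρ ((fieldOsp.D5 ^ s') (fieldOsp.top n')))) := by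
  have hr : ∀ n, Filter.Tendsto (fun q => (ratio ρ q n : ℂ)⁻¹) Filter.atTop (nhds 1) := by
    intro n
    have h : Filter.Tendsto (fun q => (ratio ρ q n : ℂ)) Filter.atTop (nhds 1) := by
      exact_mod_cast (Complex.continuous_ofReal.tendsto 1).comp (tendsto_ratio hρ n)
    simpa using h.inv₀ one_ne_zero
  have h := tendsto_smul_frechet (tendsto_symbol_mul hL hρ hψ n s n' s') ((hr n).mul (hr n'))
  rw [mul_one, one_smul] at h
  refine h.congr fun q => ?_
  rw [lift, lift, smul_mul_smul_comm, map_smul]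

theorem tendsto_sum_frechet {ι κ : Type*} {l : Filter ι} (t : Finset κ)
    {u : κ → ι → HInfSphere L ρ} {f : κ → HInfSphere L ρ}
    (hu : ∀ k ∈ t, Filter.Tendsto (u k) l (nhds (f k))) :
    Filter.Tendsto (fun i => ∑ k ∈ t, u k i) l (nhds (∑ k ∈ t, f k)) := by
  classical
  induction t using Finset.induction_on with
  | empty =>
    simp only [Finset.sum_empty]
    exact tendsto_const_nhds
  | insert k t hk ih =>
    simp only [Finset.sum_insert hk]
    exact tendsto_add_frechet (hu k (Finset.mem_insert_self _ _))
      (ih fun k' hk' => hu k' (Finset.mem_insert_of_mem hk'))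

theorem exists_eq_sum_of_mem_trunc {p : ℕ} {f : HInfSphere L ρ}
    (hf : f ∈ trunc L ρ p) : ∃ c : HarmonicIndex p → ℂ,
      f = ∑ i, c i • restrict L ρ ((fieldOsp.D5 ^ i.2.val) (fieldOsp.top i.1)) := by
  have h := span_truncElem L ρ p (Submodule.mem_top (x := (⟨f, hf⟩ : trunc L ρ p)))
  obtain ⟨c, hc⟩ := (Submodule.mem_span_range_iff_exists_fun ℂ).mp h
  refine ⟨fun i => c i * fieldConst ρ i.1, ?_⟩
  have h1 := congrArg (trunc L ρ p).subtype hc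
  rw [map_sum] at h1
  rw [show f = (trunc L ρ p).subtype ⟨f, hf⟩ from rfl, ← h1]
  refine Finset.sum_congr rfl fun i _ => ?_
  rw [map_smul]
  change c i • restrict L ρ _ = _
  rw [harmonicTop_pow, map_smul, smul_smul]

/-- The directed system of endomorphism algebras has a graded-commutative limit. -/
theorem hasGradedCommutativeLimit (hL : 1 ≤ L) (hρ : 0 < ρ)
    {ψ : (q : ℕ) → trunc L ρ q ≃ₗ[ℂ] RepEnd q} (hψ : ∀ q, SendsDescendants L ρ q (ψ q)) :
    HasGradedCommutativeLimit ψ := by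
  intro f hf f' hf'
  refine ⟨?_, fun p hp hp' => ?_⟩
  · obtain ⟨p, hp⟩ := exists_mem_trunc hL hρ hf
    obtain ⟨p', hp'⟩ := exists_mem_trunc hL hρ hf'
    exact ⟨max p p', trunc_mono L ρ (le_max_left _ _) hp, trunc_mono L ρ (le_max_right _ _) hp'⟩
  obtain ⟨c, hc⟩ := exists_eq_sum_of_mem_trunc hp
  obtain ⟨c', hc'⟩ := exists_eq_sum_of_mem_trunc hp'
  -- For `q ≥ p`, `q ≠ 0` this is the image under `ψ q` of the function with coefficients `c`,
  -- written with lifts so that a product expands into products of two lifts.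
  let Y : (HarmonicIndex p → ℂ) → (q : ℕ) → RepEnd q := fun c q =>
    ∑ i, c i • lift ρ q i.1 i.2
  have hY : ∀ (c : HarmonicIndex p → ℂ) (q : ℕ), q ≠ 0 → p ≤ q → symbol (ψ q) (Y c q) =
      ∑ i, c i • restrict L ρ ((fieldOsp.D5 ^ i.2.val) (fieldOsp.top i.1)) := by
    intro c q hq hpq
    rw [map_sum]
    refine Finset.sum_congr rfl fun i _ => ?_
    rw [map_smul, symbol_lift hρ hq (hψ q) (by omega)]
  have hlim : Filter.Tendsto (fun q => symbol (ψ q) (Y c q * Y c' q)) Filter.atTop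
      (nhds (f * f')) := by
    rw [hc, hc', Finset.sum_mul_sum]
    simp only [Y, Finset.sum_mul_sum, map_sum, smul_mul_smul_comm, map_smul]
    exact tendsto_sum_frechet _ fun i _ => tendsto_sum_frechet _ fun j _ =>
      tendsto_smul_frechet (tendsto_symbol_lift_mul_lift hL hρ hψ _ _ _ _) tendsto_const_nhds
  refine ((Filter.tendsto_comp_val_Ici_atTop (a := p)).mpr hlim).congr' ?_
  -- The bound is `p + 1` because `p` may be zero, and `symbol_lift` requires `q ≠ 0`.
  filter_upwards [Filter.eventually_ge_atTop (⟨p + 1, by simp⟩ : Set.Ici p)] with q hq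
  have hq' : p + 1 ≤ q.1 := hq
  have e : ψ q ⟨f, trunc_mono L ρ q.2 hp⟩ = Y c q :=
    eq_of_symbol_eq (hc.trans (hY c q (by omega) q.2).symm)
  have e' : ψ q ⟨f', trunc_mono L ρ q.2 hp'⟩ = Y c' q :=
    eq_of_symbol_eq (hc'.trans (hY c' q (by omega) q.2).symm)
  rw [truncProd, e, e', symbol_apply]

end

end FuzzySupersphere

end

theorem proposition3 (L : ℕ) (hL : 2 ≤ L) (ρ : ℝ) (hρ : 0 < ρ) :
    (∀ q : ℕ, ∃! ψ : FuzzySupersphere.trunc L ρ q ≃ₗ[ℂ] FuzzySupersphere.RepEnd q,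
      FuzzySupersphere.SendsHarmonics L ρ q ψ) ∧
    ∀ ψ : (q : ℕ) → FuzzySupersphere.trunc L ρ q ≃ₗ[ℂ] FuzzySupersphere.RepEnd q,
      (∀ q, FuzzySupersphere.SendsHarmonics L ρ q (ψ q)) →
        (∀ q, FuzzySupersphere.IsEvenMap L ρ q (ψ q) ∧
          FuzzySupersphere.IsModuleHom L ρ q (ψ q)) ∧
        DirectedSystem FuzzySupersphere.RepEnd
          (fun _ _ h => FuzzySupersphere.connect ψ h) ∧
        FuzzySupersphere.HasGradedCommutativeLimit ψ := by
  refine ⟨fun q => FuzzySupersphere.existsUnique_sendsHarmonics hL hρ q, fun ψ hψ => ?_⟩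
  have hψ' := fun q => FuzzySupersphere.sendsHarmonics_iff.mp (hψ q)
  exact ⟨fun q => ⟨(hψ' q).isEvenMap, (hψ' q).isModuleHom⟩,
    FuzzySupersphere.directedSystem_connect ψ,
    FuzzySupersphere.hasGradedCommutativeLimit (by omega) hρ hψ'⟩
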